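/- **Games.** A *game* $A$ is a set $M_A$ of moves with a polarity map $\lambda_A:M_A\to\{-1,+1\}$ ($-1$: Opponent, $+1$: Proponent) and a partial order $\le_A$ such that every move has finitely many predecessors. $A\otimes B$ is the disjoint union (of moves, polarities and orders), $A^*$ is $A$ with inverted polarities, and $A\multimap B=A^*\otimes B$. A game is *filiform* when $\le_A$ is total. A *strategy* on $A$ is a partial order $\le_\sigma$ on $M_A$ such that $m<_\sigma n$ implies $\lambda_A(m)=-1$ and $\lambda_A(n)=+1$, and such that the transitive closure of $\le_\sigma\cup\le_A$ is a partial order. A *cyclic strategy* on $A$ is a reflexive transitive relation $\sigma$ on $M_A$ such that $m\,\sigma\,n$ and $m\ne n$ imply $\lambda_A(m)=-1$ and $\lambda_A(n)=+1$. Games and cyclic strategies on $A\multimap B$ (as morphisms $A\to B$) form a category: the composite of $\sigma:A\to B$ and $\tau:B\to C$ is the restriction to $M_A\uplus M_C$ of the transitive closure of $\sigma\cup\tau$ on $M_A\uplus M_B\uplus M_C$, and the identity relates the two copies of each move, in the direction imposed by polarities. $\mathbf{Games}$ is the subcategory of it whose objects are the finite filiform games and whose morphisms are generated, under composition, by the strategies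 on the games $A\multimap B$. It is a monoidal category for the product "$A$ before $B$" ($A\otimes B$ in which moreover every move of $A$ is below every move of $B$; on morphisms, the disjoint union of relations), whose unit $I$ is the empty game; associators and unitors are the evident relabellings of disjoint unions. **Presentations.** A *monoidal equational theory* consists of a set of atomic types, a set of generators whose sources and targets are words of atomic types, and a set of relations between parallel morphisms of the free strict monoidal category on these generators. It *generates* the strict monoidal category whose objects are the words and whose morphisms are the formal composites and tensor products of generators, modulo the laws of strict monoidal categories and the smallest congruence (for composition and tensor) containing the relations. It *presents* a monoidal category $\mathcal M$ when $\mathcal M$ is monoidally equivalent to the category it generates (monoidal functors in both directions, whose composites are related to the identities by invertible monoidal natural transformations). **The theory $\mathfrak G$.** It has two atomic types $O$, $P$ and thirteen generators (words are written as juxtapositions) $$\mu^X:XX\to X,\quad \eta^X:I\to X,\quad \delta^X:X\to XX,\quad \varepsilon^X:X\to I,\quad \gamma^X:XX\to XX\qquad(X\in\{O,P\}),$$ $$\eta^{OP}:I\to OP,\qquad \varepsilon^{OP}:PO\to I,\qquad \gamma^{OP}:PO\to OP .$$ Its relations state the following. 1. $(O,\mu^O,\eta^O,\delta^O,\varepsilon^O,\gamma^O)$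 is a qualitative bicommutative bialgebra. That is (dropping the superscripts, and writing $O$ for $\mathrm{id}_O$): * $(\gamma\otimes O)(O\otimes\gamma)(\gamma\otimes O)=(O\otimes\gamma)(\gamma\otimes O)(O\otimes\gamma)$ and $\gamma\gamma=\mathrm{id}$; * $\mu(\mu\otimes O)=\mu(O\otimes\mu)$, $\mu(\eta\otimes O)=O=\mu(O\otimes\eta)$, $\mu\gamma=\mu$, $\gamma(\mu\otimes O)=(O\otimes\mu)(\gamma\otimes O)(O\otimes\gamma)$, $\gamma(O\otimes\mu)=(\mu\otimes O)(O\otimes\gamma)(\gamma\otimes O)$, $\gamma(\eta\otimes O)=O\otimes\eta$, $\gamma(O\otimes\eta)=\eta\otimes O$; * the eight dual equations for $\delta,\varepsilon,\gamma$; * $\delta\mu=(\mu\otimes\mu)(O\otimes\gamma\otimes O)(\delta\otimes\delta)$, $\varepsilon\mu=\varepsilon\otimes\varepsilon$, $\delta\eta=\eta\otimes\eta$, $\varepsilon\eta=\mathrm{id}_I$; * $\mu\delta=O$. 2. $P$ is left dual to $O$: $(\varepsilon^{OP}\otimes P)(P\otimes\eta^{OP})=P$ and $(O\otimes\varepsilon^{OP})(\eta^{OP}\otimes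 O)=O$. 3. The other generators are the transposes of the Opponent structure under this duality. With $\eta_2=(O\otimes\eta^{OP}\otimes P)\,\eta^{OP}:I\to OOPP$ and $\varepsilon_2=\varepsilon^{OP}(P\otimes\varepsilon^{OP}\otimes O):PPOO\to I$: $$\mu^P=(\varepsilon_2\otimes P)(PP\otimes\delta^O\otimes P)(PP\otimes\eta^{OP}),\qquad \delta^P=(\varepsilon^{OP}\otimes PP)(P\otimes\mu^O\otimes PP)(P\otimes\eta_2),$$ $$\eta^P=(\varepsilon^O\otimes P)\eta^{OP},\qquad \varepsilon^P=\varepsilon^{OP}(P\otimes\eta^O),$$ $$\gamma^P=(\varepsilon_2\otimes PP)(PP\otimes\gamma^O\otimes PP)(PP\otimes\eta_2),\qquad \gamma^{OP}=(\varepsilon^{OP}\otimes OP)(P\otimes\gamma^O\otimes P)(PO\otimes\eta^{OP}).$$ **Theorem.** The monoidal category $\mathbf{Games}$ (with the "before" tensor product) is presented by the equational theory $\mathfrak G$. -/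

import Mathlib

open CategoryTheory

namespace Causality

/-! ### Monoidal equational theories and the monoidal categories they generate -/

/-- A signature: atomic types (generators for objects) and typed generators for morphisms.
Types are words on the atomic types, i.e. elements of the free monoid. -/
structure Signature where
  Atom : Type
  Gen : Type
  src : Gen → List Atom
  tgt : Gen → List Atom

/-- Formal composites and tensor products of generators. -/
inductive Term (S : Signature) : List S.Atom → List S.Atom → Type
  | id (A : List S.Atom) : Term S A A
  | gen (g : S.Gen) : Term S (S.src g) (S.tgt g)
  | comp {A B C : List S.Atom} (f : Term S A B) (g : Term S B C) : Term S A C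
  | tensor {A B C D : List S.Atom} (f : Term S A B) (g : Term S C D) : Term S (A ++ C) (B ++ D)

/-- Transport of a term along equalities of words. -/
def Term.cast {S : Signature} {A B A' B' : List S.Atom} (hA : A = A') (hB : B = B')
    (f : Term S A B) : Term S A' B' :=
  hA ▸ hB ▸ f

/-- Diagrammatic composition: `f ⨟ g` is `g ∘ f`. -/
local notation:70 f:71 " ⨟ " g:70 => (Term.comp f g :)

local notation:75 f:76 " ⊠ " g:75 => (Term.tensor f g :)

/-- A monoidal equational theory: a signature and a set of relations between parallel morphisms
of the category generated by the signature (given by representing terms). -/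
structure Theory where
  sig : Signature
  rel : ∀ {A B : List sig.Atom}, Term sig A B → Term sig A B → Prop

/-- Equality of terms in the strict monoidal category generated by a theory: the smallest
congruence, with respect to composition and tensor product, containing the laws of strict
monoidal categories and the relations of the theory. -/
inductive Theory.Eqv (T : Theory) : ∀ {A B : List T.sig.Atom},
    Term T.sig A B → Term T.sig A B → Prop
  | refl {A B} (f : Term T.sig A B) : Theory.Eqv T f f
  | symm {A B} {f g : Term T.sig A B} : Theory.Eqv T f g → Theory.Eqv T g f
  | trans {A B} {f g h : Term T.sig A B} :
      Theory.Eqv T f g → Theory.Eqv T g h → Theory.Eqv T f h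
  | comp {A B C} {f f' : Term T.sig A B} {g g' : Term T.sig B C} :
      Theory.Eqv T f f' → Theory.Eqv T g g' → Theory.Eqv T (f ⨟ g) (f' ⨟ g')
  | tensor {A B C D} {f f' : Term T.sig A B} {g g' : Term T.sig C D} :
      Theory.Eqv T f f' → Theory.Eqv T g g' → Theory.Eqv T (f ⊠ g) (f' ⊠ g')
  | id_comp {A B} (f : Term T.sig A B) : Theory.Eqv T (Term.id A ⨟ f) f
  | comp_id {A B} (f : Term T.sig A B) : Theory.Eqv T (f ⨟ Term.id B) f
  | assoc {A B C D} (f : Term T.sig A B) (g : Term T.sig B C) (h : Term T.sig C D) :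
      Theory.Eqv T ((f ⨟ g) ⨟ h) (f ⨟ (g ⨟ h))
  | tensor_id (A B) : Theory.Eqv T (Term.id A ⊠ Term.id B) (Term.id (A ++ B))
  | interchange {A B C A' B' C'} (f : Term T.sig A B) (g : Term T.sig B C)
      (f' : Term T.sig A' B') (g' : Term T.sig B' C') :
      Theory.Eqv T ((f ⊠ f') ⨟ (g ⊠ g')) ((f ⨟ g) ⊠ (f' ⨟ g'))
  | unit_tensor {A B} (f : Term T.sig A B) : Theory.Eqv T (Term.id [] ⊠ f) f
  | tensor_unit {A B} (f : Term T.sig A B) :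
      Theory.Eqv T ((f ⊠ Term.id []).cast (List.append_nil A) (List.append_nil B)) f
  | tensor_assoc {A B C A' B' C'} (f : Term T.sig A A') (g : Term T.sig B B')
      (h : Term T.sig C C') :
      Theory.Eqv T
        (((f ⊠ g) ⊠ h).cast (List.append_assoc A B C) (List.append_assoc A' B' C'))
        (f ⊠ (g ⊠ h))
  | rel {A B} {f g : Term T.sig A B} : T.rel f g → Theory.Eqv T f g

def Theory.setoid (T : Theory) (A B : List T.sig.Atom) : Setoid (Term T.sig A B) :=
  ⟨T.Eqv, ⟨.refl, .symm, .trans⟩⟩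

/-- The objects of the category generated by a theory: words on the atomic types. -/
@[ext]
structure Presented (T : Theory) where
  word : List T.sig.Atom

namespace Presented

variable {T : Theory}

instance : Category (Presented T) where
  Hom A B := Quotient (T.setoid A.word B.word)
  id A := Quotient.mk _ (Term.id A.word)
  comp f g := Quotient.map₂ Term.comp (fun _ _ h _ _ k => Theory.Eqv.comp h k) f g
  id_comp f := Quotient.inductionOn f fun f => Quotient.sound (.id_comp f)
  comp_id f := Quotient.inductionOn f fun f => Quotient.sound (.comp_id f)
  assoc f g h := Quotient.inductionOn₃ f g h fun f g h => Quotient.sound (.assoc f g h)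

/-- The morphism represented by a term. -/
def ofTerm {A B : List T.sig.Atom} (f : Term T.sig A B) :
    (⟨A⟩ : Presented T) ⟶ (⟨B⟩ : Presented T) :=
  Quotient.mk (T.setoid A B) f

theorem ofTerm_cast {A B A' B' : List T.sig.Atom} (hA : A = A') (hB : B = B')
    (f : Term T.sig A B) :
    (ofTerm (f.cast hA hB) : (⟨A'⟩ : Presented T) ⟶ ⟨B'⟩) =
      eqToHom (by rw [hA]) ≫ ofTerm f ≫ eqToHom (by rw [hB]) := by
  subst hA hB
  simp [Term.cast]

/-- Tensor product of morphisms. -/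
def tens {A B C D : Presented T} (f : A ⟶ B) (g : C ⟶ D) :
    (⟨A.word ++ C.word⟩ : Presented T) ⟶ ⟨B.word ++ D.word⟩ :=
  Quotient.map₂ (sa := T.setoid A.word B.word) (sb := T.setoid C.word D.word)
    (sc := T.setoid (A.word ++ C.word) (B.word ++ D.word))
    Term.tensor (fun _ _ h _ _ k => Theory.Eqv.tensor h k) f g

theorem tens_id (A B : Presented T) : tens (𝟙 A) (𝟙 B) = 𝟙 _ :=
  Quotient.sound (.tensor_id A.word B.word)

theorem tens_comp {A B C A' B' C' : Presented T} (f : A ⟶ B) (f' : A' ⟶ B') (g : B ⟶ C)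
    (g' : B' ⟶ C') : tens f f' ≫ tens g g' = tens (f ≫ g) (f' ≫ g') := by
  induction f using Quotient.inductionOn
  induction g using Quotient.inductionOn
  induction f' using Quotient.inductionOn
  induction g' using Quotient.inductionOn
  exact Quotient.sound (.interchange _ _ _ _)

theorem tens_eqToHom {A B C D : Presented T} (h : A = B) (k : C = D) :
    tens (eqToHom h) (eqToHom k) = eqToHom (by rw [h, k]) := by
  subst h k
  exact tens_id _ _

/-- The generated category is strict monoidal: associators and unitors are identities. -/
instance : MonoidalCategoryStruct (Presented T) where
  tensorObj A B := ⟨A.word ++ B.word⟩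
  tensorUnit := ⟨[]⟩
  tensorHom f g := tens f g
  whiskerLeft A _ _ f := tens (𝟙 A) f
  whiskerRight f A := tens f (𝟙 A)
  associator A B C := eqToIso (congrArg Presented.mk (List.append_assoc A.word B.word C.word))
  leftUnitor _ := Iso.refl _
  rightUnitor A := eqToIso (congrArg Presented.mk (List.append_nil A.word))

instance : MonoidalCategory (Presented T) :=
  MonoidalCategory.ofTensorHom
    (id_tensorHom_id := fun A B => tens_id A B)
    (id_tensorHom := fun _ _ _ _ => rfl)
    (tensorHom_id := fun _ _ => rfl)
    (tensorHom_comp_tensorHom := fun f₁ f₂ g₁ g₂ => tens_comp f₁ f₂ g₁ g₂)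
    (associator_naturality := by
      intro A B C A' B' C' f g h
      induction f using Quotient.inductionOn with | _ f
      induction g using Quotient.inductionOn with | _ g
      induction h using Quotient.inductionOn with | _ h
      have key : ofTerm (((f ⊠ g) ⊠ h).cast (List.append_assoc _ _ _) (List.append_assoc _ _ _)) =
          ofTerm (T := T) (f ⊠ (g ⊠ h)) := Quotient.sound (.tensor_assoc f g h)
      rw [ofTerm_cast] at key
      change ofTerm ((f ⊠ g) ⊠ h) ≫
          eqToHom (congrArg Presented.mk (List.append_assoc A'.word B'.word C'.word)) =
        eqToHom (congrArg Presented.mk (List.append_assoc A.word B.word C.word)) ≫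
          ofTerm (f ⊠ (g ⊠ h))
      rw [← key]
      simp)
    (leftUnitor_naturality := by
      intro A B f
      induction f using Quotient.inductionOn with | _ f
      have key : ofTerm (Term.id [] ⊠ f) = ofTerm (T := T) f := Quotient.sound (.unit_tensor f)
      change ofTerm (Term.id [] ⊠ f) ≫ 𝟙 _ = 𝟙 _ ≫ ofTerm f
      rw [key, Category.id_comp, Category.comp_id])
    (rightUnitor_naturality := by
      intro A B f
      induction f using Quotient.inductionOn with | _ f
      have key : ofTerm ((f ⊠ Term.id []).cast (List.append_nil _) (List.append_nil _)) =
          ofTerm (T := T) f := Quotient.sound (.tensor_unit f)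
      rw [ofTerm_cast] at key
      change ofTerm (f ⊠ Term.id []) ≫ eqToHom (congrArg Presented.mk (List.append_nil B.word)) =
        eqToHom (congrArg Presented.mk (List.append_nil A.word)) ≫ ofTerm f
      rw [← key]
      simp)
    (pentagon := by
      intro W X Y Z
      have h₁ : ∀ A B C : Presented T, (MonoidalCategoryStruct.associator A B C).hom =
        eqToHom (congrArg Presented.mk (List.append_assoc A.word B.word C.word)) := fun _ _ _ => rfl
      have h₂ : ∀ {A B C D : Presented T} (f : A ⟶ B) (g : C ⟶ D),
        MonoidalCategoryStruct.tensorHom f g = tens f g := fun _ _ => rfl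
      simp only [h₁, h₂, ← eqToHom_refl _ rfl]
      rw [tens_eqToHom, tens_eqToHom]
      erw [eqToHom_trans, eqToHom_trans, eqToHom_trans])
    (triangle := by
      intro X Y
      have h := tens_eqToHom (T := T) (congrArg Presented.mk (List.append_nil X.word))
        (Eq.refl Y)
      refine Eq.trans ?_ h.symm
      refine (congrArg (_ ≫ ·) (tens_id X Y)).trans ?_
      exact Category.comp_id _)

end Presented

/-- A theory presents a monoidal category when the category it generates is monoidally
equivalent to it: there are monoidal functors in both directions, with invertible monoidal
natural transformations between their composites and the identities. -/
def Theory.Presents (T : Theory) (C : Type*) [Category C] [MonoidalCategory C] : Prop :=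
  ∃ (e : Presented T ≌ C) (_ : e.functor.Monoidal) (_ : e.inverse.Monoidal),
    NatTrans.IsMonoidal e.unitIso.hom ∧ NatTrans.IsMonoidal e.counitIso.hom

/-! ### The equational theory of strategies -/

/-- The relations of a qualitative bicommutative bialgebra on an atomic type `X`. -/
inductive BialgebraRel {S : Signature} (X : S.Atom)
    (μ : Term S [X, X] [X]) (η : Term S [] [X]) (δ : Term S [X] [X, X]) (ε : Term S [X] [])
    (γ : Term S [X, X] [X, X]) : ∀ {A B : List S.Atom}, Term S A B → Term S A B → Prop
  -- `γ` is a symmetry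
  | yang_baxter : BialgebraRel X μ η δ ε γ
      (A := [X, X, X]) (B := [X, X, X])
      (γ ⊠ Term.id (S := S) [X] ⨟ Term.id (S := S) [X] ⊠ γ ⨟ γ ⊠ Term.id (S := S) [X])
      (Term.id (S := S) [X] ⊠ γ ⨟ γ ⊠ Term.id (S := S) [X] ⨟ Term.id (S := S) [X] ⊠ γ)
  | sym_sym : BialgebraRel X μ η δ ε γ (γ ⨟ γ) (Term.id (S := S) [X, X])
  -- `(μ, η, γ)` is a commutative monoid
  | mul_assoc : BialgebraRel X μ η δ ε γ
      (A := [X, X, X]) (B := [X])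
      (μ ⊠ Term.id (S := S) [X] ⨟ μ) (Term.id (S := S) [X] ⊠ μ ⨟ μ)
  | unit_mul : BialgebraRel X μ η δ ε γ (A := [X]) (B := [X]) (η ⊠ Term.id (S := S) [X] ⨟ μ) (Term.id (S := S) [X])
  | mul_unit : BialgebraRel X μ η δ ε γ (A := [X]) (B := [X]) (Term.id (S := S) [X] ⊠ η ⨟ μ) (Term.id (S := S) [X])
  | mul_sym_left : BialgebraRel X μ η δ ε γ
      (A := [X, X, X]) (B := [X, X])
      (μ ⊠ Term.id (S := S) [X] ⨟ γ) (Term.id (S := S) [X] ⊠ γ ⨟ γ ⊠ Term.id (S := S) [X] ⨟ Term.id (S := S) [X] ⊠ μ)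
  | mul_sym_right : BialgebraRel X μ η δ ε γ
      (A := [X, X, X]) (B := [X, X])
      (Term.id (S := S) [X] ⊠ μ ⨟ γ) (γ ⊠ Term.id (S := S) [X] ⨟ Term.id (S := S) [X] ⊠ γ ⨟ μ ⊠ Term.id (S := S) [X])
  | unit_sym_left : BialgebraRel X μ η δ ε γ
      (A := [X]) (B := [X, X]) (η ⊠ Term.id (S := S) [X] ⨟ γ) (Term.id (S := S) [X] ⊠ η)
  | unit_sym_right : BialgebraRel X μ η δ ε γ
      (A := [X]) (B := [X, X]) (Term.id (S := S) [X] ⊠ η ⨟ γ) (η ⊠ Term.id (S := S) [X])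
  | mul_comm : BialgebraRel X μ η δ ε γ (γ ⨟ μ) μ
  -- `(δ, ε, γ)` is a cocommutative comonoid
  | comul_assoc : BialgebraRel X μ η δ ε γ
      (A := [X]) (B := [X, X, X])
      (δ ⨟ δ ⊠ Term.id (S := S) [X]) (δ ⨟ Term.id (S := S) [X] ⊠ δ)
  | counit_comul : BialgebraRel X μ η δ ε γ (A := [X]) (B := [X]) (δ ⨟ ε ⊠ Term.id (S := S) [X]) (Term.id (S := S) [X])
  | comul_counit : BialgebraRel X μ η δ ε γ (A := [X]) (B := [X]) (δ ⨟ Term.id (S := S) [X] ⊠ ε) (Term.id (S := S) [X])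
  | comul_sym_left : BialgebraRel X μ η δ ε γ
      (A := [X, X]) (B := [X, X, X])
      (γ ⨟ δ ⊠ Term.id (S := S) [X]) (Term.id (S := S) [X] ⊠ δ ⨟ γ ⊠ Term.id (S := S) [X] ⨟ Term.id (S := S) [X] ⊠ γ)
  | comul_sym_right : BialgebraRel X μ η δ ε γ
      (A := [X, X]) (B := [X, X, X])
      (γ ⨟ Term.id (S := S) [X] ⊠ δ) (δ ⊠ Term.id (S := S) [X] ⨟ Term.id (S := S) [X] ⊠ γ ⨟ γ ⊠ Term.id (S := S) [X])
  | counit_sym_left : BialgebraRel X μ η δ ε γ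
      (A := [X, X]) (B := [X]) (γ ⨟ ε ⊠ Term.id (S := S) [X]) (Term.id (S := S) [X] ⊠ ε)
  | counit_sym_right : BialgebraRel X μ η δ ε γ
      (A := [X, X]) (B := [X]) (γ ⨟ Term.id (S := S) [X] ⊠ ε) (ε ⊠ Term.id (S := S) [X])
  | comul_comm : BialgebraRel X μ η δ ε γ (δ ⨟ γ) δ
  -- compatibility of the monoid and the comonoid
  | hopf : BialgebraRel X μ η δ ε γ
      (μ ⨟ δ) (δ ⊠ δ ⨟ Term.id (S := S) [X] ⊠ γ ⊠ Term.id (S := S) [X] ⨟ μ ⊠ μ)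
  | mul_counit : BialgebraRel X μ η δ ε γ (μ ⨟ ε) (ε ⊠ ε)
  | unit_comul : BialgebraRel X μ η δ ε γ (η ⨟ δ) (η ⊠ η)
  | unit_counit : BialgebraRel X μ η δ ε γ (η ⨟ ε) (Term.id (S := S) [])
  -- the bialgebra is qualitative
  | qualitative : BialgebraRel X μ η δ ε γ (δ ⨟ μ) (Term.id (S := S) [X])

/-- `L` is left dual to `R`, with unit `η` and counit `ε`. -/
inductive DualityRel {S : Signature} (L R : S.Atom)
    (η : Term S [] [R, L]) (ε : Term S [L, R] []) :
    ∀ {A B : List S.Atom}, Term S A B → Term S A B → Prop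
  | zigzag_left : DualityRel L R η ε (A := [L]) (B := [L])
      (Term.id (S := S) [L] ⊠ η ⨟ ε ⊠ Term.id (S := S) [L]) (Term.id (S := S) [L])
  | zigzag_right : DualityRel L R η ε (A := [R]) (B := [R])
      (η ⊠ Term.id (S := S) [R] ⨟ Term.id (S := S) [R] ⊠ ε) (Term.id (S := S) [R])

/-- The two polarities, Opponent (`-1`) and Proponent (`+1`); they also serve as the two atomic
types of the theory of strategies. -/
inductive Polarity
  | O
  | P

open Polarity

def Polarity.neg : Polarity → Polarity
  | O => P
  | P => O

/-- The thirteen generators. -/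
inductive StratGen
  | muO | etaO | deltaO | epsO | gammaO
  | muP | etaP | deltaP | epsP | gammaP
  | etaOP | epsOP | gammaOP

/-- Sources and targets of the thirteen generators. -/
abbrev stratSig : Signature where
  Atom := Polarity
  Gen := StratGen
  src
    | .muO => [O, O]
    | .etaO => []
    | .deltaO => [O]
    | .epsO => [O]
    | .gammaO => [O, O]
    | .muP => [P, P]
    | .etaP => []
    | .deltaP => [P]
    | .epsP => [P]
    | .gammaP => [P, P]
    | .etaOP => []
    | .epsOP => [P, O]
    | .gammaOP => [P, O]
  tgt
    | .muO => [O]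
    | .etaO => [O]
    | .deltaO => [O, O]
    | .epsO => []
    | .gammaO => [O, O]
    | .muP => [P]
    | .etaP => [P]
    | .deltaP => [P, P]
    | .epsP => []
    | .gammaP => [P, P]
    | .etaOP => [O, P]
    | .epsOP => []
    | .gammaOP => [O, P]

namespace StratGen

def μO : Term stratSig [O, O] [O] := .gen (S := stratSig) muO
def ηO : Term stratSig [] [O] := .gen (S := stratSig) etaO
def δO : Term stratSig [O] [O, O] := .gen (S := stratSig) deltaO
def εO : Term stratSig [O] [] := .gen (S := stratSig) epsO
def γO : Term stratSig [O, O] [O, O] := .gen (S := stratSig) gammaO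
def μP : Term stratSig [P, P] [P] := .gen (S := stratSig) muP
def ηP : Term stratSig [] [P] := .gen (S := stratSig) etaP
def δP : Term stratSig [P] [P, P] := .gen (S := stratSig) deltaP
def εP : Term stratSig [P] [] := .gen (S := stratSig) epsP
def γP : Term stratSig [P, P] [P, P] := .gen (S := stratSig) gammaP
def ηOP : Term stratSig [] [O, P] := .gen (S := stratSig) etaOP
def εOP : Term stratSig [P, O] [] := .gen (S := stratSig) epsOP
def γOP : Term stratSig [P, O] [O, P] := .gen (S := stratSig) gammaOP

/-- The identity of a word, written as in string diagrams. -/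
abbrev wire (A : List Polarity) : Term stratSig A A := .id (S := stratSig) A

/-- The unit of the duality between the words `OO` and `PP`. -/
def ηOOPP : Term stratSig [] [O, O, P, P] := ηOP ⨟ (wire [O] ⊠ ηOP ⊠ wire [P])

/-- The counit of the duality between the words `OO` and `PP`. -/
def εPPOO : Term stratSig [P, P, O, O] [] := (wire [P] ⊠ εOP ⊠ wire [O]) ⨟ εOP

end StratGen

open StratGen

/-- The relations of the theory of strategies. -/
inductive StratRel : ∀ {A B : List Polarity},
    Term stratSig A B → Term stratSig A B → Prop
  | opponent {A B : List Polarity} {f g : Term stratSig A B} :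
      BialgebraRel (S := stratSig) O μO ηO δO εO γO f g → StratRel f g
  | duality {A B : List Polarity} {f g : Term stratSig A B} :
      DualityRel (S := stratSig) P O ηOP εOP f g → StratRel f g
  -- the Proponent structure and the mixed crossing are the mates of the Opponent structure
  | mul_P : StratRel μP
      ((wire [P, P] ⊠ ηOP) ⨟ (wire [P, P] ⊠ δO ⊠ wire [P]) ⨟ (εPPOO ⊠ wire [P]))
  | comul_P : StratRel δP
      ((wire [P] ⊠ ηOOPP) ⨟ (wire [P] ⊠ μO ⊠ wire [P, P]) ⨟ (εOP ⊠ wire [P, P]))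
  | unit_P : StratRel ηP (ηOP ⨟ (εO ⊠ wire [P]))
  | counit_P : StratRel εP ((wire [P] ⊠ ηO) ⨟ εOP)
  | sym_P : StratRel γP
      ((wire [P, P] ⊠ ηOOPP) ⨟ (wire [P, P] ⊠ γO ⊠ wire [P, P]) ⨟ (εPPOO ⊠ wire [P, P]))
  | sym_OP : StratRel γOP
      ((wire [P, O] ⊠ ηOP) ⨟ (wire [P] ⊠ γO ⊠ wire [P]) ⨟ (εOP ⊠ wire [O, P]))

/-- The equational theory of strategies. -/
abbrev stratTheory : Theory where
  sig := stratSig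
  rel := StratRel

/-! ### Games and (cyclic) strategies -/

/-- A game: a set of moves with polarities and a partial order (causality) in which every move
has finitely many predecessors. -/
structure Game where
  Moves : Type
  pol : Moves → Polarity
  [order : PartialOrder Moves]
  finite_Iic : ∀ m : Moves, (Set.Iic m).Finite

attribute [instance] Game.order

namespace Game

/-- Tensor product: disjoint union of moves, polarities and causality. -/
@[reducible]
def tensor (A B : Game) : Game where
  Moves := A.Moves ⊕ B.Moves
  pol := Sum.elim A.pol B.pol
  finite_Iic m := by
    rcases m with a | b
    · refine ((A.finite_Iic a).image Sum.inl).subset ?_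
      rintro (x | x) hx
      · exact ⟨x, by simpa using hx, rfl⟩
      · simp at hx
    · refine ((B.finite_Iic b).image Sum.inr).subset ?_
      rintro (x | x) hx
      · simp at hx
      · exact ⟨x, by simpa using hx, rfl⟩

/-- The opposite game, with inverted polarities. -/
@[reducible]
def dual (A : Game) : Game where
  Moves := A.Moves
  pol m := (A.pol m).neg
  finite_Iic := A.finite_Iic

/-- The arrow game. -/
@[reducible]
def arrow (A B : Game) : Game := A.dual.tensor B

section

variable {A B : Game}

theorem arrow_le_inl {a a' : A.Moves} :
    (A.arrow B).order.le (.inl a) (.inl a') ↔ a ≤ a' := Sum.inl_le_inl_iff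

theorem arrow_le_inr {b b' : B.Moves} :
    (A.arrow B).order.le (.inr b) (.inr b') ↔ b ≤ b' := Sum.inr_le_inr_iff

theorem not_arrow_le_inl_inr {a : A.Moves} {b : B.Moves} :
    ¬ (A.arrow B).order.le (.inl a) (.inr b) := Sum.not_inl_le_inr

theorem not_arrow_le_inr_inl {a : A.Moves} {b : B.Moves} :
    ¬ (A.arrow B).order.le (.inr b) (.inl a) := Sum.not_inr_le_inl

end

/-- A strategy on a game: a partial order on moves, relating distinct moves only when the first
is an Opponent move and the second a Proponent move, and compatible with causality. -/
structure IsStrategy (A : Game) (r : A.Moves → A.Moves → Prop) : Prop where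
  isPartialOrder : IsPartialOrder A.Moves r
  polarity : ∀ m n, r m n → m ≠ n → A.pol m = O ∧ A.pol n = P
  acyclic : IsPartialOrder A.Moves (Relation.TransGen fun m n => r m n ∨ m ≤ n)

/-- A cyclic strategy on a game. -/
@[ext]
structure CyclicStrategy (A : Game) where
  rel : A.Moves → A.Moves → Prop
  refl : ∀ m, rel m m
  trans : ∀ m n p, rel m n → rel n p → rel m p
  polarity : ∀ m n, rel m n → m ≠ n → A.pol m = O ∧ A.pol n = P

variable {A B C D : Game}

/-- The union of the relations `σ` (on `A ⊸ B`) and `τ` (on `B ⊸ C`), as a relation on the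
disjoint union of the moves of `A`, `B` and `C`. -/
inductive Interaction (σ : CyclicStrategy (A.arrow B)) (τ : CyclicStrategy (B.arrow C)) :
    A.Moves ⊕ B.Moves ⊕ C.Moves → A.Moves ⊕ B.Moves ⊕ C.Moves → Prop
  | left (x y : A.Moves ⊕ B.Moves) : σ.rel x y →
      Interaction σ τ (Sum.map id Sum.inl x) (Sum.map id Sum.inl y)
  | right (x y : B.Moves ⊕ C.Moves) : τ.rel x y → Interaction σ τ (Sum.inr x) (Sum.inr y)

theorem exists_step {α : Type*} {r : α → α → Prop} {u v : α} (h : Relation.TransGen r u v)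
    (huv : u ≠ v) : (∃ w, r u w ∧ u ≠ w) ∧ ∃ w, r w v ∧ w ≠ v := by
  classical
  induction h with
  | single h => exact ⟨⟨_, h, huv⟩, ⟨_, h, huv⟩⟩
  | @tail b c hab hbc ih =>
    by_cases hub : u = b
    · subst hub
      exact ⟨⟨_, hbc, huv⟩, ⟨_, hbc, huv⟩⟩
    · by_cases hb : b = c
      · subst hb
        exact ih huv
      · exact ⟨(ih hub).1, ⟨_, hbc, hb⟩⟩

/-- Composition `τ ∘ σ`: transitive closure of the union, restricted to the moves of `A`
and `C`. -/
def CyclicStrategy.comp (σ : CyclicStrategy (A.arrow B)) (τ : CyclicStrategy (B.arrow C)) :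
    CyclicStrategy (A.arrow C) where
  rel x y := Relation.TransGen (Interaction σ τ) (Sum.map id Sum.inr x) (Sum.map id Sum.inr y)
  refl x := by
    rcases x with a | c
    · exact .single (Interaction.left (σ := σ) (τ := τ) (.inl a) (.inl a) (σ.refl _))
    · exact .single (Interaction.right (.inr c) (.inr c) (τ.refl _))
  trans _ _ _ h k := h.trans k
  polarity x y h hxy := by
    have hne : (Sum.map id Sum.inr x : A.Moves ⊕ B.Moves ⊕ C.Moves) ≠ Sum.map id Sum.inr y :=
      fun he => hxy (Sum.map_injective.2 ⟨Function.injective_id, Sum.inr_injective⟩ he)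
    obtain ⟨⟨w, hw, hw'⟩, ⟨z, hz, hz'⟩⟩ := exists_step h hne
    constructor
    · generalize hu : (Sum.map id Sum.inr x : A.Moves ⊕ B.Moves ⊕ C.Moves) = u at hw hw'
      cases hw with
      | left p q hpq =>
        have hpq' : p ≠ q := fun e => hw' (by rw [e])
        have := (σ.polarity p q hpq hpq').1
        rcases x with a | c <;> rcases p with a' | b <;> simp at hu
        subst hu
        simpa using this
      | right p q hpq =>
        have hpq' : p ≠ q := fun e => hw' (by rw [e])
        have := (τ.polarity p q hpq hpq').1
        rcases x with a | c <;> rcases p with a' | b <;> simp at hu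
        subst hu
        simpa using this
    · generalize hu : (Sum.map id Sum.inr y : A.Moves ⊕ B.Moves ⊕ C.Moves) = u at hz hz'
      cases hz with
      | left p q hpq =>
        have hpq' : p ≠ q := fun e => hz' (by rw [e])
        have := (σ.polarity p q hpq hpq').2
        rcases y with a | c <;> rcases q with a' | b <;> simp at hu
        subst hu
        simpa using this
      | right p q hpq =>
        have hpq' : p ≠ q := fun e => hz' (by rw [e])
        have := (τ.polarity p q hpq hpq').2
        rcases y with a | c <;> rcases q with a' | b <;> simp at hu
        subst hu
        simpa using this

/-- The relation of the copycat strategy along a bijection `e` on moves: a move of `A` justifies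
its copy in `B` if it is a Proponent move (of `A`), and is justified by it if it is an Opponent
move. -/
def copyRel (A : Game) {B : Game} (e : A.Moves ≃ B.Moves) :
    A.Moves ⊕ B.Moves → A.Moves ⊕ B.Moves → Prop
  | .inl a, .inl a' => a = a'
  | .inr b, .inr b' => b = b'
  | .inl a, .inr b => e a = b ∧ A.pol a = P
  | .inr b, .inl a => e a = b ∧ A.pol a = O

/-- The copycat strategy along a polarity preserving bijection on moves. -/
def copycat (e : A.Moves ≃ B.Moves) (he : ∀ a, B.pol (e a) = A.pol a) :
    CyclicStrategy (A.arrow B) where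
  rel := copyRel A e
  refl x := by rcases x with a | b <;> simp [copyRel]
  trans x y z h k := by
    rcases x with a | b <;> rcases y with a' | b' <;> rcases z with a'' | b'' <;>
      simp only [copyRel] at h k ⊢ <;> grind
  polarity x y h hxy := by
    rcases x with a | b <;> rcases y with a' | b' <;> simp only [copyRel] at h
    · simp [h] at hxy
    · obtain ⟨rfl, h⟩ := h
      simp [h, he, Polarity.neg]
    · obtain ⟨rfl, h⟩ := h
      simp [h, he, Polarity.neg]
    · simp [h] at hxy

theorem copycat_comp_rel (e : A.Moves ≃ B.Moves) (he : ∀ a, B.pol (e a) = A.pol a)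
    (τ : CyclicStrategy (B.arrow C)) (x y : A.Moves ⊕ C.Moves) :
    ((copycat e he).comp τ).rel x y ↔ τ.rel (Sum.map e id x) (Sum.map e id y) := by
  constructor
  · intro h
    let κ : A.Moves ⊕ B.Moves ⊕ C.Moves → B.Moves ⊕ C.Moves := Sum.elim (fun a => .inl (e a)) id
    have step : ∀ u v, Interaction (copycat e he) τ u v → τ.rel (κ u) (κ v) := by
      rintro _ _ (⟨x, y, h⟩ | ⟨x, y, h⟩)
      · rcases x with a | b <;> rcases y with a' | b' <;> simp only [copycat, copyRel] at h
        · subst h; exact τ.refl _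
        · obtain ⟨rfl, -⟩ := h; exact τ.refl _
        · obtain ⟨rfl, -⟩ := h; exact τ.refl _
        · subst h; exact τ.refl _
      · exact h
    have key : ∀ u v, Relation.TransGen (Interaction (copycat e he) τ) u v →
        τ.rel (κ u) (κ v) := by
      intro u v h
      induction h with
      | single h => exact step _ _ h
      | tail _ h ih => exact τ.trans _ _ _ ih (step _ _ h)
    have := key _ _ h
    rcases x with a | c <;> rcases y with a' | c' <;> exact this
  · intro h
    by_cases hxy : x = y
    · subst hxy
      exact CyclicStrategy.refl _ _
    · have hne : Sum.map e id x ≠ Sum.map e id y := fun he' =>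
        hxy (Sum.map_injective.2 ⟨e.injective, Function.injective_id⟩ he')
      obtain ⟨hx, hy⟩ := τ.polarity _ _ h hne
      refine (Relation.TransGen.trans (b := Sum.inr (Sum.map e id x)) ?_
        (Relation.TransGen.single (.right _ _ h))).trans ?_
      · rcases x with a | c
        · refine .single (Interaction.left (.inl a) (.inr (e a)) ⟨rfl, ?_⟩)
          cases hp : A.pol a <;> simp [he, hp, Polarity.neg] at hx ⊢
        · exact .single (Interaction.right _ _ (τ.refl _))
      · rcases y with a | c
        · refine .single (Interaction.left (.inr (e a)) (.inl a) ⟨rfl, ?_⟩)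
          cases hp : A.pol a <;> simp [he, hp, Polarity.neg] at hy ⊢
        · exact .single (Interaction.right _ _ (τ.refl _))

theorem comp_copycat_rel (e : B.Moves ≃ C.Moves) (he : ∀ b, C.pol (e b) = B.pol b)
    (σ : CyclicStrategy (A.arrow B)) (x y : A.Moves ⊕ C.Moves) :
    (σ.comp (copycat e he)).rel x y ↔ σ.rel (Sum.map id e.symm x) (Sum.map id e.symm y) := by
  constructor
  · intro h
    let κ : A.Moves ⊕ B.Moves ⊕ C.Moves → A.Moves ⊕ B.Moves :=
      Sum.map id (Sum.elim id e.symm)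
    have step : ∀ u v, Interaction σ (copycat e he) u v → σ.rel (κ u) (κ v) := by
      rintro _ _ (⟨x, y, h⟩ | ⟨x, y, h⟩)
      · rcases x with a | b <;> rcases y with a' | b' <;> exact h
      · rcases x with a | b <;> rcases y with a' | b' <;> simp only [copycat, copyRel] at h
        · subst h; exact σ.refl _
        · obtain ⟨rfl, -⟩ := h
          simpa [κ] using σ.refl _
        · obtain ⟨rfl, -⟩ := h
          simpa [κ] using σ.refl _
        · subst h; exact σ.refl _
    have key : ∀ u v, Relation.TransGen (Interaction σ (copycat e he)) u v →
        σ.rel (κ u) (κ v) := by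
      intro u v h
      induction h with
      | single h => exact step _ _ h
      | tail _ h ih => exact σ.trans _ _ _ ih (step _ _ h)
    have := key _ _ h
    rcases x with a | c <;> rcases y with a' | c' <;> exact this
  · intro h
    by_cases hxy : x = y
    · subst hxy
      exact CyclicStrategy.refl _ _
    · have hne : Sum.map id e.symm x ≠ Sum.map id e.symm y := fun he' =>
        hxy (Sum.map_injective.2 ⟨Function.injective_id, e.symm.injective⟩ he')
      obtain ⟨hx, hy⟩ := σ.polarity _ _ h hne
      refine (Relation.TransGen.trans (b := Sum.map id Sum.inl (Sum.map id e.symm x)) ?_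
        (Relation.TransGen.single (.left _ _ h))).trans ?_
      · rcases x with a | c
        · exact .single (Interaction.left (.inl a) (.inl a) (σ.refl _))
        · refine .single (Interaction.right (.inr c) (.inl (e.symm c)) ⟨by simp, ?_⟩)
          simpa using hx
      · rcases y with a | c
        · exact .single (Interaction.left (.inl a) (.inl a) (σ.refl _))
        · refine .single (Interaction.right (.inl (e.symm c)) (.inr c) ⟨by simp, ?_⟩)
          simpa using hy

/-- Steps of the interaction of three strategies. -/
inductive Interaction₃ (σ : CyclicStrategy (A.arrow B)) (τ : CyclicStrategy (B.arrow C))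
    (ρ : CyclicStrategy (C.arrow D)) :
    A.Moves ⊕ B.Moves ⊕ C.Moves ⊕ D.Moves → A.Moves ⊕ B.Moves ⊕ C.Moves ⊕ D.Moves → Prop
  | left (x y : A.Moves ⊕ B.Moves) : σ.rel x y →
      Interaction₃ σ τ ρ (Sum.map id Sum.inl x) (Sum.map id Sum.inl y)
  | mid (x y : B.Moves ⊕ C.Moves) : τ.rel x y →
      Interaction₃ σ τ ρ (Sum.inr (Sum.map id Sum.inl x)) (Sum.inr (Sum.map id Sum.inl y))
  | right (x y : C.Moves ⊕ D.Moves) : ρ.rel x y →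
      Interaction₃ σ τ ρ (Sum.inr (Sum.inr x)) (Sum.inr (Sum.inr y))

theorem comp_comp_rel_left (σ : CyclicStrategy (A.arrow B)) (τ : CyclicStrategy (B.arrow C))
    (ρ : CyclicStrategy (C.arrow D)) (x y : A.Moves ⊕ D.Moves) :
    ((σ.comp τ).comp ρ).rel x y ↔ Relation.TransGen (Interaction₃ σ τ ρ)
      (Sum.map id (Sum.inr ∘ Sum.inr) x) (Sum.map id (Sum.inr ∘ Sum.inr) y) := by
  let i : A.Moves ⊕ B.Moves ⊕ C.Moves → A.Moves ⊕ B.Moves ⊕ C.Moves ⊕ D.Moves :=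
    Sum.map id (Sum.map id Sum.inl)
  let j : A.Moves ⊕ C.Moves ⊕ D.Moves → A.Moves ⊕ B.Moves ⊕ C.Moves ⊕ D.Moves :=
    Sum.map id Sum.inr
  let I := Interaction σ τ
  let J := Interaction (σ.comp τ) ρ
  let K := Interaction₃ σ τ ρ
  have hi : ∀ u v, Relation.TransGen I u v → Relation.TransGen K (i u) (i v) := by
    intro u v h
    refine Relation.TransGen.lift i ?_ _ _ h
    rintro _ _ (⟨x, y, h⟩ | ⟨x, y, h⟩)
    · have := Interaction₃.left (τ := τ) (ρ := ρ) x y h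
      rcases x with a | b <;> rcases y with a' | b' <;> exact this
    · have := Interaction₃.mid (σ := σ) (ρ := ρ) x y h
      rcases x with a | b <;> rcases y with a' | b' <;> exact this
  have hj : ∀ u v, J u v → Relation.TransGen K (j u) (j v) := by
    rintro _ _ (⟨x, y, h⟩ | ⟨x, y, h⟩)
    · have := hi _ _ h
      rcases x with a | b <;> rcases y with a' | b' <;> exact this
    · exact .single (Interaction₃.right x y h)
  constructor
  · intro h
    have : Relation.TransGen K (j (Sum.map id Sum.inr x)) (j (Sum.map id Sum.inr y)) := by
      have h' : Relation.TransGen J (Sum.map id Sum.inr x) (Sum.map id Sum.inr y) := h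
      generalize (Sum.map id Sum.inr x : A.Moves ⊕ C.Moves ⊕ D.Moves) = u at h'
      generalize (Sum.map id Sum.inr y : A.Moves ⊕ C.Moves ⊕ D.Moves) = v at h'
      clear h
      induction h' with
      | single h => exact hj _ _ h
      | tail _ h ih => exact ih.trans (hj _ _ h)
    rcases x with a | c <;> rcases y with a' | c' <;> exact this
  · intro h
    -- a vertex of the big interaction, reached from `u`
    let u : A.Moves ⊕ C.Moves ⊕ D.Moves := Sum.map id Sum.inr x
    let Reach : A.Moves ⊕ B.Moves ⊕ C.Moves ⊕ D.Moves → Prop := fun w =>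
      (∃ v, w = j v ∧ Relation.ReflTransGen J u v) ∨
      (∃ b, w = .inr (.inl b) ∧ ∃ z : A.Moves ⊕ C.Moves,
        Relation.ReflTransGen J u (Sum.map id Sum.inl z) ∧
        Relation.TransGen I (Sum.map id Sum.inr z) (.inr (.inl b)))
    have ofI : ∀ z z' : A.Moves ⊕ C.Moves,
        Relation.TransGen I (Sum.map id Sum.inr z) (Sum.map id Sum.inr z') →
        J (Sum.map id Sum.inl z) (Sum.map id Sum.inl z') := fun z z' h =>
      Interaction.left z z' h
    have main : ∀ p q : A.Moves ⊕ B.Moves ⊕ C.Moves, I p q → Reach (i p) → Reach (i q) := by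
      intro p q hpq hp
      -- find a visible start
      have hz : ∃ z : A.Moves ⊕ C.Moves, Relation.ReflTransGen J u (Sum.map id Sum.inl z) ∧
          Relation.TransGen I (Sum.map id Sum.inr z) q := by
        rcases hp with ⟨v, hv, huv⟩ | ⟨b, hb, z, huz, hzb⟩
        · rcases p with a | b | c <;> rcases v with a' | c' | d' <;> simp [i, j] at hv
          · subst hv
            exact ⟨.inl a, huv, .single hpq⟩
          · subst hv
            exact ⟨.inr c, huv, .single hpq⟩
        · rcases p with a | b' | c <;> simp [i] at hb
          subst hb
          exact ⟨z, huz, hzb.tail hpq⟩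
      obtain ⟨z, huz, hzq⟩ := hz
      rcases q with a | b | c
      · exact .inl ⟨.inl a, rfl, huz.tail (ofI z (.inl a) hzq)⟩
      · exact .inr ⟨b, rfl, z, huz, hzq⟩
      · exact .inl ⟨.inr (.inl c), rfl, huz.tail (ofI z (.inr c) hzq)⟩
    have step : ∀ p q, K p q → Reach p → Reach q := by
      rintro _ _ (⟨x, y, h⟩ | ⟨x, y, h⟩ | ⟨x, y, h⟩) hp
      · have := main _ _ (Interaction.left (τ := τ) x y h)
        rcases x with a | b <;> rcases y with a' | b' <;> exact this hp
      · have := main _ _ (Interaction.right (σ := σ) x y h)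
        rcases x with a | b <;> rcases y with a' | b' <;> exact this hp
      · rcases hp with ⟨v, hv, huv⟩ | ⟨b, hb, -⟩
        · rcases v with a | v <;> simp [j] at hv
          subst hv
          exact .inl ⟨.inr y, rfl, huv.tail (Interaction.right x y h)⟩
        · simp at hb
    have all : ∀ w, Relation.TransGen K (j u) w → Reach w := by
      intro w hw
      induction hw with
      | single h => exact step _ _ h (.inl ⟨u, rfl, .refl⟩)
      | tail _ h ih => exact step _ _ h ih
    have hju : Sum.map id (Sum.inr ∘ Sum.inr) x = j u := by rcases x with a | d <;> rfl
    rw [hju] at h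
    rcases all _ h with ⟨v, hv, huv⟩ | ⟨b, hb, -⟩
    · have hv' : v = Sum.map id Sum.inr y := by
        rcases y with a | d <;> rcases v with a' | c' | d' <;> simp [j] at hv <;> simp [hv]
      subst hv'
      rcases Relation.reflTransGen_iff_eq_or_transGen.1 huv with he | ht
      · have : x = y := Sum.map_injective.2 ⟨Function.injective_id, Sum.inr_injective⟩ he.symm
        subst this
        exact CyclicStrategy.refl _ _
      · exact ht
    · rcases y with a | d <;> simp at hb

theorem comp_comp_rel_right (σ : CyclicStrategy (A.arrow B)) (τ : CyclicStrategy (B.arrow C))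
    (ρ : CyclicStrategy (C.arrow D)) (x y : A.Moves ⊕ D.Moves) :
    (σ.comp (τ.comp ρ)).rel x y ↔ Relation.TransGen (Interaction₃ σ τ ρ)
      (Sum.map id (Sum.inr ∘ Sum.inr) x) (Sum.map id (Sum.inr ∘ Sum.inr) y) := by
  let i : B.Moves ⊕ C.Moves ⊕ D.Moves → A.Moves ⊕ B.Moves ⊕ C.Moves ⊕ D.Moves := Sum.inr
  let j : A.Moves ⊕ B.Moves ⊕ D.Moves → A.Moves ⊕ B.Moves ⊕ C.Moves ⊕ D.Moves :=
    Sum.map id (Sum.map id Sum.inr)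
  let I := Interaction τ ρ
  let J := Interaction σ (τ.comp ρ)
  let K := Interaction₃ σ τ ρ
  have hi : ∀ u v, Relation.TransGen I u v → Relation.TransGen K (i u) (i v) := by
    intro u v h
    refine Relation.TransGen.lift i ?_ _ _ h
    rintro _ _ (⟨x, y, h⟩ | ⟨x, y, h⟩)
    · exact Interaction₃.mid x y h
    · exact Interaction₃.right x y h
  have hj : ∀ u v, J u v → Relation.TransGen K (j u) (j v) := by
    rintro _ _ (⟨x, y, h⟩ | ⟨x, y, h⟩)
    · have := Interaction₃.left (τ := τ) (ρ := ρ) x y h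
      rcases x with a | b <;> rcases y with a' | b' <;> exact .single this
    · have := hi _ _ h
      rcases x with a | b <;> rcases y with a' | b' <;> exact this
  constructor
  · intro h
    have : Relation.TransGen K (j (Sum.map id Sum.inr x)) (j (Sum.map id Sum.inr y)) := by
      have h' : Relation.TransGen J (Sum.map id Sum.inr x) (Sum.map id Sum.inr y) := h
      generalize (Sum.map id Sum.inr x : A.Moves ⊕ B.Moves ⊕ D.Moves) = u at h'
      generalize (Sum.map id Sum.inr y : A.Moves ⊕ B.Moves ⊕ D.Moves) = v at h'
      clear h
      induction h' with
      | single h => exact hj _ _ h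
      | tail _ h ih => exact ih.trans (hj _ _ h)
    rcases x with a | c <;> rcases y with a' | c' <;> exact this
  · intro h
    let u : A.Moves ⊕ B.Moves ⊕ D.Moves := Sum.map id Sum.inr x
    let Reach : A.Moves ⊕ B.Moves ⊕ C.Moves ⊕ D.Moves → Prop := fun w =>
      (∃ v, w = j v ∧ Relation.ReflTransGen J u v) ∨
      (∃ c, w = .inr (.inr (.inl c)) ∧ ∃ z : B.Moves ⊕ D.Moves,
        Relation.ReflTransGen J u (Sum.inr z) ∧
        Relation.TransGen I (Sum.map id Sum.inr z) (.inr (.inl c)))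
    have ofI : ∀ z z' : B.Moves ⊕ D.Moves,
        Relation.TransGen I (Sum.map id Sum.inr z) (Sum.map id Sum.inr z') →
        J (Sum.inr z) (Sum.inr z') := fun z z' h => Interaction.right z z' h
    have main : ∀ p q : B.Moves ⊕ C.Moves ⊕ D.Moves, I p q → Reach (i p) → Reach (i q) := by
      intro p q hpq hp
      have hz : ∃ z : B.Moves ⊕ D.Moves, Relation.ReflTransGen J u (Sum.inr z) ∧
          Relation.TransGen I (Sum.map id Sum.inr z) q := by
        rcases hp with ⟨v, hv, huv⟩ | ⟨b, hb, z, huz, hzb⟩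
        · rcases p with a | b | c <;> rcases v with a' | c' | d' <;> simp [i, j] at hv
          · subst hv
            exact ⟨.inl a, huv, .single hpq⟩
          · subst hv
            exact ⟨.inr c, huv, .single hpq⟩
        · rcases p with a | b' | c <;> simp [i] at hb
          subst hb
          exact ⟨z, huz, hzb.tail hpq⟩
      obtain ⟨z, huz, hzq⟩ := hz
      rcases q with a | b | c
      · exact .inl ⟨.inr (.inl a), rfl, huz.tail (ofI z (.inl a) hzq)⟩
      · exact .inr ⟨b, rfl, z, huz, hzq⟩
      · exact .inl ⟨.inr (.inr c), rfl, huz.tail (ofI z (.inr c) hzq)⟩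
    have step : ∀ p q, K p q → Reach p → Reach q := by
      rintro _ _ (⟨x, y, h⟩ | ⟨x, y, h⟩ | ⟨x, y, h⟩) hp
      · rcases hp with ⟨v, hv, huv⟩ | ⟨b, hb, -⟩
        · have hv' : v = Sum.map id Sum.inl x := by
            rcases x with a | b <;> rcases v with a' | c' | d' <;> simp [j] at hv <;> simp [hv]
          subst hv'
          refine .inl ⟨Sum.map id Sum.inl y, ?_, huv.tail (Interaction.left x y h)⟩
          rcases y with a | b <;> rfl
        · rcases x with a | b <;> simp at hb
      · exact main _ _ (Interaction.left x y h) hp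
      · exact main _ _ (Interaction.right x y h) hp
    have all : ∀ w, Relation.TransGen K (j u) w → Reach w := by
      intro w hw
      induction hw with
      | single h => exact step _ _ h (.inl ⟨u, rfl, .refl⟩)
      | tail _ h ih => exact step _ _ h ih
    have hju : Sum.map id (Sum.inr ∘ Sum.inr) x = j u := by rcases x with a | d <;> rfl
    rw [hju] at h
    rcases all _ h with ⟨v, hv, huv⟩ | ⟨b, hb, -⟩
    · have hv' : v = Sum.map id Sum.inr y := by
        rcases y with a | d <;> rcases v with a' | c' | d' <;> simp [j] at hv <;> simp [hv]
      subst hv'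
      rcases Relation.reflTransGen_iff_eq_or_transGen.1 huv with he | ht
      · have : x = y := Sum.map_injective.2 ⟨Function.injective_id, Sum.inr_injective⟩ he.symm
        subst this
        exact CyclicStrategy.refl _ _
      · exact ht
    · rcases y with a | d <;> simp at hb

/-- The identity strategy. -/
def idStrategy (A : Game) : CyclicStrategy (A.arrow A) :=
  copycat (Equiv.refl A.Moves) fun a => by simp

/-- The category whose objects are games and whose morphisms `A ⟶ B` are the cyclic strategies
on the arrow game `A ⊸ B`. -/
instance : Category Game where
  Hom A B := CyclicStrategy (A.arrow B)
  id A := idStrategy A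
  comp σ τ := CyclicStrategy.comp σ τ
  id_comp σ := by
    ext x y
    refine (copycat_comp_rel (Equiv.refl _) (fun _ => by simp) σ x y).trans ?_
    rcases x with a | b <;> rcases y with a' | b' <;> rfl
  comp_id σ := by
    ext x y
    refine (comp_copycat_rel (Equiv.refl _) (fun _ => by simp) σ x y).trans ?_
    rcases x with a | b <;> rcases y with a' | b' <;> rfl
  assoc σ τ ρ := by
    ext x y
    exact (comp_comp_rel_left σ τ ρ x y).trans (comp_comp_rel_right σ τ ρ x y).symm

theorem copycat_comp_copycat (e : A.Moves ≃ B.Moves) (he : ∀ a, B.pol (e a) = A.pol a)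
    (f : B.Moves ≃ C.Moves) (hf : ∀ b, C.pol (f b) = B.pol b) :
    (copycat e he).comp (copycat f hf) =
      copycat (e.trans f) fun a => by rw [Equiv.trans_apply, hf, he] := by
  ext x y
  rw [copycat_comp_rel]
  rcases x with a | b <;> rcases y with a' | b' <;> simp [copycat, copyRel, he]

theorem isPartialOrder_transGen {α β : Type*} {r : α → α → Prop} (hr : ∀ a, r a a)
    (R : β → β → Prop) [IsPartialOrder β R] (f : α → β) (hf : Function.Injective f)
    (h : ∀ a b, r a b → R (f a) (f b)) : IsPartialOrder α (Relation.TransGen r) := by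
  have key : ∀ a b, Relation.TransGen r a b → R (f a) (f b) := by
    intro a b hab
    induction hab with
    | single hab => exact h _ _ hab
    | tail _ hbc ih => exact _root_.trans ih (h _ _ hbc)
  exact { refl := fun a => .single (hr a)
          trans := fun _ _ _ => Relation.TransGen.trans
          antisymm := fun a b hab hba => hf (antisymm_of R (key _ _ hab) (key _ _ hba)) }

theorem CyclicStrategy.isPartialOrder (σ : CyclicStrategy A) : IsPartialOrder A.Moves σ.rel where
  refl := σ.refl
  trans := σ.trans
  antisymm m n h k := by
    by_contra hmn
    have h₁ := (σ.polarity m n h hmn).1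
    have h₂ := (σ.polarity n m k (Ne.symm hmn)).2
    simp [h₁] at h₂

/-- The copycat strategy along an isomorphism of games is a strategy. -/
theorem copycat_isStrategy (e : A.Moves ≃ B.Moves) (he : ∀ a, B.pol (e a) = A.pol a)
    (hle : ∀ a a', a ≤ a' → e a ≤ e a') : IsStrategy (A.arrow B) (copycat e he).rel where
  isPartialOrder := (copycat e he).isPartialOrder
  polarity := (copycat e he).polarity
  acyclic := by
    let rank : Polarity → ℕ := fun p => match p with
      | O => 0
      | P => 1
    let f : A.Moves ⊕ B.Moves → B.Moves ×ₗ ℕ :=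
      Sum.elim (fun a => toLex (e a, rank (A.pol a).neg)) (fun b => toLex (b, rank (B.pol b)))
    refine isPartialOrder_transGen (fun a => .inr le_rfl) (R := (· ≤ ·)) f ?_ ?_
    · rintro (a | b) (a' | b') h <;> simp only [f, Sum.elim_inl, Sum.elim_inr,
        EmbeddingLike.apply_eq_iff_eq, Prod.mk.injEq] at h
      · rw [h.1]
      · obtain ⟨rfl, h⟩ := h
        rw [he] at h
        cases hp : A.pol a <;> simp [hp, rank, Polarity.neg] at h
      · obtain ⟨rfl, h⟩ := h
        rw [he] at h
        cases hp : A.pol a' <;> simp [hp, rank, Polarity.neg] at h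
      · rw [h.1]
    · rintro (a | b) (a' | b') (h | h)
      · obtain rfl : a = a' := h
        exact le_rfl
      · have h' : a ≤ a' := Sum.inl_le_inl_iff.1 h
        rcases eq_or_lt_of_le h' with rfl | h'
        · exact le_rfl
        · refine Prod.Lex.le_iff.2 (.inl ?_)
          exact lt_of_le_of_ne (hle _ _ h'.le) (fun h => h'.ne (e.injective h))
      · obtain ⟨rfl, h⟩ : e a = b' ∧ A.pol a = P := h
        refine Prod.Lex.le_iff.2 (.inr ⟨rfl, ?_⟩)
        simp [f, rank, h, Polarity.neg]
      · simp at h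
      · obtain ⟨rfl, h⟩ : e a' = b ∧ A.pol a' = O := h
        refine Prod.Lex.le_iff.2 (.inr ⟨rfl, ?_⟩)
        simp [f, rank, h, he]
      · simp at h
      · obtain rfl : b = b' := h
        exact le_rfl
      · have h' : b ≤ b' := Sum.inr_le_inr_iff.1 h
        rcases eq_or_lt_of_le h' with rfl | h'
        · exact le_rfl
        · exact Prod.Lex.le_iff.2 (.inl h')

end Game

/-! ### The monoidal category of finite filiform games -/

open Game

/-- Finite filiform games: the causality order is total. -/
structure Games where
  game : Game
  finite : Finite game.Moves
  total : ∀ m n : game.Moves, m ≤ n ∨ n ≤ m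

namespace Games

/-- The morphisms between finite filiform games: the smallest class of cyclic strategies which
contains the strategies and is closed under composition. -/
inductive IsMorphism : ∀ {A B : Games}, (A.game ⟶ B.game) → Prop
  | strategy {A B : Games} (σ : A.game ⟶ B.game) :
      IsStrategy (A.game.arrow B.game) (CyclicStrategy.rel σ) → IsMorphism σ
  | comp {A B C : Games} (σ : A.game ⟶ B.game) (τ : B.game ⟶ C.game) :
      IsMorphism σ → IsMorphism τ → IsMorphism (σ ≫ τ)

theorem IsMorphism.id (A : Games) : IsMorphism (𝟙 A.game) :=
  .strategy _ (copycat_isStrategy (Equiv.refl _) (fun _ => by simp) fun _ _ h => h)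

/-- The category of finite filiform games, generated by strategies. -/
instance : Category Games where
  Hom A B := { σ : A.game ⟶ B.game // IsMorphism σ }
  id A := ⟨𝟙 A.game, .id A⟩
  comp σ τ := ⟨σ.1 ≫ τ.1, .comp _ _ σ.2 τ.2⟩
  id_comp _ := Subtype.ext (Category.id_comp _)
  comp_id _ := Subtype.ext (Category.comp_id _)
  assoc _ _ _ := Subtype.ext (Category.assoc _ _ _)

/-- The game `A` before `B`: moves and polarities of the tensor product, where moreover every
move of `A` is below every move of `B`. -/
@[reducible]
def before (A B : Games) : Games where
  game :=
    { Moves := A.game.Moves ⊕ B.game.Moves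
      pol := Sum.elim A.game.pol B.game.pol
      order :=
        { le := Sum.Lex (· ≤ ·) (· ≤ ·)
          lt := fun m n => Sum.Lex (· ≤ ·) (· ≤ ·) m n ∧ ¬ Sum.Lex (· ≤ ·) (· ≤ ·) n m
          le_refl := refl_of _
          le_trans := fun _ _ _ => trans_of _
          le_antisymm := fun _ _ => antisymm_of _ }
      finite_Iic := fun _ =>
        have := A.finite
        have := B.finite
        Set.toFinite _ }
  finite :=
    have := A.finite
    have := B.finite
    (inferInstance : Finite (A.game.Moves ⊕ B.game.Moves))
  total :=
    have : Std.Total (α := A.game.Moves) (· ≤ ·) := ⟨A.total⟩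
    have : Std.Total (α := B.game.Moves) (· ≤ ·) := ⟨B.total⟩
    fun m n => total_of (Sum.Lex (α := A.game.Moves) (β := B.game.Moves) (· ≤ ·) (· ≤ ·)) m n

/-- The empty game. -/
@[reducible]
def empty : Games where
  game :=
    { Moves := Empty
      pol := Empty.elim
      order :=
        { le := fun _ _ => True
          lt := fun _ _ => False
          lt_iff_le_not_ge := fun a => a.elim
          le_refl := fun _ => trivial
          le_trans := fun _ _ _ _ _ => trivial
          le_antisymm := fun a => a.elim }
      finite_Iic := fun m => m.elim }
  finite := (inferInstance : Finite Empty)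
  total := fun m => m.elim

variable {A B C D A' B' C' : Games}

/-- Regrouping of a disjoint union of four sets. -/
def shuffle {α β γ δ : Type} : (α ⊕ γ) ⊕ (β ⊕ δ) → (α ⊕ β) ⊕ (γ ⊕ δ)
  | .inl (.inl a) => .inl (.inl a)
  | .inl (.inr c) => .inr (.inl c)
  | .inr (.inl b) => .inl (.inr b)
  | .inr (.inr d) => .inr (.inr d)

theorem shuffle_injective {α β γ δ : Type} :
    Function.Injective (shuffle (α := α) (β := β) (γ := γ) (δ := δ)) := by
  rintro ((a | c) | (b | d)) ((a' | c') | (b' | d')) h <;> simp_all [shuffle]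

/-- The action of `before` on morphisms: disjoint union of relations. -/
def beforeHom (σ : A.game ⟶ B.game) (τ : C.game ⟶ D.game) :
    (before A C).game ⟶ (before B D).game where
  rel x y := Sum.LiftRel (CyclicStrategy.rel σ) (CyclicStrategy.rel τ) (shuffle x) (shuffle y)
  refl x := by
    rcases x with (a | c) | (b | d)
    · exact .inl (CyclicStrategy.refl σ _)
    · exact .inr (CyclicStrategy.refl τ _)
    · exact .inl (CyclicStrategy.refl σ _)
    · exact .inr (CyclicStrategy.refl τ _)
  trans x y z h k := by
    generalize shuffle x = x, shuffle y = y, shuffle z = z at h k ⊢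
    cases h with
    | inl h => cases k with | inl k => exact .inl (CyclicStrategy.trans σ _ _ _ h k)
    | inr h => cases k with | inr k => exact .inr (CyclicStrategy.trans τ _ _ _ h k)
  polarity x y h hxy := by
    have hxy' : shuffle x ≠ shuffle y := fun e => hxy (shuffle_injective e)
    have key : ∀ u v, Sum.LiftRel (CyclicStrategy.rel σ) (CyclicStrategy.rel τ) u v → u ≠ v →
        Sum.elim (A.game.arrow B.game).pol (C.game.arrow D.game).pol u = O ∧
        Sum.elim (A.game.arrow B.game).pol (C.game.arrow D.game).pol v = P := by
      rintro _ _ (h | h) hne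
      · exact CyclicStrategy.polarity σ _ _ h fun e => hne (by rw [e])
      · exact CyclicStrategy.polarity τ _ _ h fun e => hne (by rw [e])
    have := key _ _ h hxy'
    rcases x with (a | c) | (b | d) <;> rcases y with (a' | c') | (b' | d') <;> exact this

theorem beforeHom_comp (σ : A.game ⟶ B.game) (σ' : A'.game ⟶ B'.game) (τ : B.game ⟶ C.game)
    (τ' : B'.game ⟶ C'.game) :
    beforeHom σ σ' ≫ beforeHom τ τ' = beforeHom (σ ≫ τ) (σ' ≫ τ') := by
  let j : A.game.Moves ⊕ B.game.Moves ⊕ C.game.Moves → (A.game.Moves ⊕ A'.game.Moves) ⊕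
      (B.game.Moves ⊕ B'.game.Moves) ⊕ (C.game.Moves ⊕ C'.game.Moves) :=
    Sum.map Sum.inl (Sum.map Sum.inl Sum.inl)
  let j' : A'.game.Moves ⊕ B'.game.Moves ⊕ C'.game.Moves → (A.game.Moves ⊕ A'.game.Moves) ⊕
      (B.game.Moves ⊕ B'.game.Moves) ⊕ (C.game.Moves ⊕ C'.game.Moves) :=
    Sum.map Sum.inr (Sum.map Sum.inr Sum.inr)
  have hj : Function.Injective j := by
    rintro (a | b | c) (a' | b' | c') h <;> simp_all [j]
  have hj' : Function.Injective j' := by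
    rintro (a | b | c) (a' | b' | c') h <;> simp_all [j']
  have hjj : ∀ p q, j p ≠ j' q := by
    rintro (a | b | c) (a' | b' | c') h <;> simp_all [j, j']
  let I := Interaction σ τ
  let I' := Interaction σ' τ'
  let K := Interaction (A := (before A A').game) (B := (before B B').game)
    (C := (before C C').game) (beforeHom σ σ') (beforeHom τ τ')
  have up : ∀ p q, I p q → K (j p) (j q) := by
    rintro _ _ (⟨x, y, h⟩ | ⟨x, y, h⟩)
    · have := Interaction.left (A := (before A A').game) (B := (before B B').game)
        (C := (before C C').game) (σ := beforeHom σ σ') (τ := beforeHom τ τ')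
        (Sum.map Sum.inl Sum.inl x) (Sum.map Sum.inl Sum.inl y)
        (by rcases x with a | b <;> rcases y with a' | b' <;> exact .inl h)
      rcases x with a | b <;> rcases y with a' | b' <;> exact this
    · have := Interaction.right (A := (before A A').game) (B := (before B B').game)
        (C := (before C C').game) (σ := beforeHom σ σ') (τ := beforeHom τ τ')
        (Sum.map Sum.inl Sum.inl x) (Sum.map Sum.inl Sum.inl y)
        (by rcases x with a | b <;> rcases y with a' | b' <;> exact .inl h)
      rcases x with a | b <;> rcases y with a' | b' <;> exact this
  have up' : ∀ p q, I' p q → K (j' p) (j' q) := by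
    rintro _ _ (⟨x, y, h⟩ | ⟨x, y, h⟩)
    · have := Interaction.left (A := (before A A').game) (B := (before B B').game)
        (C := (before C C').game) (σ := beforeHom σ σ') (τ := beforeHom τ τ')
        (Sum.map Sum.inr Sum.inr x) (Sum.map Sum.inr Sum.inr y)
        (by rcases x with a | b <;> rcases y with a' | b' <;> exact .inr h)
      rcases x with a | b <;> rcases y with a' | b' <;> exact this
    · have := Interaction.right (A := (before A A').game) (B := (before B B').game)
        (C := (before C C').game) (σ := beforeHom σ σ') (τ := beforeHom τ τ')
        (Sum.map Sum.inr Sum.inr x) (Sum.map Sum.inr Sum.inr y)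
        (by rcases x with a | b <;> rcases y with a' | b' <;> exact .inr h)
      rcases x with a | b <;> rcases y with a' | b' <;> exact this
  have down : ∀ u v, K u v → (∃ p q, j p = u ∧ j q = v ∧ I p q) ∨
      (∃ p q, j' p = u ∧ j' q = v ∧ I' p q) := by
    rintro _ _ (⟨x, y, h⟩ | ⟨x, y, h⟩)
    · rcases x with (a | a') | (b | b') <;> rcases y with (c | c') | (d | d') <;>
        change Sum.LiftRel _ _ _ _ at h <;> simp only [shuffle] at h <;> cases h
      all_goals rename_i h
      all_goals first
        | exact .inl ⟨_, _, rfl, rfl, Interaction.left _ _ h⟩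
        | exact .inr ⟨_, _, rfl, rfl, Interaction.left _ _ h⟩
    · rcases x with (a | a') | (b | b') <;> rcases y with (c | c') | (d | d') <;>
        change Sum.LiftRel _ _ _ _ at h <;> simp only [shuffle] at h <;> cases h
      all_goals rename_i h
      all_goals first
        | exact .inl ⟨_, _, rfl, rfl, Interaction.right _ _ h⟩
        | exact .inr ⟨_, _, rfl, rfl, Interaction.right _ _ h⟩
  have all : ∀ u v, Relation.TransGen K u v →
      (∃ p q, j p = u ∧ j q = v ∧ Relation.TransGen I p q) ∨
      (∃ p q, j' p = u ∧ j' q = v ∧ Relation.TransGen I' p q) := by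
    intro u v h
    induction h with
    | single h =>
      rcases down _ _ h with ⟨p, q, hp, hq, h⟩ | ⟨p, q, hp, hq, h⟩
      · exact .inl ⟨p, q, hp, hq, .single h⟩
      · exact .inr ⟨p, q, hp, hq, .single h⟩
    | tail _ h ih =>
      rcases down _ _ h with ⟨p, q, hp, hq, h⟩ | ⟨p, q, hp, hq, h⟩ <;>
        rcases ih with ⟨p', q', hp', hq', h'⟩ | ⟨p', q', hp', hq', h'⟩
      · obtain rfl := hj (hp.trans hq'.symm)
        exact .inl ⟨p', q, hp', hq, h'.tail h⟩
      · exact absurd (hp.trans hq'.symm) (hjj _ _)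
      · exact absurd (hq'.trans hp.symm) (hjj _ _)
      · obtain rfl := hj' (hp.trans hq'.symm)
        exact .inr ⟨p', q, hp', hq, h'.tail h⟩
  have tg : ∀ p q, Relation.TransGen K (j p) (j q) ↔ Relation.TransGen I p q := by
    intro p q
    refine ⟨fun h => ?_, fun h => Relation.TransGen.lift j up _ _ h⟩
    rcases all _ _ h with ⟨p', q', hp, hq, h⟩ | ⟨p', q', hp, hq, h⟩
    · rwa [← hj hp, ← hj hq]
    · exact absurd hp.symm (hjj _ _)
  have tg' : ∀ p q, Relation.TransGen K (j' p) (j' q) ↔ Relation.TransGen I' p q := by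
    intro p q
    refine ⟨fun h => ?_, fun h => Relation.TransGen.lift j' up' _ _ h⟩
    rcases all _ _ h with ⟨p', q', hp, hq, h⟩ | ⟨p', q', hp, hq, h⟩
    · exact absurd hp (hjj _ _)
    · rwa [← hj' hp, ← hj' hq]
  have ntg : ∀ p q, ¬ Relation.TransGen K (j p) (j' q) := by
    intro p q h
    rcases all _ _ h with ⟨p', q', hp, hq, h⟩ | ⟨p', q', hp, hq, h⟩
    · exact hjj _ _ hq
    · exact hjj _ _ hp.symm
  have ntg' : ∀ p q, ¬ Relation.TransGen K (j' p) (j q) := by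
    intro p q h
    rcases all _ _ h with ⟨p', q', hp, hq, h⟩ | ⟨p', q', hp, hq, h⟩
    · exact hjj _ _ hp
    · exact hjj _ _ hq.symm
  apply CyclicStrategy.ext
  funext x y
  apply propext
  change Relation.TransGen K (Sum.map id Sum.inr x) (Sum.map id Sum.inr y) ↔
    Sum.LiftRel (fun x y => Relation.TransGen I (Sum.map id Sum.inr x) (Sum.map id Sum.inr y))
      (fun x y => Relation.TransGen I' (Sum.map id Sum.inr x) (Sum.map id Sum.inr y))
      (shuffle x) (shuffle y)
  rcases x with (a | a') | (b | b') <;> rcases y with (c | c') | (d | d') <;>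
    simp only [shuffle, Sum.liftRel_inl_inl, Sum.liftRel_inr_inr, Sum.not_liftRel_inl_inr,
      Sum.not_liftRel_inr_inl, iff_false]
  all_goals first
    | exact tg (.inl _) (.inl _)
    | exact tg (.inl _) (.inr (.inr _))
    | exact tg (.inr (.inr _)) (.inl _)
    | exact tg (.inr (.inr _)) (.inr (.inr _))
    | exact tg' (.inl _) (.inl _)
    | exact tg' (.inl _) (.inr (.inr _))
    | exact tg' (.inr (.inr _)) (.inl _)
    | exact tg' (.inr (.inr _)) (.inr (.inr _))
    | exact ntg (.inl _) (.inl _)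
    | exact ntg (.inl _) (.inr (.inr _))
    | exact ntg (.inr (.inr _)) (.inl _)
    | exact ntg (.inr (.inr _)) (.inr (.inr _))
    | exact ntg' (.inl _) (.inl _)
    | exact ntg' (.inl _) (.inr (.inr _))
    | exact ntg' (.inr (.inr _)) (.inl _)
    | exact ntg' (.inr (.inr _)) (.inr (.inr _))

/-- An isomorphism of games induces a morphism. -/
theorem IsMorphism.copycat (e : A.game.Moves ≃ B.game.Moves)
    (he : ∀ a, B.game.pol (e a) = A.game.pol a) (hle : ∀ a a', a ≤ a' → e a ≤ e a') :
    IsMorphism (A := A) (B := B) (Game.copycat e he) :=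
  .strategy _ (copycat_isStrategy e he hle)

theorem beforeHom_isStrategy (σ : A.game ⟶ B.game) (τ : C.game ⟶ D.game)
    (hσ : IsStrategy (A.game.arrow B.game) (CyclicStrategy.rel σ))
    (hτ : IsStrategy (C.game.arrow D.game) (CyclicStrategy.rel τ)) :
    IsStrategy ((before A C).game.arrow (before B D).game)
      (CyclicStrategy.rel (beforeHom σ τ)) where
  isPartialOrder := CyclicStrategy.isPartialOrder _
  polarity := CyclicStrategy.polarity _
  acyclic := by
    have h₁ := hσ.acyclic
    have h₂ := hτ.acyclic
    let R := Sum.Lex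
      (Relation.TransGen fun m n : (A.game.arrow B.game).Moves => CyclicStrategy.rel σ m n ∨ m ≤ n)
      (Relation.TransGen fun m n : (C.game.arrow D.game).Moves => CyclicStrategy.rel τ m n ∨ m ≤ n)
    have : IsPartialOrder _ R :=
      { refl := refl_of _, trans := fun _ _ _ => trans_of _, antisymm := fun _ _ => antisymm_of _ }
    refine isPartialOrder_transGen
      (fun a => .inr (@le_refl _ (Game.order _).toPreorder a)) R shuffle shuffle_injective ?_
    rintro x y (h | h)
    · change Sum.LiftRel _ _ _ _ at h
      generalize shuffle x = x, shuffle y = y at h ⊢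
      cases h with
      | inl h => exact .inl (.single (.inl h))
      | inr h => exact .inr (.single (.inl h))
    · rcases x with x | x <;> rcases y with y | y
      · have h' : Sum.Lex (α := A.game.Moves) (β := C.game.Moves) (· ≤ ·) (· ≤ ·) x y :=
          arrow_le_inl.1 h
        clear h
        cases h' with
        | inl k => exact .inl (.single (.inr (arrow_le_inl.2 k)))
        | inr k => exact .inr (.single (.inr (arrow_le_inl.2 k)))
        | sep a b => exact .sep _ _
      · exact absurd h not_arrow_le_inl_inr
      · exact absurd h not_arrow_le_inr_inl
      · have h' : Sum.Lex (α := B.game.Moves) (β := D.game.Moves) (· ≤ ·) (· ≤ ·) x y :=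
          arrow_le_inr.1 h
        clear h
        cases h' with
        | inl k => exact .inl (.single (.inr (arrow_le_inr.2 k)))
        | inr k => exact .inr (.single (.inr (arrow_le_inr.2 k)))
        | sep a b => exact .sep _ _

theorem IsMorphism.beforeHom {σ : A.game ⟶ B.game} {τ : C.game ⟶ D.game} (hσ : IsMorphism σ)
    (hτ : IsMorphism τ) : IsMorphism (A := before A C) (B := before B D) (beforeHom σ τ) := by
  have hid : ∀ X : Games, IsStrategy (X.game.arrow X.game) (CyclicStrategy.rel (𝟙 X.game)) :=
    fun X => copycat_isStrategy (Equiv.refl _) (fun _ => by simp) fun _ _ h => h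
  have left : ∀ {A B : Games} {σ : A.game ⟶ B.game}, IsMorphism σ → ∀ C : Games,
      IsMorphism (A := before A C) (B := before B C) (Games.beforeHom σ (𝟙 C.game)) := by
    intro A B σ hσ C
    induction hσ with
    | strategy σ h => exact .strategy _ (beforeHom_isStrategy _ _ h (hid C))
    | comp σ τ _ _ ih₁ ih₂ =>
      have := beforeHom_comp σ (𝟙 C.game) τ (𝟙 C.game)
      rw [Category.comp_id] at this
      rw [← this]
      exact .comp (A := before _ C) (B := before _ C) (C := before _ C) _ _ ih₁ ih₂
  have right : ∀ {A B : Games} {σ : A.game ⟶ B.game}, IsMorphism σ → ∀ C : Games,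
      IsMorphism (A := before C A) (B := before C B) (Games.beforeHom (𝟙 C.game) σ) := by
    intro A B σ hσ C
    induction hσ with
    | strategy σ h => exact .strategy _ (beforeHom_isStrategy _ _ (hid C) h)
    | comp σ τ _ _ ih₁ ih₂ =>
      have := beforeHom_comp (𝟙 C.game) σ (𝟙 C.game) τ
      rw [Category.comp_id] at this
      rw [← this]
      exact .comp (A := before C _) (B := before C _) (C := before C _) _ _ ih₁ ih₂
  have := beforeHom_comp σ (𝟙 C.game) (𝟙 B.game) τ
  rw [Category.comp_id, Category.id_comp] at this
  rw [← this]
  exact .comp (A := before A C) (B := before B C) (C := before B D) _ _ (left hσ C) (right hτ B)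

theorem copycat_congr {A B : Game} {e f : A.Moves ≃ B.Moves} (he : ∀ a, B.pol (e a) = A.pol a)
    (hf : ∀ a, B.pol (f a) = A.pol a) (h : ∀ a, e a = f a) : copycat e he = copycat f hf := by
  obtain rfl : e = f := Equiv.ext h
  rfl

/-- The isomorphism of `Games` induced by an isomorphism of games. -/
def isoOf (e : A.game.Moves ≃ B.game.Moves) (he : ∀ a, B.game.pol (e a) = A.game.pol a)
    (hle : ∀ a a', a ≤ a' ↔ e a ≤ e a') : A ≅ B where
  hom := ⟨copycat e he, .copycat e he fun a a' h => (hle a a').1 h⟩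
  inv := ⟨copycat e.symm fun b => by rw [← he, e.apply_symm_apply],
    .copycat _ _ fun b b' h => (hle _ _).2 (by simpa using h)⟩
  hom_inv_id := by
    apply Subtype.ext
    refine (copycat_comp_copycat e he e.symm fun b => by rw [← he, e.apply_symm_apply]).trans ?_
    exact copycat_congr _ (fun _ => by simp) fun a => by simp
  inv_hom_id := by
    apply Subtype.ext
    refine (copycat_comp_copycat e.symm (fun b => by rw [← he, e.apply_symm_apply]) e he).trans ?_
    exact copycat_congr _ (fun _ => by simp) fun a => by simp

theorem beforeHom_copycat (e : A.game.Moves ≃ B.game.Moves)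
    (he : ∀ a, B.game.pol (e a) = A.game.pol a) (f : C.game.Moves ≃ D.game.Moves)
    (hf : ∀ a, D.game.pol (f a) = C.game.pol a) :
    beforeHom (A := A) (B := B) (C := C) (D := D) (copycat e he) (copycat f hf) =
      copycat (A := (before A C).game) (B := (before B D).game) (Equiv.sumCongr e f)
        (by rintro (a | c) <;> simp [he, hf]) := by
  apply CyclicStrategy.ext
  funext x y
  apply propext
  change Sum.LiftRel (copyRel A.game e) (copyRel C.game f) (shuffle x) (shuffle y) ↔
    copyRel (before A C).game (B := (before B D).game) (Equiv.sumCongr e f) x y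
  rcases x with (a | c) | (b | d) <;> rcases y with (a' | c') | (b' | d') <;>
    simp [shuffle, copyRel]

theorem beforeHom_id (A B : Games) :
    beforeHom (𝟙 A.game) (𝟙 B.game) = 𝟙 (before A B).game := by
  refine (beforeHom_copycat (A := A) (B := A) (C := B) (D := B) (Equiv.refl _) (fun _ => by simp)
    (Equiv.refl _) (fun _ => by simp)).trans ?_
  exact copycat_congr _ (fun _ => by simp) (by rintro (a | b) <;> rfl)

/-- The monoidal structure on finite filiform games given by `before` and the empty game. -/
instance : MonoidalCategoryStruct Games where
  tensorObj := before
  tensorUnit := empty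
  tensorHom σ τ := ⟨beforeHom σ.1 τ.1, .beforeHom σ.2 τ.2⟩
  whiskerLeft A _ _ σ := ⟨beforeHom (𝟙 A.game) σ.1, .beforeHom (.id A) σ.2⟩
  whiskerRight σ A := ⟨beforeHom σ.1 (𝟙 A.game), .beforeHom σ.2 (.id A)⟩
  associator A B C := isoOf (A := before (before A B) C) (B := before A (before B C))
    (Equiv.sumAssoc _ _ _) (by rintro ((a | b) | c) <;> rfl) (by
      rintro ((a | b) | c) ((a' | b') | c') <;> change Sum.Lex _ _ _ _ ↔ Sum.Lex _ _ _ _ <;>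
        simp [LE.le])
  leftUnitor A := isoOf (A := before empty A) (B := A) (Equiv.emptySum _ _)
    (by rintro (a | b); exacts [a.elim, rfl]) (by
      rintro (a | b) (a' | b')
      · exact a.elim
      · exact a.elim
      · exact a'.elim
      · exact Sum.lex_inr_inr)
  rightUnitor A := isoOf (A := before A empty) (B := A) (Equiv.sumEmpty _ _)
    (by rintro (a | b); exacts [rfl, b.elim]) (by
      rintro (a | b) (a' | b')
      · exact Sum.lex_inl_inl
      · exact b'.elim
      · exact b.elim
      · exact b.elim)

theorem beforeHom_rel (σ : A.game ⟶ B.game) (τ : C.game ⟶ D.game)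
    (x y : (A.game.Moves ⊕ C.game.Moves) ⊕ (B.game.Moves ⊕ D.game.Moves)) :
    CyclicStrategy.rel (beforeHom σ τ) x y ↔
      Sum.LiftRel (CyclicStrategy.rel σ) (CyclicStrategy.rel τ) (shuffle x) (shuffle y) :=
  Iff.rfl

theorem hom_ext_of_rel {A B : Games} {f g : A ⟶ B}
    (h : ∀ x y : A.game.Moves ⊕ B.game.Moves,
      CyclicStrategy.rel f.1 x y ↔ CyclicStrategy.rel g.1 x y) : f = g :=
  Subtype.ext (CyclicStrategy.ext (funext fun x => funext fun y => propext (h x y)))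

theorem comp_isoOf_rel {A B C : Games} (f : A ⟶ B) (e : B.game.Moves ≃ C.game.Moves)
    (he : ∀ b, C.game.pol (e b) = B.game.pol b) (hle : ∀ b b', b ≤ b' ↔ e b ≤ e b')
    (x y : A.game.Moves ⊕ C.game.Moves) :
    CyclicStrategy.rel (f ≫ (isoOf e he hle).hom).1 x y ↔
      CyclicStrategy.rel f.1 (Sum.map id e.symm x) (Sum.map id e.symm y) :=
  comp_copycat_rel e he f.1 x y

theorem isoOf_comp_rel {A B C : Games} (e : A.game.Moves ≃ B.game.Moves)
    (he : ∀ a, B.game.pol (e a) = A.game.pol a) (hle : ∀ a a', a ≤ a' ↔ e a ≤ e a')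
    (f : B ⟶ C) (x y : A.game.Moves ⊕ C.game.Moves) :
    CyclicStrategy.rel ((isoOf e he hle).hom ≫ f).1 x y ↔
      CyclicStrategy.rel f.1 (Sum.map e id x) (Sum.map e id y) :=
  copycat_comp_rel e he f.1 x y

theorem liftRel_shuffle_assoc {α α' β β' γ γ' : Type} (r : α ⊕ α' → α ⊕ α' → Prop)
    (s : β ⊕ β' → β ⊕ β' → Prop) (t : γ ⊕ γ' → γ ⊕ γ' → Prop)
    (x y : ((α ⊕ β) ⊕ γ) ⊕ (α' ⊕ β' ⊕ γ')) :
    Sum.LiftRel (fun x y => Sum.LiftRel r s (shuffle x) (shuffle y)) t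
        (shuffle (Sum.map id (Equiv.sumAssoc α' β' γ').symm x))
        (shuffle (Sum.map id (Equiv.sumAssoc α' β' γ').symm y)) ↔
      Sum.LiftRel r (fun x y => Sum.LiftRel s t (shuffle x) (shuffle y))
        (shuffle (Sum.map (Equiv.sumAssoc α β γ) id x))
        (shuffle (Sum.map (Equiv.sumAssoc α β γ) id y)) := by
  rcases x with ((_ | _) | _) | (_ | _ | _) <;> rcases y with ((_ | _) | _) | (_ | _ | _) <;>
    simp [shuffle]

/-- The morphism `f` is the copycat strategy along `e`. -/
def IsCopy {A B : Games} (f : A ⟶ B) (e : A.game.Moves ≃ B.game.Moves) : Prop :=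
  ∃ he, f.1 = copycat e he

theorem IsCopy.eq {A B : Games} {f g : A ⟶ B} {e e' : A.game.Moves ≃ B.game.Moves}
    (hf : IsCopy f e) (hg : IsCopy g e') (h : ∀ a, e a = e' a) : f = g := by
  obtain ⟨he, hf⟩ := hf
  obtain ⟨he', hg⟩ := hg
  exact Subtype.ext (hf.trans ((copycat_congr he he' h).trans hg.symm))

theorem IsCopy.id (A : Games) : IsCopy (𝟙 A) (Equiv.refl _) := ⟨fun _ => by simp, rfl⟩

theorem IsCopy.isoOf {A B : Games} (e : A.game.Moves ≃ B.game.Moves)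
    (he : ∀ a, B.game.pol (e a) = A.game.pol a) (hle : ∀ a a', a ≤ a' ↔ e a ≤ e a') :
    IsCopy (isoOf e he hle).hom e := ⟨he, rfl⟩

theorem IsCopy.comp {A B C : Games} {f : A ⟶ B} {g : B ⟶ C} {e : A.game.Moves ≃ B.game.Moves}
    {e' : B.game.Moves ≃ C.game.Moves} (hf : IsCopy f e) (hg : IsCopy g e') :
    IsCopy (f ≫ g) (e.trans e') := by
  obtain ⟨he, hf⟩ := hf
  obtain ⟨he', hg⟩ := hg
  refine ⟨fun a => by rw [Equiv.trans_apply, he', he], ?_⟩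
  refine Eq.trans ?_ (copycat_comp_copycat e he e' he')
  change CyclicStrategy.comp f.1 g.1 = _
  rw [hf, hg]

theorem IsCopy.tensor {A B C D : Games} {f : A ⟶ B} {g : C ⟶ D}
    {e : A.game.Moves ≃ B.game.Moves} {e' : C.game.Moves ≃ D.game.Moves} (hf : IsCopy f e)
    (hg : IsCopy g e') :
    IsCopy (MonoidalCategoryStruct.tensorHom f g) (Equiv.sumCongr e e') := by
  obtain ⟨he, hf⟩ := hf
  obtain ⟨he', hg⟩ := hg
  refine ⟨by rintro (a | c) <;> simp [MonoidalCategoryStruct.tensorObj, he, he'], ?_⟩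
  refine Eq.trans ?_ (beforeHom_copycat e he e' he')
  change beforeHom f.1 g.1 = _
  rw [hf, hg]

instance : MonoidalCategory Games :=
  MonoidalCategory.ofTensorHom
    (id_tensorHom_id := fun A B => Subtype.ext (beforeHom_id A B))
    (id_tensorHom := fun _ _ _ _ => rfl)
    (tensorHom_id := fun _ _ => rfl)
    (tensorHom_comp_tensorHom := fun f₁ f₂ g₁ g₂ =>
      Subtype.ext (beforeHom_comp f₁.1 f₂.1 g₁.1 g₂.1))
    (associator_naturality := by
      intro A B C A' B' C' f g h
      refine hom_ext_of_rel fun x y =>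
        (comp_isoOf_rel _ _ _ _ x y).trans (Iff.trans ?_ (isoOf_comp_rel _ _ _ _ x y).symm)
      exact liftRel_shuffle_assoc (CyclicStrategy.rel f.1) (CyclicStrategy.rel g.1)
        (CyclicStrategy.rel h.1) x y)
    (leftUnitor_naturality := by
      intro A B f
      refine hom_ext_of_rel fun x y =>
        (comp_isoOf_rel _ _ _ _ x y).trans (Iff.trans ?_ (isoOf_comp_rel _ _ _ _ x y).symm)
      rcases x with (a | _) | _ <;> rcases y with (b | _) | _ <;>
        first
          | exact a.elim
          | exact b.elim
          | exact (beforeHom_rel _ _ _ _).trans Sum.liftRel_inr_inr)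
    (rightUnitor_naturality := by
      intro A B f
      refine hom_ext_of_rel fun x y =>
        (comp_isoOf_rel _ _ _ _ x y).trans (Iff.trans ?_ (isoOf_comp_rel _ _ _ _ x y).symm)
      rcases x with (_ | a) | _ <;> rcases y with (_ | b) | _ <;>
        first
          | exact a.elim
          | exact b.elim
          | exact (beforeHom_rel _ _ _ _).trans Sum.liftRel_inl_inl)
    (pentagon := by
      intro W X Y Z
      refine IsCopy.eq (((IsCopy.isoOf _ _ _).tensor (.id _)).comp ((IsCopy.isoOf _ _ _).comp
        (IsCopy.tensor (.id _) (IsCopy.isoOf _ _ _))))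
        ((IsCopy.isoOf _ _ _).comp (IsCopy.isoOf _ _ _)) ?_
      rintro (((_ | _) | _) | _) <;> rfl)
    (triangle := by
      intro X Y
      refine IsCopy.eq ((IsCopy.isoOf _ _ _).comp (IsCopy.tensor (.id _) (IsCopy.isoOf _ _ _)))
        ((IsCopy.isoOf _ _ _).tensor (.id _)) ?_
      rintro ((_ | a) | _)
      · rfl
      · exact a.elim
      · rfl)

end Games

end Causality

open CategoryTheory

namespace Causality

open Polarity StratGen

/-! ### Whiskered generators -/

/-! For a morphism `A ⟶ B`, the letters P of `A` and O of `B` are the Opponent moves of the arrow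
game, and the letters O of `A` and P of `B` its Proponent moves. A cyclic strategy is thus a Boolean
matrix telling which Opponent moves each Proponent move depends on. The letters O carry a bialgebra
of Boolean matrices (copy, discard, add, zero, exchange, with `x + x = x`), and the duality bends
wires to obtain the letters P. The theorem says that the functor `Games.semantics` interpreting
terms this way is an equivalence and monoidal.

Soundness. On Opponent terms, composition is a product of Boolean matrices, so the bialgebra
relations are finite computations; the zigzags are followed along explicit paths; the remaining
generators are interpreted by their defining transposes. Coherence is automatic, since there is at
most one order isomorphism between two finite total orders.

Faithfulness. The letters of `A` and `B` are consumed from left to right with a memory `Oⁿ`. An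
Opponent letter enlarges the memory; a Proponent letter is attached to a marked subset of it. The
morphisms built this way (`NF`) contain the identities (`NF.id`) and are stable under composition
with every generator (`Post.all`), so every morphism is of this form (`NF.all`). Each step can be
undone inside the theory: feeding zero to an input O, or applying the counit to an output P,
recovers the rest, and silencing all other letters recovers the marked subset. When an input O and
an output P compete to be read, the two readings commute. Hence a functor that respects whiskering
and keeps two elementary pairs of morphisms apart is faithful (`faithful_of_separates`), and no
normal form has to be interpreted.

Fullness. The morphisms of `Games` are generated by strategies, so strategies suffice
(`Games.exists_sem_eq`). They are realised by the same left-to-right reading. When the next letters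
are an input O and an output P, acyclicity ensures that one of them depends on the memory only:
otherwise the two dependencies and the two causal orders close a cycle. Finally, a finite filiform
game is a word of polarities up to relabelling, which gives essential surjectivity. -/

/-- Morphisms of the category generated by the theory of strategies. -/
abbrev Mor (A B : List Polarity) : Type :=
  (⟨A⟩ : Presented stratTheory) ⟶ (⟨B⟩ : Presented stratTheory)

/-- The morphism represented by a term. -/
abbrev ofT {A B : List Polarity} (t : Term stratSig A B) : Mor A B :=
  Presented.ofTerm (T := stratTheory) t

/-- Tensor product of morphisms. -/
def tensMor {A B C D : List Polarity} (f : Mor A B) (g : Mor C D) : Mor (A ++ C) (B ++ D) :=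
  Presented.tens f g

/-- Whiskering by a word on the right. -/
def rwk {A B : List Polarity} (f : Mor A B) (Y : List Polarity) : Mor (A ++ Y) (B ++ Y) :=
  tensMor f (𝟙 (⟨Y⟩ : Presented stratTheory))

/-- Whiskering by a letter on the left. -/
def lw (a : Polarity) {A B : List Polarity} (f : Mor A B) : Mor (a :: A) (a :: B) :=
  tensMor (𝟙 (⟨[a]⟩ : Presented stratTheory)) f

section

variable {A B C D : List Polarity}

theorem lw_id (a : Polarity) (A : List Polarity) :
    lw a (𝟙 (⟨A⟩ : Presented stratTheory)) = 𝟙 (⟨a :: A⟩ : Presented stratTheory) :=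
  Presented.tens_id (T := stratTheory) ⟨[a]⟩ ⟨A⟩

theorem lw_comp (a : Polarity) (f : Mor A B) (g : Mor B C) :
    lw a (f ≫ g) = lw a f ≫ lw a g := by
  have := Presented.tens_comp (𝟙 (⟨[a]⟩ : Presented stratTheory)) f (𝟙 _) g
  rw [Category.id_comp] at this
  exact this.symm

theorem rw_id (A Y : List Polarity) :
    rwk (𝟙 (⟨A⟩ : Presented stratTheory)) Y = 𝟙 (⟨A ++ Y⟩ : Presented stratTheory) :=
  Presented.tens_id (T := stratTheory) ⟨A⟩ ⟨Y⟩

theorem rw_comp (f : Mor A B) (g : Mor B C) (Y : List Polarity) :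
    rwk (f ≫ g) Y = rwk f Y ≫ rwk g Y := by
  have := Presented.tens_comp f (𝟙 (⟨Y⟩ : Presented stratTheory)) g (𝟙 _)
  rw [Category.id_comp] at this
  exact this.symm

/-- The associativity law of the theory contains a cast, but reassociating after a one-letter first
factor is definitional, so no transport appears. This is why left whiskering is done letter by
letter. -/
theorem lw_tens (a : Polarity) {A' B' : List Polarity} (f : Mor A B) (g : Mor A' B') :
    lw a (tensMor f g) = tensMor (lw a f) g := by
  induction f using Quotient.inductionOn with | _ f
  induction g using Quotient.inductionOn with | _ g
  exact Quotient.sound (Theory.Eqv.tensor_assoc (T := stratTheory)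
    (Term.id (S := stratSig) [a]) f g).symm

theorem lw_rw (a : Polarity) (f : Mor A B) (Y : List Polarity) :
    lw a (rwk f Y) = rwk (lw a f) Y := lw_tens a f _

theorem tens_eq {A' B' : List Polarity} (f : Mor A B) (g : Mor A' B') :
    tensMor f g = rwk f A' ≫ tensMor (𝟙 (⟨B⟩ : Presented stratTheory)) g := by
  have := Presented.tens_comp f (𝟙 (⟨A'⟩ : Presented stratTheory)) (𝟙 _) g
  rw [Category.id_comp, Category.comp_id] at this
  exact this.symm

theorem tens_eq' {A' B' : List Polarity} (f : Mor A B) (g : Mor A' B') :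
    tensMor f g = tensMor (𝟙 (⟨A⟩ : Presented stratTheory)) g ≫ rwk f B' := by
  have := Presented.tens_comp (𝟙 (⟨A⟩ : Presented stratTheory)) g f (𝟙 _)
  rw [Category.id_comp, Category.comp_id] at this
  exact this.symm

theorem nil_tens (f : Mor A B) : tensMor (𝟙 (⟨[]⟩ : Presented stratTheory)) f = f := by
  induction f using Quotient.inductionOn with | _ f
  exact Quotient.sound (Theory.Eqv.unit_tensor (T := stratTheory) f)

/-- Whiskering by a word on the left. -/
theorem cons_tens (a : Polarity) (X : List Polarity) (f : Mor A B) :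
    tensMor (𝟙 (⟨a :: X⟩ : Presented stratTheory)) f =
      lw a (tensMor (𝟙 (⟨X⟩ : Presented stratTheory)) f) := by
  rw [lw_tens, lw_id]

end

/-- Multiplication, acting on the first two letters. -/
def mu (Y : List Polarity) : Mor (O :: O :: Y) (O :: Y) := rwk (ofT μO) Y
def eta (Y : List Polarity) : Mor Y (O :: Y) := rwk (ofT ηO) Y
def del (Y : List Polarity) : Mor (O :: Y) (O :: O :: Y) := rwk (ofT δO) Y
def eps (Y : List Polarity) : Mor (O :: Y) Y := rwk (ofT εO) Y
def gam (Y : List Polarity) : Mor (O :: O :: Y) (O :: O :: Y) := rwk (ofT γO) Y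
def etaOP (Y : List Polarity) : Mor Y (O :: P :: Y) := rwk (ofT ηOP) Y
def epsOP (Y : List Polarity) : Mor (P :: O :: Y) Y := rwk (ofT εOP) Y

/-! ### Naturality of the generators in the untouched tail of the word -/

section naturality

variable {Y Z : List Polarity} (f : Mor Y Z)

theorem rw_natural {A B : List Polarity} (g : Mor A B) :
    rwk g Y ≫ tensMor (𝟙 (⟨B⟩ : Presented stratTheory)) f =
      tensMor (𝟙 (⟨A⟩ : Presented stratTheory)) f ≫ rwk g Z :=
  (tens_eq g f).symm.trans (tens_eq' g f)

theorem mu_nat : mu Y ≫ lw O f = lw O (lw O f) ≫ mu Z := by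
  have := rw_natural f (ofT μO)
  repeat rw [cons_tens] at this
  rw [nil_tens] at this
  exact this

theorem eta_nat : eta Y ≫ lw O f = f ≫ eta Z := by
  have := rw_natural f (ofT ηO)
  repeat rw [cons_tens] at this
  rw [nil_tens] at this
  exact this

theorem del_nat : del Y ≫ lw O (lw O f) = lw O f ≫ del Z := by
  have := rw_natural f (ofT δO)
  repeat rw [cons_tens] at this
  rw [nil_tens] at this
  exact this

theorem eps_nat : eps Y ≫ f = lw O f ≫ eps Z := by
  have := rw_natural f (ofT εO)
  repeat rw [cons_tens] at this
  rw [nil_tens] at this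
  exact this

theorem gam_nat : gam Y ≫ lw O (lw O f) = lw O (lw O f) ≫ gam Z := by
  have := rw_natural f (ofT γO)
  repeat rw [cons_tens] at this
  rw [nil_tens] at this
  exact this

theorem etaOP_nat : etaOP Y ≫ lw O (lw P f) = f ≫ etaOP Z := by
  have := rw_natural f (ofT ηOP)
  repeat rw [cons_tens] at this
  rw [nil_tens] at this
  exact this

theorem epsOP_nat : epsOP Y ≫ f = lw P (lw O f) ≫ epsOP Z := by
  have := rw_natural f (ofT εOP)
  repeat rw [cons_tens] at this
  rw [nil_tens] at this
  exact this

end naturality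

/-! ### The relations of the theory, whiskered by an arbitrary tail -/

section relations

variable (Y : List Polarity)

theorem rel_sound {A B : List Polarity} {f g : Term stratSig A B} (h : StratRel f g) :
    rwk (ofT f) Y = rwk (ofT g) Y := by
  have : ofT f = ofT g := Quotient.sound (Theory.Eqv.rel (T := stratTheory) h)
  rw [this]

theorem bialg_sound {A B : List Polarity} {f g : Term stratSig A B}
    (h : BialgebraRel (S := stratSig) O μO ηO δO εO γO f g) :
    rwk (ofT f) Y = rwk (ofT g) Y := rel_sound Y (.opponent h)

theorem rw_comp_term {A B C : List Polarity} (f : Term stratSig A B) (g : Term stratSig B C) :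
    rwk (ofT (Term.comp f g)) Y = rwk (ofT f) Y ≫ rwk (ofT g) Y :=
  rw_comp (ofT f) (ofT g) Y

theorem rw_whisker_left (a : Polarity) {A B : List Polarity} (f : Term stratSig A B) :
    rwk (ofT (Term.tensor (S := stratSig) (Term.id [a]) f)) Y = lw a (rwk (ofT f) Y) :=
  (lw_rw a (ofT f) Y).symm

theorem ofT_id (A : List Polarity) : rwk (ofT (Term.id (S := stratSig) A)) Y = 𝟙 _ := rw_id A Y

/-- When the source and target of `f` and the word `X` are concrete, the cast is definitionally
trivial; the uses below rely on this. -/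
theorem rw_whisker_right {A B X : List Polarity} (f : Term stratSig A B) :
    Theory.Eqv stratTheory
      (Term.cast (List.append_assoc _ _ _) (List.append_assoc _ _ _)
        (Term.tensor (Term.tensor f (Term.id (S := stratSig) X)) (Term.id (S := stratSig) Y)))
      (Term.tensor f (Term.id (S := stratSig) (X ++ Y))) :=
  (Theory.Eqv.tensor_assoc (T := stratTheory) f (Term.id (S := stratSig) X)
    (Term.id (S := stratSig) Y)).trans 
    (.tensor (.refl (T := stratTheory) f) (.tensor_id (T := stratTheory) X Y))

theorem mu_whisker (X : List Polarity) :
    rwk (ofT (Term.tensor (S := stratSig) μO (Term.id X))) Y = mu (X ++ Y) :=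
  Quotient.sound (rw_whisker_right (X := X) Y μO)

theorem eta_whisker (X : List Polarity) :
    rwk (ofT (Term.tensor (S := stratSig) ηO (Term.id X))) Y = eta (X ++ Y) :=
  Quotient.sound (rw_whisker_right (X := X) Y ηO)

theorem del_whisker (X : List Polarity) :
    rwk (ofT (Term.tensor (S := stratSig) δO (Term.id X))) Y = del (X ++ Y) :=
  Quotient.sound (rw_whisker_right (X := X) Y δO)

theorem eps_whisker (X : List Polarity) :
    rwk (ofT (Term.tensor (S := stratSig) εO (Term.id X))) Y = eps (X ++ Y) :=
  Quotient.sound (rw_whisker_right (X := X) Y εO)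

theorem gam_whisker (X : List Polarity) :
    rwk (ofT (Term.tensor (S := stratSig) γO (Term.id X))) Y = gam (X ++ Y) :=
  Quotient.sound (rw_whisker_right (X := X) Y γO)


theorem gam_gam : gam Y ≫ gam Y = 𝟙 _ := by
  have := bialg_sound Y .sym_sym
  simp only [rw_comp_term, ofT_id] at this
  exact this

theorem yang_baxter :
    gam (O :: Y) ≫ lw O (gam Y) ≫ gam (O :: Y) = lw O (gam Y) ≫ gam (O :: Y) ≫ lw O (gam Y) := by
  have := bialg_sound Y .yang_baxter
  simp only [rw_comp_term, gam_whisker] at this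
  repeat erw [rw_whisker_left] at this
  exact this

theorem mu_assoc : mu (O :: Y) ≫ mu Y = lw O (mu Y) ≫ mu Y := by
  have := bialg_sound Y .mul_assoc
  simp only [rw_comp_term, mu_whisker] at this
  repeat erw [rw_whisker_left] at this
  exact this

theorem eta_mu : eta (O :: Y) ≫ mu Y = 𝟙 _ := by
  have := bialg_sound Y .unit_mul
  simp only [rw_comp_term, eta_whisker, ofT_id] at this
  exact this

theorem lw_eta_mu : lw O (eta Y) ≫ mu Y = 𝟙 _ := by
  have := bialg_sound Y .mul_unit
  simp only [rw_comp_term, ofT_id] at this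
  repeat erw [rw_whisker_left] at this
  exact this

theorem mu_gam : mu (O :: Y) ≫ gam Y = lw O (gam Y) ≫ gam (O :: Y) ≫ lw O (mu Y) := by
  have := bialg_sound Y .mul_sym_left
  simp only [rw_comp_term, mu_whisker, gam_whisker] at this
  repeat erw [rw_whisker_left] at this
  exact this

theorem lw_mu_gam : lw O (mu Y) ≫ gam Y = gam (O :: Y) ≫ lw O (gam Y) ≫ mu (O :: Y) := by
  have := bialg_sound Y .mul_sym_right
  simp only [rw_comp_term, mu_whisker, gam_whisker] at this
  repeat erw [rw_whisker_left] at this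
  exact this

theorem eta_gam : eta (O :: Y) ≫ gam Y = lw O (eta Y) := by
  have := bialg_sound Y .unit_sym_left
  simp only [rw_comp_term, eta_whisker] at this
  repeat erw [rw_whisker_left] at this
  exact this

theorem lw_eta_gam : lw O (eta Y) ≫ gam Y = eta (O :: Y) := by
  have := bialg_sound Y .unit_sym_right
  simp only [rw_comp_term, eta_whisker] at this
  repeat erw [rw_whisker_left] at this
  exact this

theorem gam_mu : gam Y ≫ mu Y = mu Y := by
  have := bialg_sound Y .mul_comm
  simp only [rw_comp_term] at this
  exact this

theorem del_assoc : del Y ≫ del (O :: Y) = del Y ≫ lw O (del Y) := by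
  have := bialg_sound Y .comul_assoc
  simp only [rw_comp_term, del_whisker] at this
  repeat erw [rw_whisker_left] at this
  exact this

theorem del_eps : del Y ≫ eps (O :: Y) = 𝟙 _ := by
  have := bialg_sound Y .counit_comul
  simp only [rw_comp_term, eps_whisker, ofT_id] at this
  exact this

theorem del_lw_eps : del Y ≫ lw O (eps Y) = 𝟙 _ := by
  have := bialg_sound Y .comul_counit
  simp only [rw_comp_term, ofT_id] at this
  repeat erw [rw_whisker_left] at this
  exact this

theorem gam_del : gam Y ≫ del (O :: Y) = lw O (del Y) ≫ gam (O :: Y) ≫ lw O (gam Y) := by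
  have := bialg_sound Y .comul_sym_left
  simp only [rw_comp_term, del_whisker, gam_whisker] at this
  repeat erw [rw_whisker_left] at this
  exact this

theorem gam_lw_del : gam Y ≫ lw O (del Y) = del (O :: Y) ≫ lw O (gam Y) ≫ gam (O :: Y) := by
  have := bialg_sound Y .comul_sym_right
  simp only [rw_comp_term, del_whisker, gam_whisker] at this
  repeat erw [rw_whisker_left] at this
  exact this

theorem gam_eps : gam Y ≫ eps (O :: Y) = lw O (eps Y) := by
  have := bialg_sound Y .counit_sym_left
  simp only [rw_comp_term, eps_whisker] at this
  repeat erw [rw_whisker_left] at this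
  exact this

theorem gam_lw_eps : gam Y ≫ lw O (eps Y) = eps (O :: Y) := by
  have := bialg_sound Y .counit_sym_right
  simp only [rw_comp_term, eps_whisker] at this
  repeat erw [rw_whisker_left] at this
  exact this

theorem del_gam : del Y ≫ gam Y = del Y := by
  have := bialg_sound Y .comul_comm
  simp only [rw_comp_term] at this
  exact this

theorem hopf : mu Y ≫ del Y =
    del (O :: Y) ≫ lw O (lw O (del Y)) ≫ lw O (gam (O :: Y)) ≫ mu (O :: O :: Y) ≫
      lw O (mu Y) := by
  have := bialg_sound Y .hopf
  rw [rw_comp_term, rw_comp_term, rw_comp_term, rw_whisker_left, gam_whisker] at this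
  -- A tensor of two generators is made sequential by interchange, left factor first, so that only
  -- whiskered generators remain.
  have h₁ : rwk (ofT (Term.tensor (S := stratSig) δO δO)) Y =
      del (O :: Y) ≫ lw O (lw O (del Y)) := by
    refine (congrArg (rwk · Y) (tens_eq (ofT δO) (ofT δO))).trans ?_
    rw [rw_comp]
    refine congrArg₂ (· ≫ ·) (del_whisker Y [O]) ?_
    rw [cons_tens, cons_tens, nil_tens, ← lw_rw, ← lw_rw]
    rfl
  have h₂ : rwk (ofT (Term.tensor (S := stratSig) μO μO)) Y =
      mu (O :: O :: Y) ≫ lw O (mu Y) := by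
    refine (congrArg (rwk · Y) (tens_eq (ofT μO) (ofT μO))).trans ?_
    rw [rw_comp]
    refine congrArg₂ (· ≫ ·) (mu_whisker Y [O, O]) ?_
    rw [cons_tens, nil_tens, ← lw_rw]
    rfl
  rw [h₁, h₂] at this
  simp only [Category.assoc] at this
  exact this

theorem mu_eps : mu Y ≫ eps Y = eps (O :: Y) ≫ eps Y := by
  have := bialg_sound Y .mul_counit
  rw [rw_comp_term] at this
  refine this.trans ((congrArg (rwk · Y) (tens_eq (ofT εO) (ofT εO))).trans ?_)
  rw [rw_comp]
  refine congrArg₂ (· ≫ ·) (eps_whisker Y [O]) ?_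
  rw [nil_tens]
  rfl

theorem eta_del : eta Y ≫ del Y = eta Y ≫ eta (O :: Y) := by
  have := bialg_sound Y .unit_comul
  rw [rw_comp_term] at this
  refine this.trans ((congrArg (rwk · Y) (tens_eq' (ofT ηO) (ofT ηO))).trans ?_)
  rw [rw_comp]
  refine congrArg₂ (· ≫ ·) ?_ (eta_whisker Y [O])
  rw [nil_tens]
  rfl

theorem eta_eps : eta Y ≫ eps Y = 𝟙 _ := by
  have := bialg_sound Y .unit_counit
  simp only [rw_comp_term, ofT_id] at this
  exact this

theorem del_mu : del Y ≫ mu Y = 𝟙 _ := by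
  have := bialg_sound Y .qualitative
  simp only [rw_comp_term, ofT_id] at this
  exact this

theorem zigzag_P : lw P (etaOP Y) ≫ epsOP (P :: Y) = 𝟙 _ := by
  have := rel_sound Y (.duality .zigzag_left)
  have h : rwk (ofT (Term.tensor (S := stratSig) εOP (Term.id [P]))) Y = epsOP (P :: Y) :=
    Quotient.sound (rw_whisker_right (X := [P]) Y εOP)
  simp only [rw_comp_term, h, ofT_id] at this
  erw [rw_whisker_left] at this
  exact this

theorem zigzag_O : etaOP (O :: Y) ≫ lw O (epsOP Y) = 𝟙 _ := by
  have := rel_sound Y (.duality .zigzag_right)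
  have h : rwk (ofT (Term.tensor (S := stratSig) ηOP (Term.id [O]))) Y = etaOP (O :: Y) :=
    Quotient.sound (rw_whisker_right (X := [O]) Y ηOP)
  simp only [rw_comp_term, h, ofT_id] at this
  erw [rw_whisker_left] at this
  exact this

end relations

/-! ### Adding one letter to another: the calculus of `kap` -/

section kappa

variable (Y : List Polarity)

/-- `(y, x) ↦ (x, y + b x)`. -/
def kap (b : Bool) (Y : List Polarity) : Mor (O :: O :: Y) (O :: O :: Y) :=
  match b with
  | false => gam Y
  | true => lw O (del Y) ≫ gam (O :: Y) ≫ lw O (mu Y)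

theorem lw_congr_comp {A B C D : List Polarity} {a : Polarity} {f : Mor A B} {g : Mor B D}
    {f' : Mor A C} {g' : Mor C D} (h : f ≫ g = f' ≫ g') :
    lw a f ≫ lw a g = lw a f' ≫ lw a g' := by
  rw [← lw_comp, h, lw_comp]

theorem kap_lw_eps (b : Bool) : kap b Y ≫ lw O (eps Y) = eps (O :: Y) := by
  cases b
  · exact gam_lw_eps Y
  · have h := lw_congr_comp (a := O) (mu_eps Y)
    simp only [kap, Category.assoc, h]
    rw [reassoc_of% (gam_lw_eps (O :: Y)), ← reassoc_of% (eps_nat (del Y)), del_lw_eps,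
      Category.comp_id]

theorem kap_nat (b : Bool) {Y Z : List Polarity} (f : Mor Y Z) :
    kap b Y ≫ lw O (lw O f) = lw O (lw O f) ≫ kap b Z := by
  cases b
  · exact gam_nat f
  · have h₁ := lw_congr_comp (a := O) (mu_nat f)
    have h₂ := lw_congr_comp (a := O) (del_nat f)
    simp only [kap, Category.assoc, h₁]
    rw [reassoc_of% (gam_nat (lw O f)), reassoc_of% h₂]

/-- Adding a letter to a fresh zero is copying it. This is how copies are expressed in normal forms.
-/
theorem eta_kap_true : eta (O :: Y) ≫ kap true Y = del Y := by
  simp only [kap]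
  rw [reassoc_of% (eta_nat (del Y)), reassoc_of% (eta_gam (O :: Y)), ← lw_comp, eta_mu, lw_id,
    Category.comp_id]

theorem lw_gam_gam (X : List Polarity) : lw O (gam X) ≫ lw O (gam X) = 𝟙 _ := by
  rw [← lw_comp, gam_gam, lw_id]

/-- Two successive additions of `x` to `y₁` and `y₂`. -/
theorem lw_kap_kap_true : lw O (kap true Y) ≫ kap true (O :: Y) =
    lw O (lw O (del Y ≫ del (O :: Y))) ≫ lw O (gam (O :: O :: Y)) ≫ gam (O :: O :: O :: Y) ≫
      lw O (lw O (gam (O :: Y))) ≫ lw O (mu (O :: O :: Y) ≫ lw O (mu Y)) := by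
  have h₁ := lw_congr_comp (a := O) (del_nat (mu Y)).symm
  have h₂ := congrArg (lw O) (gam_del (O :: Y))
  have h₃ := congrArg (lw O) (mu_nat (mu Y)).symm
  simp only [lw_comp] at h₁ h₂ h₃
  simp only [kap, lw_comp, Category.assoc]
  rw [reassoc_of% h₁, ← reassoc_of% (gam_nat (lw O (mu Y))), h₃, reassoc_of% h₂,
    reassoc_of% (gam_nat (gam (O :: Y)))]

/-- On `(y₁, y₂, x)`: adding `a x` to `y₁` and `b x` to `y₂`, then merging, gives `y₁ + y₂ + (a ∨ b)
x`. The disjunction is correct when both are `true` because addition is idempotent. -/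
theorem lw_kap_kap_mu (a b : Bool) :
    lw O (kap b Y) ≫ kap a (O :: Y) ≫ lw O (mu Y) = mu (O :: Y) ≫ kap (a || b) Y := by
  have rhs : mu (O :: Y) ≫ kap true Y = lw O (lw O (del Y)) ≫ lw O (gam (O :: Y)) ≫
      gam (O :: O :: Y) ≫ lw O (mu (O :: Y) ≫ mu Y) := by
    simp only [kap, lw_comp]
    rw [reassoc_of% (mu_nat (del Y)), reassoc_of% (mu_gam (O :: Y))]
  cases a <;> cases b
  · exact (mu_gam Y).symm
  · rw [Bool.or_true, rhs]
    simp only [kap, lw_comp, Category.assoc]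
    rw [← reassoc_of% (gam_nat (mu Y)), ← lw_comp, ← lw_comp, mu_assoc]
  · rw [Bool.or_false, rhs]
    have h₁ := congrArg (lw O) (gam_del Y)
    simp only [lw_comp] at h₁
    simp only [kap, Category.assoc]
    rw [reassoc_of% h₁, ← reassoc_of% (gam_nat (gam Y))]
    simp only [← lw_comp]
    rw [mu_assoc, ← reassoc_of% (lw_comp O (gam Y) (mu Y)), gam_mu]
  · rw [Bool.or_true, rhs, ← Category.assoc, lw_kap_kap_true]
    have h₁ : lw O (gam (O :: Y)) ≫ (mu (O :: O :: Y) ≫ lw O (mu Y)) ≫ mu Y =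
        mu (O :: O :: Y) ≫ mu (O :: Y) ≫ mu Y := by
      rw [Category.assoc, ← mu_assoc, reassoc_of% (mu_assoc (O :: Y)),
        ← reassoc_of% (lw_comp O (gam (O :: Y)) (mu (O :: Y))), gam_mu]
    -- The qualitative law enters here: two copies of `x` that are added again give `x`.
    have h₂ : lw O (lw O (del Y)) ≫ mu (O :: O :: Y) ≫ mu (O :: Y) ≫ mu Y =
        mu (O :: Y) ≫ mu Y := by
      rw [← reassoc_of% (mu_nat (del Y)), mu_assoc, ← reassoc_of% (lw_comp O (del Y) (mu Y)), del_mu,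
        lw_id, Category.id_comp, mu_assoc]
    have h₃ := congrArg (lw O) (gam_nat (del Y))
    have h₄ := gam_nat (lw O (del Y))
    simp only [lw_comp] at h₃
    rw [del_assoc]
    simp only [lw_comp, Category.assoc]
    rw [← reassoc_of% h₃, ← reassoc_of% h₄]
    simp only [← lw_comp, Category.assoc] at h₁ h₂ ⊢
    rw [h₁, h₂]

/-- Copying `y + a x` amounts to copying `y` and adding `a x` to both copies. For `a = true` this is
the bialgebra law `hopf`, together with coassociativity. -/
theorem kap_lw_del (a : Bool) :
    kap a Y ≫ lw O (del Y) = del (O :: Y) ≫ lw O (kap a Y) ≫ kap a (O :: Y) := by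
  cases a
  · exact gam_lw_del Y
  · have h := congrArg (lw O) (hopf Y)
    have h₁ := congrArg (lw O) (gam_nat (del Y))
    simp only [lw_comp] at h h₁
    rw [lw_kap_kap_true]
    simp only [kap, Category.assoc, h]
    rw [reassoc_of% (gam_lw_del (O :: Y)), ← reassoc_of% (del_nat (del Y)),
      reassoc_of% (gam_nat (lw O (del Y))), reassoc_of% h₁, del_assoc]
    simp only [lw_comp, Category.assoc]

/-- Both sides send `(y, z, x)` to `(x, z, y + x)`: `z` is a bystander that slides past the copy,
the exchange and the addition by naturality of `γ` and the Yang–Baxter equation. -/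
theorem lw_gam_kap_lw_gam : lw O (gam Y) ≫ kap true (O :: Y) ≫ lw O (gam Y) =
    gam (O :: Y) ≫ lw O (kap true Y) ≫ gam (O :: Y) := by
  have h₁ := congrArg (lw O) (gam_del Y)
  have h₂ := congrArg (lw O) (mu_gam Y)
  have h₃ := lw_congr_comp (a := O) ((lw_gam_gam Y).trans (Category.comp_id (𝟙 _)).symm)
  simp only [lw_comp, lw_id] at h₁ h₂ h₃
  simp only [kap, Category.assoc, h₂, lw_comp]
  rw [reassoc_of% h₁, ← reassoc_of% (gam_nat (gam Y)), reassoc_of% h₃,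
    ← reassoc_of% (yang_baxter (O :: Y)), reassoc_of% (gam_nat (del Y)), ← gam_nat (mu Y)]

/-- On `(y₁, y₂, x)`: exchanging `y₁` and `y₂` after the additions amounts to exchanging them
before, with the marks `a` and `b` exchanged too. For two marks the point is cocommutativity: the
copies of `x` are interchangeable. -/
theorem lw_kap_kap_gam (a b : Bool) : lw O (kap b Y) ≫ kap a (O :: Y) ≫ lw O (gam Y) =
    gam (O :: Y) ≫ lw O (kap a Y) ≫ kap b (O :: Y) := by
  cases a <;> cases b
  · exact (yang_baxter Y).symm
  · have h := lw_gam_kap_lw_gam Y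
    -- The previous lemma is solved for `kap true`, the exchanges being involutions.
    have : kap true (O :: Y) = lw O (gam Y) ≫ gam (O :: Y) ≫ lw O (kap true Y) ≫
        gam (O :: Y) ≫ lw O (gam Y) := by
      rw [← reassoc_of% h, lw_gam_gam, Category.comp_id, reassoc_of% (lw_gam_gam Y)]
    rw [this]
    simp only [kap]
    rw [reassoc_of% (lw_gam_gam Y), reassoc_of% (gam_gam (O :: Y))]
  · exact lw_gam_kap_lw_gam Y
  · rw [← Category.assoc, lw_kap_kap_true]
    have h₁ : (mu (O :: O :: Y) ≫ lw O (mu Y)) ≫ gam Y = lw O (gam (O :: Y)) ≫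
        gam (O :: O :: Y) ≫ lw O (lw O (gam Y)) ≫ lw O (gam (O :: Y)) ≫
          mu (O :: O :: Y) ≫ lw O (mu Y) := by
      have h := congrArg (lw O) (mu_gam Y)
      simp only [lw_comp] at h
      rw [Category.assoc, lw_mu_gam, reassoc_of% (mu_gam (O :: Y)), reassoc_of% h,
        ← mu_nat (mu Y)]
    have h₂ : del Y ≫ del (O :: Y) ≫ lw O (gam Y) = del Y ≫ del (O :: Y) := by
      rw [reassoc_of% (del_assoc Y), ← lw_comp, del_gam, del_assoc]
    have h₁' := congrArg (lw O) h₁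
    have h₂' := congrArg (fun f => lw O (lw O f)) h₂
    have h₃ := congrArg (lw O) (gam_nat (gam Y))
    have h₄ := lw_congr_comp (a := O) ((lw_gam_gam (O :: Y)).trans (Category.comp_id (𝟙 _)).symm)
    simp only [lw_comp, lw_id, Category.assoc] at h₁' h₂' h₃ h₄
    simp only [lw_comp, Category.assoc, h₁']
    rw [reassoc_of% h₄, ← reassoc_of% (yang_baxter (O :: O :: Y)),
      reassoc_of% (gam_nat (lw O (gam Y))), reassoc_of% h₃,
      reassoc_of% (gam_nat (lw O (gam Y))), reassoc_of% h₂', reassoc_of% (gam_nat (del Y)),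
      reassoc_of% (gam_nat (del (O :: Y)))]

theorem kap_lw_kap_true : kap true (O :: Y) ≫ lw O (kap true Y) =
    lw O (del (O :: Y) ≫ lw O (lw O (del Y))) ≫ gam (O :: O :: O :: Y) ≫
      lw O (lw O (gam (O :: Y))) ≫ lw O (gam (O :: O :: Y)) ≫
        lw O (lw O (mu (O :: Y) ≫ mu Y)) := by
  have h₁ := congrArg (lw O) (mu_nat (del Y))
  have h₂ := congrArg (lw O) (mu_gam (O :: Y))
  simp only [lw_comp] at h₁ h₂
  simp only [kap, lw_comp, Category.assoc]
  rw [reassoc_of% h₁, reassoc_of% h₂, reassoc_of% (gam_nat (lw O (del Y)))]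

/-- On `(y, x₁, x₂)`: the additions of `a x₁` and `b x₂` to `y` may be done in either order, by
commutativity of `μ`. Everything that makes readings commute rests on this. -/
theorem lw_gam_kap_kap (a b : Bool) : lw O (gam Y) ≫ kap b (O :: Y) ≫ lw O (kap a Y) =
    kap a (O :: Y) ≫ lw O (kap b Y) ≫ gam (O :: Y) := by
  cases a <;> cases b
  · exact (yang_baxter Y).symm
  · exact lw_gam_kap_lw_gam Y
  · have h := lw_gam_kap_lw_gam Y
    have : kap true (O :: Y) = lw O (gam Y) ≫ gam (O :: Y) ≫ lw O (kap true Y) ≫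
        gam (O :: Y) ≫ lw O (gam Y) := by
      rw [← reassoc_of% h, lw_gam_gam, Category.comp_id, reassoc_of% (lw_gam_gam Y)]
    rw [this]
    simp only [kap, Category.assoc]
    rw [reassoc_of% (lw_gam_gam Y), gam_gam, Category.comp_id]
  · rw [← Category.assoc (kap true (O :: Y)), kap_lw_kap_true]
    have h₁ : gam Y ≫ del (O :: Y) ≫ lw O (lw O (del Y)) = del (O :: Y) ≫ lw O (lw O (del Y)) ≫
        lw O (gam (O :: Y)) ≫ gam (O :: O :: Y) ≫ lw O (lw O (gam Y)) ≫
          lw O (gam (O :: Y)) := by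
      have h := congrArg (lw O) (gam_lw_del Y)
      simp only [lw_comp] at h
      rw [reassoc_of% (gam_del Y), h, reassoc_of% (gam_lw_del (O :: Y)),
        ← reassoc_of% (del_nat (del Y))]
    have h₂ : lw O (gam Y) ≫ mu (O :: Y) ≫ mu Y = mu (O :: Y) ≫ mu Y := by
      rw [mu_assoc, ← reassoc_of% (lw_comp O (gam Y)), gam_mu]
    have h₁' := congrArg (lw O) h₁
    have h₂' := congrArg (fun f => lw O (lw O f)) h₂
    have h₃ := congrArg (lw O) (gam_nat (gam Y))
    have h₄ := lw_congr_comp (a := O) ((lw_gam_gam (O :: Y)).trans (Category.comp_id (𝟙 _)).symm)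
    simp only [lw_comp, lw_id] at h₁' h₂' h₃ h₄
    simp only [lw_comp, Category.assoc]
    rw [reassoc_of% h₁', reassoc_of% (gam_nat (gam (O :: Y))), reassoc_of% h₄,
      ← reassoc_of% (gam_nat (lw O (gam Y))), ← reassoc_of% h₃, h₂',
      ← gam_nat (mu Y), ← reassoc_of% (gam_nat (mu (O :: Y))),
      ← reassoc_of% (yang_baxter (O :: O :: Y)), ← reassoc_of% (gam_nat (gam (O :: Y)))]

end kappa

/-! ### Memories -/

/-- The word `Oⁿ Y`. -/
@[reducible]
def mem : ℕ → List Polarity → List Polarity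
  | 0, Y => Y
  | n + 1, Y => mem n (O :: Y)

/-- Whiskering by `Oⁿ` on the left. -/
def memMap : ∀ (n : ℕ) {Y Z : List Polarity}, Mor Y Z → Mor (mem n Y) (mem n Z)
  | 0, _, _, f => f
  | n + 1, _, _, f => memMap n (lw O f)

theorem memMap_id (n : ℕ) (Y : List Polarity) :
    memMap n (𝟙 (⟨Y⟩ : Presented stratTheory)) = 𝟙 (⟨mem n Y⟩ : Presented stratTheory) := by
  induction n generalizing Y with
  | zero => rfl
  | succ n ih =>
    change memMap n (lw O _) = _
    rw [lw_id, ih]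

theorem memMap_comp (n : ℕ) {X Y Z : List Polarity} (f : Mor X Y) (g : Mor Y Z) :
    memMap n (f ≫ g) = memMap n f ≫ memMap n g := by
  induction n generalizing X Y Z with
  | zero => rfl
  | succ n ih =>
    change memMap n (lw O _) = _
    rw [lw_comp, ih]
    rfl

/-- The memory grows at the end adjacent to the tail: letter number `n` is the last of `n + 1`. With
this convention, moving a leading O of the tail into the memory changes neither the word nor the
morphism. -/
theorem memMap_succ (n : ℕ) {Y Z : List Polarity} (f : Mor Y Z) :
    memMap (n + 1) f = memMap n (lw O f) := rfl

/-- The map `Oⁿ O Y ⟶ Oⁿ Y` adding the last letter to the letters marked by `S`. -/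
def addTo : ∀ (n : ℕ) (_ : ℕ → Bool) (Y : List Polarity), Mor (mem n (O :: Y)) (mem n Y)
  | 0, _, Y => eps Y
  | n + 1, S, Y => memMap n (kap (S n) Y) ≫ addTo n S (O :: Y)

theorem addTo_succ (n : ℕ) (S : ℕ → Bool) (Y : List Polarity) :
    addTo (n + 1) S Y = memMap n (kap (S n) Y) ≫ addTo n S (O :: Y) := rfl

theorem addTo_congr {n : ℕ} {S T : ℕ → Bool} (h : ∀ i < n, S i = T i) (Y : List Polarity) :
    addTo n S Y = addTo n T Y := by
  induction n generalizing Y with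
  | zero => rfl
  | succ n ih =>
    rw [addTo_succ, addTo_succ, h n (by omega), ih fun i hi => h i (by omega)]

theorem addTo_nat (n : ℕ) (S : ℕ → Bool) {Y Z : List Polarity} (f : Mor Y Z) :
    addTo n S Y ≫ memMap n f = memMap n (lw O f) ≫ addTo n S Z := by
  induction n generalizing Y Z with
  | zero => exact eps_nat f
  | succ n ih =>
    rw [memMap_succ, memMap_succ, addTo_succ, addTo_succ, Category.assoc, ih,
      ← Category.assoc, ← memMap_comp, kap_nat, memMap_comp, Category.assoc]

/-- The map `O Oⁿ Y ⟶ Oⁿ O Y` moving the first letter to the end of the memory. -/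
def rot : ∀ (n : ℕ) (Y : List Polarity), Mor (O :: mem n Y) (mem n (O :: Y))
  | 0, _ => 𝟙 _
  | n + 1, Y => rot n (O :: Y) ≫ memMap n (gam Y)

def rotInv : ∀ (n : ℕ) (Y : List Polarity), Mor (mem n (O :: Y)) (O :: mem n Y)
  | 0, _ => 𝟙 _
  | n + 1, Y => memMap n (gam Y) ≫ rotInv n (O :: Y)

theorem rot_succ (n : ℕ) (Y : List Polarity) :
    rot (n + 1) Y = rot n (O :: Y) ≫ memMap n (gam Y) := rfl

theorem rotInv_succ (n : ℕ) (Y : List Polarity) :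
    rotInv (n + 1) Y = memMap n (gam Y) ≫ rotInv n (O :: Y) := rfl

theorem memMap_gam_gam (n : ℕ) (Y : List Polarity) :
    memMap n (gam Y) ≫ memMap n (gam Y) = 𝟙 _ := by
  rw [← memMap_comp, gam_gam, memMap_id]

theorem rot_rotInv (n : ℕ) (Y : List Polarity) : rot n Y ≫ rotInv n Y = 𝟙 _ := by
  induction n generalizing Y with
  | zero => exact Category.id_comp _
  | succ n ih =>
    rw [rot_succ, rotInv_succ, Category.assoc, reassoc_of% (memMap_gam_gam n Y), ih]

theorem rotInv_rot (n : ℕ) (Y : List Polarity) : rotInv n Y ≫ rot n Y = 𝟙 _ := by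
  induction n generalizing Y with
  | zero => exact Category.id_comp _
  | succ n ih =>
    rw [rot_succ, rotInv_succ, Category.assoc, reassoc_of% (ih (O :: Y)), memMap_gam_gam]

theorem rot_nat (n : ℕ) {Y Z : List Polarity} (f : Mor Y Z) :
    rot n Y ≫ memMap n (lw O f) = lw O (memMap n f) ≫ rot n Z := by
  induction n generalizing Y Z with
  | zero => exact (Category.id_comp _).trans (Category.comp_id _).symm
  | succ n ih =>
    rw [memMap_succ, memMap_succ, rot_succ, rot_succ, Category.assoc, ← memMap_comp, gam_nat,
      memMap_comp, reassoc_of% (ih (lw O f))]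

/-- Insertion of units as new memory letters. -/
def etas : ∀ (n : ℕ) (Y : List Polarity), Mor Y (mem n Y)
  | 0, _ => 𝟙 _
  | n + 1, Y => eta Y ≫ etas n (O :: Y)

theorem etas_succ (n : ℕ) (Y : List Polarity) :
    etas (n + 1) Y = eta Y ≫ etas n (O :: Y) := rfl

theorem etas_nat (n : ℕ) {Y Z : List Polarity} (f : Mor Y Z) :
    etas n Y ≫ memMap n f = f ≫ etas n Z := by
  induction n generalizing Y Z with
  | zero => exact (Category.id_comp _).trans (Category.comp_id _).symm
  | succ n ih =>
    rw [etas_succ, etas_succ, memMap_succ, Category.assoc, ih, reassoc_of% (eta_nat f)]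

/-- Families of morphisms `Oᵐ Y ⟶ Oⁿ Y` acting linearly on the memory. -/
structure IsMemMap (m n : ℕ) (h : ∀ Y, Mor (mem m Y) (mem n Y)) : Prop where
  nat : ∀ {Y Z : List Polarity} (f : Mor Y Z), h Y ≫ memMap n f = memMap m f ≫ h Z
  etas : ∀ Y, etas m Y ≫ h Y = etas n Y
  rot : ∀ Y, rot m Y ≫ h (O :: Y) = lw O (h Y) ≫ rot n Y
  add : ∀ S, ∃ T, ∀ Y, addTo m S Y ≫ h Y = h (O :: Y) ≫ addTo n T Y

namespace IsMemMap

variable {l m n : ℕ}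

theorem rotInv {h : ∀ Y, Mor (mem m Y) (mem n Y)} (hh : IsMemMap m n h) (Y : List Polarity) :
    rotInv m Y ≫ lw O (h Y) = h (O :: Y) ≫ rotInv n Y := by
  have := hh.rot Y
  calc _ = Causality.rotInv m Y ≫ (lw O (h Y) ≫ Causality.rot n Y) ≫ Causality.rotInv n Y := by
        rw [Category.assoc, rot_rotInv, Category.comp_id]
    _ = _ := by rw [← this, Category.assoc, reassoc_of% (rotInv_rot m Y)]

theorem comp {h : ∀ Y, Mor (mem l Y) (mem m Y)} {k : ∀ Y, Mor (mem m Y) (mem n Y)}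
    (hh : IsMemMap l m h) (hk : IsMemMap m n k) : IsMemMap l n fun Y => h Y ≫ k Y where
  nat f := by rw [Category.assoc, hk.nat, reassoc_of% (hh.nat f)]
  etas Y := by rw [reassoc_of% (hh.etas Y), hk.etas]
  rot Y := by rw [reassoc_of% (hh.rot Y), hk.rot, lw_comp, Category.assoc]
  add S := by
    obtain ⟨T, hT⟩ := hh.add S
    obtain ⟨U, hU⟩ := hk.add T
    exact ⟨U, fun Y => by rw [reassoc_of% (hT Y), hU, Category.assoc]⟩

theorem cons {h : ∀ Y, Mor (mem m Y) (mem n Y)} (hh : IsMemMap m n h) :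
    IsMemMap (m + 1) (n + 1) fun Y => h (O :: Y) where
  nat f := hh.nat (lw O f)
  etas Y := by rw [etas_succ, etas_succ, Category.assoc, hh.etas]
  rot Y := by
    rw [rot_succ, rot_succ, Category.assoc, ← hh.nat (gam Y), reassoc_of% (hh.rot (O :: Y))]
  add S := by
    obtain ⟨T, hT⟩ := hh.add S
    -- The added letter keeps its mark; its number is `m` before `h` and `n` after it.
    refine ⟨fun i => if i = n then S m else T i, fun Y => ?_⟩
    rw [addTo_succ, addTo_succ, Category.assoc, hT, ← reassoc_of% (hh.nat (kap (S m) Y)),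
      if_pos rfl]
    congr 2
    exact addTo_congr (fun i hi => by rw [if_neg (by omega)]) _

theorem mu (n : ℕ) : IsMemMap (n + 2) (n + 1) fun Y => memMap n (mu Y) where
  nat f := by
    change memMap n _ ≫ memMap n (lw O f) = memMap n (lw O (lw O f)) ≫ memMap n _
    rw [← memMap_comp, mu_nat, memMap_comp]
  etas Y := by
    rw [etas_succ, etas_succ, etas_succ, Category.assoc, Category.assoc, etas_nat,
      reassoc_of% (eta_mu Y)]
  rot Y := by
    rw [rot_succ, rot_succ, rot_succ, Category.assoc, Category.assoc, memMap_succ, ← memMap_comp,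
      ← memMap_comp, ← reassoc_of% (rot_nat n (Causality.mu Y)), ← memMap_comp, lw_mu_gam]
  add S := by
    -- A merged letter is marked when one of its two parts is.
    refine ⟨fun i => if i = n then S n || S (n + 1) else S i, fun Y => ?_⟩
    rw [addTo_succ, addTo_succ, addTo_succ, if_pos rfl, memMap_succ, Category.assoc,
      Category.assoc, addTo_nat]
    simp only [← Category.assoc, ← memMap_comp]
    rw [Category.assoc, lw_kap_kap_mu]
    congr 1
    exact addTo_congr (fun i hi => by rw [if_neg (by omega)]) _

theorem eta (n : ℕ) : IsMemMap n (n + 1) fun Y => memMap n (eta Y) where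
  nat f := by
    change memMap n _ ≫ memMap n (lw O f) = memMap n f ≫ memMap n _
    rw [← memMap_comp, eta_nat, memMap_comp]
  etas Y := by rw [etas_nat]; rfl
  rot Y := by
    rw [rot_succ, ← reassoc_of% (rot_nat n (Causality.eta Y)), ← memMap_comp, lw_eta_gam]
  add S := by
    -- The letter created by the unit has to stay zero, hence unmarked.
    refine ⟨fun i => if i = n then false else S i, fun Y => ?_⟩
    rw [addTo_succ, if_pos rfl, addTo_nat, ← Category.assoc, ← memMap_comp]
    change _ = memMap n (Causality.eta (O :: Y) ≫ gam Y) ≫ _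
    rw [eta_gam]
    congr 1
    exact addTo_congr (fun i hi => by rw [if_neg (by omega)]) _

theorem del (n : ℕ) : IsMemMap (n + 1) (n + 2) fun Y => memMap n (del Y) where
  nat f := by
    change memMap n _ ≫ memMap n (lw O (lw O f)) = memMap n (lw O f) ≫ memMap n _
    rw [← memMap_comp, del_nat, memMap_comp]
  etas Y := by
    rw [etas_succ, etas_succ, etas_succ, Category.assoc, etas_nat, reassoc_of% (eta_del Y)]
  rot Y := by
    rw [rot_succ, rot_succ, rot_succ, Category.assoc, Category.assoc, memMap_succ, ← memMap_comp,
      ← memMap_comp, ← reassoc_of% (rot_nat n (Causality.del Y)), ← memMap_comp, gam_del]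
  add S := by
    -- Both copies, numbered `n` and `n + 1`, inherit the mark of the original.
    refine ⟨fun i => if i = n + 1 then S n else S i, fun Y => ?_⟩
    rw [addTo_succ, addTo_succ, addTo_succ, if_pos rfl, if_neg (by omega), memMap_succ,
      Category.assoc, addTo_nat]
    simp only [← Category.assoc, ← memMap_comp]
    rw [Category.assoc, kap_lw_del]
    congr 1
    exact addTo_congr (fun i hi => by rw [if_neg (by omega)]) _

theorem eps (n : ℕ) : IsMemMap (n + 1) n fun Y => memMap n (eps Y) where
  nat f := by
    change memMap n _ ≫ memMap n f = memMap n (lw O f) ≫ memMap n _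
    rw [← memMap_comp, eps_nat, memMap_comp]
  etas Y := by
    rw [etas_succ, Category.assoc, etas_nat, reassoc_of% (eta_eps Y)]
  rot Y := by
    rw [rot_succ, Category.assoc, ← memMap_comp, gam_eps, rot_nat]
  add S := by
    refine ⟨S, fun Y => ?_⟩
    rw [addTo_succ, Category.assoc, addTo_nat, ← Category.assoc, ← memMap_comp, kap_lw_eps]

theorem gam (n : ℕ) : IsMemMap (n + 2) (n + 2) fun Y => memMap n (gam Y) where
  nat f := by
    change memMap n _ ≫ memMap n (lw O (lw O f)) = memMap n (lw O (lw O f)) ≫ memMap n _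
    rw [← memMap_comp, gam_nat, memMap_comp]
  etas Y := by
    rw [etas_succ, etas_succ, Category.assoc, Category.assoc, etas_nat,
      reassoc_of% (eta_gam Y), reassoc_of% (eta_nat (Causality.eta Y))]
  rot Y := by
    rw [rot_succ, rot_succ, Category.assoc, Category.assoc, memMap_succ, ← memMap_comp,
      ← memMap_comp, Category.assoc, ← reassoc_of% (rot_nat n (Causality.gam Y)), ← memMap_comp,
      ← memMap_comp, yang_baxter]
  add S := by
    refine ⟨fun i => if i = n + 1 then S n else if i = n then S (n + 1) else S i, fun Y => ?_⟩
    rw [addTo_succ, addTo_succ, addTo_succ, addTo_succ, if_pos rfl, if_neg (by omega), if_pos rfl,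
      memMap_succ, memMap_succ, Category.assoc, Category.assoc, addTo_nat]
    simp only [← Category.assoc, ← memMap_comp]
    rw [Category.assoc, lw_kap_kap_gam, Category.assoc]
    congr 1
    exact addTo_congr (fun i hi => by rw [if_neg (by omega), if_neg (by omega)]) _

theorem kap (n : ℕ) (b : Bool) : IsMemMap (n + 2) (n + 2) fun Y => memMap n (kap b Y) := by
  cases b
  · exact gam n
  · have := ((del (n + 1)).comp (gam n).cons).comp (mu (n + 1))
    convert this using 2 with Y
    change memMap n _ = (memMap n _ ≫ memMap n _) ≫ memMap n _
    rw [← memMap_comp, ← memMap_comp, Category.assoc]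
    rfl

/-- Adding a letter to the memory becomes itself a memory map once that letter belongs to the
memory. This treats the counit of the duality (`Post.epsOP`) and the commutation of readings. -/
theorem addTo (n : ℕ) (S : ℕ → Bool) : IsMemMap (n + 1) n fun Y => addTo n S Y := by
  induction n with
  | zero => exact eps 0
  | succ n ih => exact (kap n (S n)).comp ih.cons

end IsMemMap

/-- Without marks, the letter only crosses the memory by exchanges before being discarded, and `ε`
absorbs exchanges. -/
theorem addTo_false (n : ℕ) (Y : List Polarity) : addTo n (fun _ => false) Y = memMap n (eps Y) := by
  induction n generalizing Y with
  | zero => rfl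
  | succ n ih =>
    rw [addTo_succ, ih, ← memMap_comp]
    change memMap n (gam Y ≫ _) = _
    rw [gam_eps]
    rfl

/-- Additions to the memory commute. -/
theorem addTo_addTo (n : ℕ) (S T : ℕ → Bool) (Y : List Polarity) :
    memMap n (gam Y) ≫ addTo n T (O :: Y) ≫ addTo n S Y = addTo n S (O :: Y) ≫ addTo n T Y := by
  induction n generalizing Y with
  | zero =>
    change gam Y ≫ eps (O :: Y) ≫ eps Y = eps (O :: Y) ≫ eps Y
    rw [reassoc_of% (gam_eps Y), ← eps_nat]
  | succ n ih =>
    rw [addTo_succ, addTo_succ, addTo_succ, addTo_succ, Category.assoc, Category.assoc,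
      reassoc_of% (addTo_nat n T (kap (S n) Y)), reassoc_of% (addTo_nat n S (kap (T n) Y)),
      ← ih (O :: Y), memMap_succ]
    simp only [← Category.assoc, ← memMap_comp]
    rw [Category.assoc (lw O (gam Y)), lw_gam_kap_kap]
    simp only [Category.assoc]

/-! ### Normal forms -/

/-- Normal forms: morphisms `A ⟶ Oⁿ B` which process the letters of `A` and `B` from left to
right, recording the incoming information in the memory `Oⁿ`. -/
inductive NF : ∀ (n : ℕ) (A B : List Polarity), Mor A (mem n B) → Prop
  | nil (n : ℕ) : NF n [] [] (etas n [])
  | absorbO {n : ℕ} {A B : List Polarity} {f : Mor A (mem (n + 1) B)} :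
      NF (n + 1) A B f → NF n A (O :: B) f
  | absorbP {n : ℕ} {A B : List Polarity} {f : Mor A (mem (n + 1) B)} :
      NF (n + 1) A B f → NF n (P :: A) B (lw P (f ≫ rotInv n B) ≫ epsOP (mem n B))
  | readO {n : ℕ} {A B : List Polarity} {f : Mor A (mem n B)} (S : ℕ → Bool) :
      NF n A B f → NF n (O :: A) B (lw O f ≫ rot n B ≫ addTo n S B)
  | readP {n : ℕ} {A B : List Polarity} {f : Mor A (mem n B)} (S : ℕ → Bool) :
      NF n A B f → NF n A (P :: B) (f ≫ memMap n (etaOP B) ≫ addTo n S (P :: B))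

theorem NF.of_eq {n : ℕ} {A B : List Polarity} {f g : Mor A (mem n B)} (hf : NF n A B f)
    (h : f = g) : NF n A B g := h ▸ hf

/-- The fields of `IsMemMap` are what pushes `h` through the constructors: `etas` for `nil`, `rot`
for `absorbP`, `rot` and `add` for `readO`, `nat` and `add` for `readP`; `absorbO` needs stability
under `cons`. -/
theorem NF.comp_memMap {m n : ℕ} {A B : List Polarity} {f : Mor A (mem m B)} (hf : NF m A B f)
    {h : ∀ Y, Mor (mem m Y) (mem n Y)} (hh : IsMemMap m n h) : NF n A B (f ≫ h B) := by
  induction hf generalizing n with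
  | nil m => exact (NF.nil n).of_eq (hh.etas []).symm
  | absorbO _ ih => exact .absorbO (ih hh.cons)
  | @absorbP m A B f _ ih =>
    refine (NF.absorbP (ih hh.cons)).of_eq ?_
    rw [Category.assoc, Category.assoc, epsOP_nat, ← hh.rotInv, ← Category.assoc f, lw_comp,
      Category.assoc]
  | @readO m A B f S _ ih =>
    obtain ⟨T, hT⟩ := hh.add S
    refine (NF.readO T (ih hh)).of_eq ?_
    rw [Category.assoc, Category.assoc, hT, reassoc_of% (hh.rot B), lw_comp, Category.assoc]
  | @readP m A B f S _ ih =>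
    obtain ⟨T, hT⟩ := hh.add S
    refine (NF.readP T (ih hh)).of_eq ?_
    rw [Category.assoc, Category.assoc, Category.assoc, hT, ← reassoc_of% (hh.nat (etaOP B))]

/-- Inversion of `absorbO`. A normal form with target `O :: B` may also end with `absorbP` or
`readO`; these act on the source and can be performed after the absorption. -/
theorem NF.of_absorbO {n : ℕ} {A B : List Polarity} {f : Mor A (mem (n + 1) B)}
    (hf : NF n A (O :: B) f) : NF (n + 1) A B f := by
  let motive (n : ℕ) (A : List Polarity) : ∀ C, Mor A (mem n C) → Prop
    | O :: B, f => NF (n + 1) A B f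
    | _, _ => True
  suffices ∀ {n A C} {f : Mor A (mem n C)}, NF n A C f → motive n A C f from this hf
  intro n A C f hf
  induction hf with
  | nil => trivial
  | absorbO hf _ => exact hf
  | @absorbP n A C f _ ih =>
    rcases C with _ | ⟨⟨⟩, B⟩ <;> try trivial
    -- The letter coming from the source has number `n` and the O of the target number `n + 1`;
    -- `absorbP` transposes the last letter, so the two are exchanged.
    refine (NF.absorbP (NF.comp_memMap (A := A) (B := B) ih (IsMemMap.gam n))).of_eq ?_
    rw [rotInv_succ, Category.assoc, reassoc_of% (memMap_gam_gam n B)]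
  | @readO n A C f S _ ih =>
    rcases C with _ | ⟨⟨⟩, B⟩ <;> try trivial
    -- The O of the target now has number `n` in the memory, and the letter read was not added to
    -- it.
    refine (NF.readO (A := A) (B := B) (fun i => if i = n then false else S i) ih).of_eq ?_
    rw [rot_succ, addTo_succ, if_pos rfl]
    change _ ≫ (rot n (O :: B) ≫ memMap n (gam B)) ≫ memMap n (gam B) ≫ _ = _
    rw [Category.assoc, reassoc_of% (memMap_gam_gam n B)]
    congr 2
    exact addTo_congr (fun i hi => by rw [if_neg (by omega)]) _
  | readP => trivial

theorem rotInv_nat (n : ℕ) {Y Z : List Polarity} (f : Mor Y Z) :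
    rotInv n Y ≫ lw O (memMap n f) = memMap n (lw O f) ≫ rotInv n Z := by
  calc _ = rotInv n Y ≫ (lw O (memMap n f) ≫ rot n Z) ≫ rotInv n Z := by
        rw [Category.assoc, rot_rotInv, Category.comp_id]
    _ = _ := by rw [← rot_nat, Category.assoc, reassoc_of% (rotInv_rot n Y)]

/-! ### Stability of normal forms under composition -/

/-- Morphisms by which normal forms can be composed. -/
def Post {A B : List Polarity} (k : Mor A B) : Prop :=
  ∀ (n : ℕ) (C : List Polarity) (f : Mor C (mem n A)), NF n C A f → NF n C B (f ≫ memMap n k)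

namespace Post

theorem id (A : List Polarity) : Post (𝟙 (⟨A⟩ : Presented stratTheory)) := by
  intro n C f hf
  rwa [memMap_id, Category.comp_id]

theorem comp {A B C : List Polarity} {k : Mor A B} {l : Mor B C} (hk : Post k) (hl : Post l) :
    Post (k ≫ l) := by
  intro n D f hf
  rw [memMap_comp, ← Category.assoc]
  exact hl _ _ _ (hk _ _ _ hf)

theorem cast {A B A' B' : List Polarity} (hA : A = A') (hB : B = B') {t : Term stratSig A B} :
    Post (ofT (Term.cast hA hB t)) ↔ Post (ofT t) := by
  subst hA hB
  rfl

/-- It is enough to compose normal forms in which the first letter has just been produced. -/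
theorem of_readP {A B : List Polarity} {k : Mor (P :: A) B}
    (h : ∀ (n : ℕ) (C : List Polarity) (f : Mor C (mem n A)) (S : ℕ → Bool), NF n C A f →
      NF n C B (f ≫ memMap n (etaOP A) ≫ addTo n S (P :: A) ≫ memMap n k)) : Post k := by
  -- For a target beginning with P the last constructor is `absorbP`, `readO` or `readP`. The first
  -- two act on the source and commute with `k`, so the induction descends to `readP`.
  let motive (n : ℕ) (C : List Polarity) : ∀ D, Mor C (mem n D) → Prop
    | P :: A, f => ∀ {B : List Polarity} {k : Mor (P :: A) B},
      (∀ (n : ℕ) (C : List Polarity) (f : Mor C (mem n A)) (S : ℕ → Bool), NF n C A f →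
        NF n C B (f ≫ memMap n (etaOP A) ≫ addTo n S (P :: A) ≫ memMap n k)) →
      NF n C B (f ≫ memMap n k)
    | _, _ => True
  suffices ∀ {n C D} {f : Mor C (mem n D)}, NF n C D f → motive n C D f from
    fun n C f hf => this hf h
  clear h k A B
  intro n C D f hf
  induction hf with
  | nil => trivial
  | absorbO => trivial
  | @absorbP n C D f _ ih =>
    rcases D with _ | ⟨⟨⟩, A⟩ <;> try trivial
    intro B k h
    refine (NF.absorbP (ih h)).of_eq ?_
    have := rotInv_nat n k
    rw [Category.assoc, Category.assoc, epsOP_nat, memMap_succ, ← this, ← Category.assoc f,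
      lw_comp, Category.assoc]
  | @readO n C D f S _ ih =>
    rcases D with _ | ⟨⟨⟩, A⟩ <;> try trivial
    intro B k h
    refine (NF.readO S (ih h)).of_eq ?_
    rw [Category.assoc, Category.assoc, addTo_nat, reassoc_of% (rot_nat n k), lw_comp,
      Category.assoc]
  | @readP n C D f S hf _ =>
    intro B k h
    exact (h n C f S hf).of_eq (by simp only [Category.assoc])

/-- A leading O is absorbed into the memory and `k` is applied behind a longer memory. A leading P
may be assumed just produced by `etaOP`, past which `k` slides by naturality. -/
theorem lw (a : Polarity) {A B : List Polarity} {k : Mor A B} (hk : Post k) :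
    Post (Causality.lw a k) := by
  cases a
  · exact fun n C f hf => .absorbO (hk (n + 1) C f hf.of_absorbO)
  · refine of_readP fun n C f S hf => ?_
    refine (NF.readP S (hk n C f hf)).of_eq ?_
    rw [addTo_nat, ← reassoc_of% (memMap_comp n (etaOP A)), etaOP_nat, memMap_comp]
    simp only [Category.assoc]

theorem tens_id {A B : List Polarity} (X : List Polarity) {k : Mor A B} (hk : Post k) :
    Post (tensMor (𝟙 (⟨X⟩ : Presented stratTheory)) k) := by
  induction X with
  | nil => rwa [nil_tens]
  | cons a X ih =>
    rw [cons_tens]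
    exact ih.lw a

theorem mu (Y : List Polarity) : Post (Causality.mu Y) := fun n _ _ hf =>
  .absorbO (hf.of_absorbO.of_absorbO.comp_memMap (IsMemMap.mu n))

theorem eta (Y : List Polarity) : Post (Causality.eta Y) := fun n _ _ hf =>
  .absorbO (hf.comp_memMap (IsMemMap.eta n))

theorem del (Y : List Polarity) : Post (Causality.del Y) := fun n _ _ hf =>
  .absorbO (.absorbO (hf.of_absorbO.comp_memMap (IsMemMap.del n)))

theorem eps (Y : List Polarity) : Post (Causality.eps Y) := fun n _ _ hf =>
  hf.of_absorbO.comp_memMap (IsMemMap.eps n)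

theorem gam (Y : List Polarity) : Post (Causality.gam Y) := fun n _ _ hf =>
  .absorbO (.absorbO (hf.of_absorbO.of_absorbO.comp_memMap (IsMemMap.gam n)))

theorem etaOP (Y : List Polarity) : Post (Causality.etaOP Y) := fun n C f hf => by
  -- The O of the new pair is a zero memory letter, numbered `n`, to which the cause of the P is
  -- added. It is the only marked letter, and adding to zero copies.
  refine .absorbO ((NF.readP (fun i => if i = n then true else false)
    (hf.comp_memMap (IsMemMap.eta n))).of_eq ?_)
  rw [addTo_succ, if_pos rfl, memMap_succ, addTo_congr (T := fun _ => false)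
    (fun i hi => by rw [if_neg (by omega)]), addTo_false]
  simp only [Category.assoc, ← memMap_comp]
  rw [reassoc_of% (eta_nat (Causality.etaOP Y)), reassoc_of% (eta_kap_true (P :: Y)), del_eps,
    Category.comp_id]

/-- If the P was just created by `etaOP`, the zigzag identity straightens the wire: what remains is
the addition of the absorbed O to the letters on which the P depended, a memory map. -/
theorem epsOP (Y : List Polarity) : Post (Causality.epsOP Y) := by
  refine of_readP fun n C f S hf => (hf.of_absorbO.comp_memMap (IsMemMap.addTo n S)).of_eq ?_
  rw [addTo_nat, ← reassoc_of% (memMap_comp n (Causality.etaOP (O :: Y))), zigzag_O, memMap_id,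
    Category.id_comp]

/-- Terms which can be composed with normal forms after whiskering on the right. -/
def Good {A B : List Polarity} (t : Term stratSig A B) : Prop :=
  ∀ Y, Post (rwk (ofT t) Y)

theorem Good.id (A : List Polarity) : Good (Term.id (S := stratSig) A) := fun Y => by
  rw [ofT_id]
  exact Post.id _

theorem Good.comp {A B C : List Polarity} {t : Term stratSig A B} {u : Term stratSig B C}
    (ht : Good t) (hu : Good u) : Good (Term.comp t u) := fun Y => by
  rw [rw_comp_term]
  exact (ht Y).comp (hu Y)

theorem Good.tensor {A B C D : List Polarity} {t : Term stratSig A B} {u : Term stratSig C D}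
    (ht : Good t) (hu : Good u) : Good (Term.tensor t u) := fun Y => by
  have h₁ : (ofT (Term.cast (List.append_assoc A C Y) (List.append_assoc B D Y)
      (Term.tensor (Term.tensor t u) (Term.id (S := stratSig) Y)))) =
      rwk (ofT t) (C ++ Y) ≫ tensMor (𝟙 (⟨B⟩ : Presented stratTheory)) (rwk (ofT u) Y) := by
    rw [← tens_eq]
    exact Quotient.sound (Theory.Eqv.tensor_assoc (T := stratTheory) t u _)
  change Post (ofT (Term.tensor (Term.tensor t u) (Term.id (S := stratSig) Y)))
  rw [← cast (List.append_assoc A C Y) (List.append_assoc B D Y), h₁]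
  exact (ht _).comp ((hu _).tens_id B)

theorem Good.of_rel {A B : List Polarity} {t u : Term stratSig A B} (h : StratRel t u)
    (hu : Good u) : Good t := fun Y => by
  rw [rel_sound Y h]
  exact hu Y

/-- The Proponent generators and the mixed crossing equal terms in the Opponent structure and the
duality, so seven generators remain to be treated directly. -/
theorem good {A B : List stratSig.Atom} (t : Term stratSig A B) : Good t := by
  have hμ : Good μO := mu
  have hη : Good ηO := eta
  have hδ : Good δO := del
  have hε : Good εO := eps
  have hγ : Good γO := gam
  have h₁ : Good ηOP := etaOP
  have h₂ : Good εOP := epsOP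
  have h₃ : Good ηOOPP := h₁.comp ((Good.id _).tensor (h₁.tensor (.id _)))
  have h₄ : Good εPPOO := ((Good.id _).tensor (h₂.tensor (.id _))).comp h₂
  induction t with
  | id A => exact .id A
  | comp t u iht ihu => exact iht.comp ihu
  | tensor t u iht ihu => exact iht.tensor ihu
  | gen g =>
    cases g
    · exact hμ
    · exact hη
    · exact hδ
    · exact hε
    · exact hγ
    · exact .of_rel .mul_P (((Good.id _).tensor h₁).comp
        (((Good.id _).tensor (hδ.tensor (.id _))).comp (h₄.tensor (.id _))))
    · exact .of_rel .unit_P (h₁.comp (hε.tensor (.id _)))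
    · exact .of_rel .comul_P (((Good.id _).tensor h₃).comp
        (((Good.id _).tensor (hμ.tensor (.id _))).comp (h₂.tensor (.id _))))
    · exact .of_rel .counit_P (((Good.id _).tensor hη).comp h₂)
    · exact .of_rel .sym_P (((Good.id _).tensor h₃).comp
        (((Good.id _).tensor (hγ.tensor (.id _))).comp (h₄.tensor (.id _))))
    · exact h₁
    · exact h₂
    · exact .of_rel .sym_OP (((Good.id _).tensor h₁).comp
        (((Good.id _).tensor (hγ.tensor (.id _))).comp (h₂.tensor (.id _))))

theorem all {A B : List Polarity} (k : Mor A B) : Post k := by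
  induction k using Quotient.inductionOn with | _ t
  have h' : ofT (Term.cast (List.append_nil A) (List.append_nil B)
      (Term.tensor t (Term.id (S := stratSig) []))) = ofT t :=
    Quotient.sound (Theory.Eqv.tensor_unit (T := stratTheory) t)
  change Post (ofT t)
  rw [← h', cast]
  exact good t []

end Post

/-- For a letter O, the output is absorbed as a zero memory letter and the input is then added to
it. For a letter P, the input is absorbed and the output produced from it, which is a zigzag. -/
theorem NF.id (A : List Polarity) : NF 0 A A (𝟙 _) := by
  induction A with
  | nil => exact .nil 0
  | cons a A ih =>
    cases a
    · refine .absorbO ((NF.readO (fun _ => true)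
        (Post.eta A 0 A _ ih).of_absorbO).of_eq ?_)
      change Causality.lw O (𝟙 _ ≫ Causality.eta A) ≫ (𝟙 _ ≫ Causality.gam A) ≫
        kap true A ≫ Causality.eps (O :: A) = _
      rw [Category.id_comp, Category.id_comp, reassoc_of% (lw_eta_gam A),
        reassoc_of% (eta_kap_true A), del_eps]
    · refine (NF.absorbP (Post.etaOP A 0 A _ ih).of_absorbO).of_eq ?_
      change Causality.lw P ((𝟙 _ ≫ Causality.etaOP A) ≫ 𝟙 _) ≫ Causality.epsOP (P :: A) = _
      rw [Category.id_comp, Category.comp_id, zigzag_P]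

/-- Every morphism is a normal form. -/
theorem NF.all {A B : List Polarity} {n : ℕ} (f : Mor A (mem n B)) : NF n A B f := by
  have h : NF 0 A (mem n B) f := by
    have := Post.all f 0 A _ (NF.id A)
    exact this.of_eq (Category.id_comp f)
  induction n generalizing B with
  | zero => exact h
  | succ n ih => exact (ih (B := O :: B) f h).of_absorbO

/-! ### Separation of normal forms -/

section

variable (Y : List Polarity)

/-- Adding zero changes nothing, marked or not. Hence a reading step fed with zero leaves no trace.
-/
theorem lw_eta_kap (b : Bool) : lw O (eta Y) ≫ kap b Y = eta (O :: Y) := by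
  cases b
  · exact lw_eta_gam Y
  · have h := congrArg (lw O) (eta_del Y)
    simp only [lw_comp] at h
    simp only [kap]
    rw [reassoc_of% h, reassoc_of% (lw_eta_gam (O :: Y)), eta_nat, reassoc_of% (lw_eta_mu Y)]

theorem eta_addTo (n : ℕ) (S : ℕ → Bool) : memMap n (eta Y) ≫ addTo n S Y = 𝟙 _ := by
  induction n generalizing Y with
  | zero => exact eta_eps Y
  | succ n ih =>
    rw [addTo_succ, memMap_succ, ← Category.assoc, ← memMap_comp, lw_eta_kap, ih]

theorem eta_rot (n : ℕ) : eta (mem n Y) ≫ rot n Y = memMap n (eta Y) := by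
  induction n generalizing Y with
  | zero => exact Category.comp_id _
  | succ n ih => rw [rot_succ, reassoc_of% (ih (O :: Y)), ← memMap_comp, eta_gam, memMap_succ]

theorem etas_rot (n : ℕ) : lw O (etas n Y) ≫ rot n Y = etas n (O :: Y) := by
  induction n generalizing Y with
  | zero => exact (Category.comp_id _).trans (lw_id O Y)
  | succ n ih =>
    rw [rot_succ, etas_succ, etas_succ, lw_comp, Category.assoc, reassoc_of% (ih (O :: Y)),
      etas_nat, reassoc_of% (lw_eta_gam Y)]

/-- The counit on the type `P`. -/
def epsP : Mor (P :: Y) Y := lw P (eta Y) ≫ epsOP Y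

/-- The unit on the type `P`. -/
def etaP : Mor Y (P :: Y) := etaOP Y ≫ eps (P :: Y)

/-- Discarding the P of a pair turns its cause into zero; by `eta_addTo` the addition to the memory
then disappears. -/
theorem etaOP_epsP : etaOP Y ≫ lw O (epsP Y) = eta Y := by
  rw [epsP, lw_comp, reassoc_of% (etaOP_nat (eta Y)), zigzag_O, Category.comp_id]

/-- Removal of the memory. -/
def killMem : ∀ (n : ℕ) (Y : List Polarity), Mor (mem n Y) Y
  | 0, _ => 𝟙 _
  | n + 1, Y => killMem n (O :: Y) ≫ eps Y

theorem killMem_succ (n : ℕ) : killMem (n + 1) Y = killMem n (O :: Y) ≫ eps Y := rfl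

theorem killMem_nat (n : ℕ) {Y Z : List Polarity} (f : Mor Y Z) :
    killMem n Y ≫ f = memMap n f ≫ killMem n Z := by
  induction n generalizing Y Z with
  | zero => exact (Category.id_comp _).trans (Category.comp_id _).symm
  | succ n ih =>
    rw [killMem_succ, killMem_succ, memMap_succ, Category.assoc, eps_nat,
      reassoc_of% (ih (lw O f))]

theorem etas_killMem (n : ℕ) : etas n Y ≫ killMem n Y = 𝟙 _ := by
  induction n generalizing Y with
  | zero => exact Category.comp_id _
  | succ n ih =>
    rw [etas_succ, killMem_succ, Category.assoc, reassoc_of% (ih (O :: Y)), eta_eps]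

theorem addTo_killMem (n : ℕ) (S : ℕ → Bool) :
    addTo n S Y ≫ killMem n Y = killMem n (O :: Y) ≫ eps Y := by
  induction n generalizing Y with
  | zero => exact (Category.comp_id _).trans (Category.id_comp _).symm
  | succ n ih =>
    rw [addTo_succ, killMem_succ, killMem_succ, Category.assoc, reassoc_of% (ih (O :: Y)),
      ← reassoc_of% (killMem_nat n (kap (S n) Y)), eps_nat (eps Y),
      reassoc_of% (kap_lw_eps Y (S n)), Category.assoc, eps_nat (eps Y)]

/-- Projection on the letter `i` of the memory. -/
def evalMem : ∀ (n : ℕ) (_ : ℕ) (Y : List Polarity), Mor (mem n Y) (O :: Y)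
  -- A default value: an empty memory has no letter to project on, and the projection is only
  -- computed for `i < n`.
  | 0, _, Y => eta Y
  | n + 1, i, Y => if i = n then killMem n (O :: Y) else evalMem n i (O :: Y) ≫ lw O (eps Y)

/-- After adding `x` to a memory of zeros, letter `i` contains `x` or zero according to its mark, so
the projection reads the mark off. -/
theorem addTo_evalMem {n i : ℕ} (hi : i < n) (S : ℕ → Bool) :
    etas n (O :: Y) ≫ addTo n S Y ≫ evalMem n i Y =
      if S i then 𝟙 _ else eps Y ≫ eta Y := by
  induction n generalizing Y with
  | zero => omega
  | succ n ih =>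
    rw [etas_succ, addTo_succ, evalMem, Category.assoc, Category.assoc,
      reassoc_of% (etas_nat n (kap (S n) Y))]
    split_ifs with h₁ h₂ h₂
    · subst h₁
      rw [addTo_killMem, reassoc_of% (etas_killMem (O :: O :: Y) i), h₂,
        reassoc_of% (eta_kap_true Y), del_eps]
    · subst h₁
      rw [addTo_killMem, reassoc_of% (etas_killMem (O :: O :: Y) i), Bool.eq_false_of_not_eq_true h₂]
      change eta (O :: Y) ≫ gam Y ≫ eps (O :: Y) = _
      rw [gam_eps, eta_nat]
    · have := ih (O :: Y) (by omega)
      rw [if_pos h₂] at this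
      rw [reassoc_of% this, kap_lw_eps, eta_eps]
    · have := ih (O :: Y) (by omega)
      rw [if_neg h₂] at this
      rw [reassoc_of% this, eta_nat, reassoc_of% (eps_nat (eps Y)), reassoc_of% (kap_lw_eps Y (S n)),
        reassoc_of% (eta_eps (O :: Y))]

end

/-- The unit of a word. -/
def killIn : ∀ A : List Polarity, Mor [] A
  | [] => 𝟙 _
  | O :: A => killIn A ≫ eta A
  | P :: A => killIn A ≫ etaP A

/-- The counit of a word. -/
def killOut : ∀ A : List Polarity, Mor A []
  | [] => 𝟙 _
  | O :: A => eps A ≫ killOut A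
  | P :: A => epsP A ≫ killOut A

/-- With no letter left to process, `nil` is the only applicable constructor. -/
theorem nil_mem_unique {n : ℕ} (f : Mor [] (mem n [])) : f = etas n [] := by
  cases NF.all (A := []) (B := []) f
  rfl

theorem nf_cases_O_nil {n : ℕ} {A : List Polarity} (f : Mor (O :: A) (mem n [])) :
    ∃ (S : ℕ → Bool) (f₀ : Mor A (mem n [])), f = lw O f₀ ≫ rot n [] ≫ addTo n S [] := by
  cases NF.all (A := O :: A) (B := []) f with
  | readO S h => exact ⟨S, _, rfl⟩

theorem nf_cases_nil_P {n : ℕ} {B : List Polarity} (f : Mor [] (mem n (P :: B))) :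
    ∃ (S : ℕ → Bool) (f₀ : Mor [] (mem n B)),
      f = f₀ ≫ memMap n (etaOP B) ≫ addTo n S (P :: B) := by
  cases NF.all (A := []) (B := P :: B) f with
  | readP S h => exact ⟨S, _, rfl⟩

/-- The one pair of leading letters for which a normal form leaves a choice. -/
theorem nf_cases_O_P {n : ℕ} {A B : List Polarity} (f : Mor (O :: A) (mem n (P :: B))) :
    (∃ (S : ℕ → Bool) (f₀ : Mor A (mem n (P :: B))),
      f = lw O f₀ ≫ rot n (P :: B) ≫ addTo n S (P :: B)) ∨
    ∃ (S : ℕ → Bool) (f₀ : Mor (O :: A) (mem n B)),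
      f = f₀ ≫ memMap n (etaOP B) ≫ addTo n S (P :: B) := by
  cases NF.all (A := O :: A) (B := P :: B) f with
  | readO S h => exact .inl ⟨S, _, rfl⟩
  | readP S h => exact .inr ⟨S, _, rfl⟩

section

variable {n : ℕ} {A B : List Polarity} (S : ℕ → Bool)

/-- This and the next lemma undo the reading steps by operations independent of the marks, so that
they apply to two morphisms with different marks at once. -/
theorem eta_readO (f : Mor A (mem n B)) : eta A ≫ lw O f ≫ rot n B ≫ addTo n S B = f := by
  rw [reassoc_of% (eta_nat f), reassoc_of% (eta_rot B n), eta_addTo, Category.comp_id]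

theorem readP_epsP (f : Mor A (mem n B)) :
    (f ≫ memMap n (etaOP B) ≫ addTo n S (P :: B)) ≫ memMap n (epsP B) = f := by
  rw [Category.assoc, Category.assoc, addTo_nat, ← reassoc_of% (memMap_comp n (etaOP B)),
    etaOP_epsP, eta_addTo, Category.comp_id]

/-- With all other letters silenced, `f` becomes a morphism from the empty word to the memory, hence
the unique one, and only the marks survive. The next lemma is the analogue for an output P. -/
theorem readO_killed (f : Mor A (mem n B)) :
    lw O (killIn A) ≫ (lw O f ≫ rot n B ≫ addTo n S B) ≫ memMap n (killOut B) =
      etas n [O] ≫ addTo n S [] := by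
  rw [Category.assoc, Category.assoc, addTo_nat, reassoc_of% (rot_nat n (killOut B)),
    ← etas_rot, Category.assoc, ← nil_mem_unique (killIn A ≫ f ≫ memMap n (killOut B))]
  simp only [lw_comp, Category.assoc]

theorem readP_killed (f : Mor A (mem n B)) :
    killIn A ≫ (f ≫ memMap n (etaOP B) ≫ addTo n S (P :: B)) ≫ memMap n (lw P (killOut B)) =
      etaOP [] ≫ etas n [O, P] ≫ addTo n S [P] := by
  rw [← reassoc_of% (etas_nat n (etaOP [])),
    ← nil_mem_unique (killIn A ≫ f ≫ memMap n (killOut B))]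
  simp only [Category.assoc]
  rw [addTo_nat, ← reassoc_of% (memMap_comp n (etaOP B)), etaOP_nat, memMap_comp]
  simp only [Category.assoc]

/-- The endomorphism `e` erases the P and produces it again with the marks `T`. It commutes with the
reading of an O because the two additions to the memory do. -/
theorem readO_readP_comm (e : Mor (mem n (P :: B)) (mem n (P :: B))) (T : ℕ → Bool)
    (he : e = memMap n (epsP B) ≫ memMap n (etaOP B) ≫ addTo n T (P :: B)) :
    lw O e ≫ rot n (P :: B) ≫ addTo n S (P :: B) =
      rot n (P :: B) ≫ addTo n S (P :: B) ≫ e := by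
  have h := (IsMemMap.addTo n T).rot (P :: B)
  subst he
  simp only [lw_comp, Category.assoc]
  rw [← reassoc_of% h, rot_succ, Category.assoc, addTo_addTo,
    reassoc_of% (addTo_nat n S (epsP B)), reassoc_of% (addTo_nat n S (etaOP B)),
    reassoc_of% (rot_nat n (epsP B)), reassoc_of% (rot_nat n (etaOP B))]

end

/-- A functor which is compatible with whiskering and separates the two endomorphisms of `O` is
faithful. -/
theorem faithful_of_separates {C : Type*} [Category C] (F : Presented stratTheory ⥤ C)
    (hlw : ∀ (a : Polarity) {A B : List Polarity} (f g : Mor A B), F.map f = F.map g →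
      F.map (lw a f) = F.map (lw a g))
    (h₁ : F.map (𝟙 (⟨[O]⟩ : Presented stratTheory)) ≠ F.map (eps [] ≫ eta []))
    (h₂ : F.map (etaOP []) ≠ F.map (etaOP [] ≫ eps [P] ≫ eta [P])) :
    ∀ (n : ℕ) (A B : List Polarity) (f g : Mor A (mem n B)), F.map f = F.map g → f = g := by
  -- Marks that differ at `i` would, after projection on letter `i`, identify the identity of O with
  -- discarding followed by zero.
  have hO : ∀ (n : ℕ) (S T : ℕ → Bool),
      F.map (etas n [O] ≫ addTo n S []) = F.map (etas n [O] ≫ addTo n T []) →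
      ∀ i < n, S i = T i := by
    intro n S T h i hi
    have h' : F.map ((etas n [O] ≫ addTo n S []) ≫ evalMem n i []) =
        F.map ((etas n [O] ≫ addTo n T []) ≫ evalMem n i []) := by
      rw [F.map_comp, h, ← F.map_comp]
    rw [Category.assoc, Category.assoc, addTo_evalMem _ hi, addTo_evalMem _ hi] at h'
    by_contra hne
    cases hS : S i <;> cases hT : T i <;> simp only [hS, hT] at hne h'
    · exact hne trivial
    · exact h₁ h'.symm
    · exact h₁ h'
    · exact hne trivial
  -- Likewise, the projection would identify the unit of the duality with the pair whose O has been
  -- replaced by zero.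
  have hP : ∀ (n : ℕ) (S T : ℕ → Bool),
      F.map (etaOP [] ≫ etas n [O, P] ≫ addTo n S [P]) =
        F.map (etaOP [] ≫ etas n [O, P] ≫ addTo n T [P]) →
      ∀ i < n, S i = T i := by
    intro n S T h i hi
    have h' : F.map ((etaOP [] ≫ etas n [O, P] ≫ addTo n S [P]) ≫ evalMem n i [P]) =
        F.map ((etaOP [] ≫ etas n [O, P] ≫ addTo n T [P]) ≫ evalMem n i [P]) := by
      rw [F.map_comp, h, ← F.map_comp]
    simp only [Category.assoc] at h'
    rw [addTo_evalMem _ hi, addTo_evalMem _ hi] at h'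
    by_contra hne
    cases hS : S i <;> cases hT : T i <;> simp only [hS, hT] at hne h'
    · exact hne trivial
    · exact h₂ (h'.trans (by simp)).symm
    · exact h₂ (by simpa using h')
    · exact hne trivial
  -- Only the letters outside the memory are counted, so absorbing a letter decreases the measure
  -- although `n` grows.
  suffices ∀ (N n : ℕ) (A B : List Polarity), A.length + B.length ≤ N →
      ∀ f g : Mor A (mem n B), F.map f = F.map g → f = g from
    fun n A B f g => this _ n A B le_rfl f g
  intro N
  induction N with
  | zero =>
    intro n A B hN f g _
    obtain rfl : A = [] := List.length_eq_zero_iff.1 (by omega)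
    obtain rfl : B = [] := List.length_eq_zero_iff.1 (by omega)
    rw [nil_mem_unique f, nil_mem_unique g]
  | succ N ih =>
    have sameO : ∀ (n : ℕ) (A B : List Polarity), (O :: A).length + B.length ≤ N + 1 →
        ∀ (S T : ℕ → Bool) (f g : Mor A (mem n B)),
        F.map (lw O f ≫ rot n B ≫ addTo n S B) = F.map (lw O g ≫ rot n B ≫ addTo n T B) →
        lw O f ≫ rot n B ≫ addTo n S B = lw O g ≫ rot n B ≫ addTo n T B := by
      intro n A B hN S T f g hfg
      have h : f = g := ih n A B (by simp only [List.length_cons] at hN; omega) f g (by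
        rw [← eta_readO S f, ← eta_readO T g, F.map_comp, hfg, ← F.map_comp])
      have hST := hO n S T (by
        rw [← readO_killed S f, ← readO_killed T g, F.map_comp, F.map_comp, hfg,
          ← F.map_comp, ← F.map_comp])
      rw [h, addTo_congr hST]
    have sameP : ∀ (n : ℕ) (A B : List Polarity), A.length + (P :: B).length ≤ N + 1 →
        ∀ (S T : ℕ → Bool) (f g : Mor A (mem n B)),
        F.map (f ≫ memMap n (etaOP B) ≫ addTo n S (P :: B)) =
          F.map (g ≫ memMap n (etaOP B) ≫ addTo n T (P :: B)) →
        f ≫ memMap n (etaOP B) ≫ addTo n S (P :: B) =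
          g ≫ memMap n (etaOP B) ≫ addTo n T (P :: B) := by
      intro n A B hN S T f g hfg
      have h : f = g := ih n A B (by simp only [List.length_cons] at hN; omega) f g (by
        rw [← readP_epsP S f, ← readP_epsP T g, F.map_comp, hfg, ← F.map_comp])
      have hST := hP n S T (by
        rw [← readP_killed S f, ← readP_killed T g, F.map_comp, F.map_comp, hfg,
          ← F.map_comp, ← F.map_comp])
      rw [h, addTo_congr hST]
    -- One side ends by reading the O, the other by reading the P. Undoing each reading on the
    -- opposite side expresses `f` through `g` and `g` through `f`.
    have mixed : ∀ (n : ℕ) (A B : List Polarity), (O :: A).length + (P :: B).length ≤ N + 1 →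
        ∀ (S T : ℕ → Bool) (f : Mor A (mem n (P :: B))) (g : Mor (O :: A) (mem n B)),
        F.map (lw O f ≫ rot n (P :: B) ≫ addTo n S (P :: B)) =
          F.map (g ≫ memMap n (etaOP B) ≫ addTo n T (P :: B)) →
        lw O f ≫ rot n (P :: B) ≫ addTo n S (P :: B) =
          g ≫ memMap n (etaOP B) ≫ addTo n T (P :: B) := by
      intro n A B hN S T f g hfg
      have h₁ : f = eta A ≫ g ≫ memMap n (etaOP B) ≫ addTo n T (P :: B) :=
        ih n A (P :: B) (by simp only [List.length_cons] at hN ⊢; omega) _ _ (by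
          rw [← eta_readO S f, F.map_comp, hfg, ← F.map_comp])
      have h₂ : g = (lw O f ≫ rot n (P :: B) ≫ addTo n S (P :: B)) ≫ memMap n (epsP B) :=
        ih n (O :: A) B (by simp only [List.length_cons] at hN ⊢; omega) _ _ (by
          rw [← readP_epsP T g, F.map_comp, ← hfg, ← F.map_comp])
      have hc := readO_readP_comm S _ T rfl (B := B) (n := n)
      -- By `h₁`, `f` itself ends by reading the P with the marks `T`, so erasing the P and reading
      -- it again does not change it.
      have h₃ : f ≫ memMap n (epsP B) ≫ memMap n (etaOP B) ≫ addTo n T (P :: B) = f := by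
        have := readP_epsP T (eta A ≫ g)
        simp only [Category.assoc] at this
        conv_lhs => rw [h₁]
        simp only [Category.assoc]
        rw [reassoc_of% this, ← h₁]
      conv_rhs => rw [h₂]
      simp only [Category.assoc]
      rw [← hc]
      conv_lhs => rw [← h₃]
      rw [lw_comp, Category.assoc]
    intro n A B hN f g hfg
    match A, B, f, g, hN with
    | A, O :: B, f, g, hN =>
      exact ih (n + 1) A B (by simp only [List.length_cons] at hN; omega) f g hfg
    | P :: A, B, f, g, hN =>
      have h := ih (n + 1) A B (by simp only [List.length_cons] at hN; omega)
        (etaOP A ≫ lw O f ≫ rot n B) (etaOP A ≫ lw O g ≫ rot n B) (by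
          rw [F.map_comp, F.map_comp, hlw O _ _ hfg, ← F.map_comp, ← F.map_comp])
      -- Transposition is invertible by the duality, so `f` and `g` may be compared after the
      -- leading P has been moved into the memory.
      have key : ∀ k : Mor (P :: A) (mem n B),
          lw P ((etaOP A ≫ lw O k ≫ rot n B) ≫ rotInv n B) ≫ epsOP (mem n B) = k := by
        intro k
        simp only [Category.assoc]
        rw [rot_rotInv, Category.comp_id, lw_comp, Category.assoc, ← epsOP_nat,
          reassoc_of% (zigzag_P A)]
      rw [← key f, ← key g, h]
    | [], [], f, g, _ => rw [nil_mem_unique f, nil_mem_unique g]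
    | O :: A, [], f, g, hN =>
      obtain ⟨S, f₀, rfl⟩ := nf_cases_O_nil f
      obtain ⟨T, g₀, rfl⟩ := nf_cases_O_nil g
      exact sameO _ _ _ hN _ _ _ _ hfg
    | [], P :: B, f, g, hN =>
      obtain ⟨S, f₀, rfl⟩ := nf_cases_nil_P f
      obtain ⟨T, g₀, rfl⟩ := nf_cases_nil_P g
      exact sameP _ _ _ hN _ _ _ _ hfg
    | O :: A, P :: B, f, g, hN =>
      rcases nf_cases_O_P f with ⟨S, f₀, rfl⟩ | ⟨S, f₀, rfl⟩ <;>
        rcases nf_cases_O_P g with ⟨T, g₀, rfl⟩ | ⟨T, g₀, rfl⟩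
      · exact sameO _ _ _ hN _ _ _ _ hfg
      · exact mixed _ _ _ hN _ _ _ _ hfg
      · exact (mixed _ _ _ hN _ _ _ _ hfg.symm).symm
      · exact sameP _ _ _ hN _ _ _ _ hfg

namespace Games

open Game MonoidalCategory



/-! ### Interpretation of terms in games -/



/-- The game with one move. -/
@[reducible]
def atom (a : Polarity) : Games where
  game :=
    { Moves := Unit
      pol := fun _ => a
      finite_Iic := fun _ => Set.toFinite _ }
  finite := (inferInstance : Finite Unit)
  total := fun _ _ => .inl le_rfl

/-- The filiform game whose moves are the letters of a word. -/
@[reducible]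
def ofWord : List Polarity → Games
  | [] => empty
  | a :: w => before (atom a) (ofWord w)

/-- The relation underlying a morphism. -/
abbrev rel {A B : Games} (f : A ⟶ B) :
    A.game.Moves ⊕ B.game.Moves → A.game.Moves ⊕ B.game.Moves → Prop :=
  CyclicStrategy.rel f.1

/-- The copycat morphisms along isomorphisms of games. -/
def IsStructural {A B : Games} (f : A ⟶ B) : Prop :=
  ∃ e : A.game.Moves ≃ B.game.Moves, IsCopy f e ∧ ∀ a a', a ≤ a' → e a ≤ e a'

/-- Finite total orders have no nontrivial automorphism. Through `IsStructural.eq`, every coherence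
condition below reduces to this. -/
theorem equiv_eq_of_monotone {A B : Games} {e e' : A.game.Moves ≃ B.game.Moves}
    (he : ∀ a a', a ≤ a' → e a ≤ e a') (he' : ∀ a a', a ≤ a' → e' a ≤ e' a') (a : A.game.Moves) :
    e a = e' a := by
  classical
  have := A.finite
  let _ : LinearOrder A.game.Moves :=
    { A.game.order with
      le_total := A.total
      toDecidableLE := Classical.decRel _ }
  have iso : ∀ f : A.game.Moves ≃ B.game.Moves, (∀ a a', a ≤ a' → f a ≤ f a') →
      ∀ a a', f a ≤ f a' ↔ a ≤ a' := fun f hf a a' => by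
    refine ⟨fun h => ?_, hf a a'⟩
    rcases le_total a a' with h' | h'
    · exact h'
    · exact (f.injective (le_antisymm h (hf _ _ h'))).le
  have : (⟨e, iso e he _ _⟩ : A.game.Moves ≃o B.game.Moves) = ⟨e', iso e' he' _ _⟩ :=
    Subsingleton.elim _ _
  exact congrArg (fun f : A.game.Moves ≃o B.game.Moves => f a) this

namespace IsStructural

variable {A B C D : Games}

theorem eq {f g : A ⟶ B} (hf : IsStructural f) (hg : IsStructural g) : f = g := by
  obtain ⟨e, he, hm⟩ := hf
  obtain ⟨e', he', hm'⟩ := hg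
  exact he.eq he' (equiv_eq_of_monotone hm hm')

theorem id (A : Games) : IsStructural (𝟙 A) := ⟨_, .id A, fun _ _ h => h⟩

theorem comp {f : A ⟶ B} {g : B ⟶ C} (hf : IsStructural f) (hg : IsStructural g) :
    IsStructural (f ≫ g) := by
  obtain ⟨e, he, hm⟩ := hf
  obtain ⟨e', he', hm'⟩ := hg
  exact ⟨_, he.comp he', fun a a' h => hm' _ _ (hm _ _ h)⟩

theorem tensor {f : A ⟶ B} {g : C ⟶ D} (hf : IsStructural f) (hg : IsStructural g) :
    IsStructural (f ⊗ₘ g) := by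
  obtain ⟨e, he, hm⟩ := hf
  obtain ⟨e', he', hm'⟩ := hg
  refine ⟨_, he.tensor he', ?_⟩
  rintro _ _ (h | h | _)
  · exact .inl (hm _ _ h)
  · exact .inr (hm' _ _ h)
  · exact .sep _ _

theorem whiskerLeft (C : Games) {f : A ⟶ B} (hf : IsStructural f) : IsStructural (C ◁ f) := by
  rw [← id_tensorHom]
  exact (id C).tensor hf

theorem whiskerRight {f : A ⟶ B} (hf : IsStructural f) (C : Games) : IsStructural (f ▷ C) := by
  rw [← tensorHom_id]
  exact hf.tensor (id C)

theorem of_eq_isoOf {i : A ≅ B} {e : A.game.Moves ≃ B.game.Moves}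
    {he : ∀ a, B.game.pol (e a) = A.game.pol a} {hle : ∀ a a', a ≤ a' ↔ e a ≤ e a'}
    (h : i = isoOf e he hle) : IsStructural i.hom ∧ IsStructural i.inv := by
  subst h
  exact ⟨⟨e, ⟨he, rfl⟩, fun a a' => (hle a a').1⟩,
    ⟨e.symm, ⟨fun b => by rw [← he, e.apply_symm_apply], rfl⟩,
      fun b b' h => (hle _ _).2 (by simpa using h)⟩⟩

theorem leftUnitor (A : Games) : IsStructural (λ_ A).hom ∧ IsStructural (λ_ A).inv :=
  of_eq_isoOf rfl

theorem rightUnitor (A : Games) : IsStructural (ρ_ A).hom ∧ IsStructural (ρ_ A).inv :=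
  of_eq_isoOf rfl

theorem associator (A B C : Games) :
    IsStructural (α_ A B C).hom ∧ IsStructural (α_ A B C).inv :=
  of_eq_isoOf rfl

theorem eqToHom (h : A = B) : IsStructural (eqToHom h) := by
  subst h
  exact id A

end IsStructural

/-- The game of a concatenation. -/
def ofWordAppend : ∀ A B : List Polarity, ofWord A ⊗ ofWord B ≅ ofWord (A ++ B)
  | [], B => λ_ (ofWord B)
  | a :: A, B => α_ (atom a) (ofWord A) (ofWord B) ≪≫ whiskerLeftIso (atom a) (ofWordAppend A B)

theorem ofWordAppend_hom (A B : List Polarity) : IsStructural (ofWordAppend A B).hom := by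
  induction A with
  | nil => exact (IsStructural.leftUnitor _).1
  | cons a A ih => exact .comp (IsStructural.associator _ _ _).1 (ih.whiskerLeft _)

theorem ofWordAppend_inv (A B : List Polarity) : IsStructural (ofWordAppend A B).inv := by
  induction A with
  | nil => exact (IsStructural.leftUnitor _).2
  | cons a A ih => exact .comp (ih.whiskerLeft _) (IsStructural.associator _ _ _).2

/-- An interpretation of the generators. -/
abbrev Interpretation := ∀ g : StratGen, ofWord (stratSig.src g) ⟶ ofWord (stratSig.tgt g)

/-- The interpretation of terms induced by an interpretation of the generators. -/
def eval (I : Interpretation) : ∀ {A B : List Polarity}, Term stratSig A B → (ofWord A ⟶ ofWord B)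
  | _, _, .id A => 𝟙 (ofWord A)
  | _, _, .gen g => I g
  | _, _, .comp f g => eval I f ≫ eval I g
  | _, _, @Term.tensor _ A B C D f g =>
    (ofWordAppend A C).inv ≫ (eval I f ⊗ₘ eval I g) ≫ (ofWordAppend B D).hom

theorem eval_cast (I : Interpretation) {A B A' B' : List Polarity} (hA : A = A') (hB : B = B')
    (f : Term stratSig A B) :
    eval I (f.cast hA hB) = eqToHom (by rw [hA]) ≫ eval I f ≫ eqToHom (by rw [hB]) := by
  subst hA hB
  simp [Term.cast]

/-- The strict monoidal laws hold in `Games` only up to associators and unitors. The isomorphisms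
`ofWordAppend` absorb them, since parallel structural morphisms are equal. -/
theorem eval_eqv (I : Interpretation)
    (hI : ∀ {A B : List Polarity} {f g : Term stratSig A B}, StratRel f g → eval I f = eval I g)
    {A B : List stratTheory.sig.Atom} {f g : Term stratTheory.sig A B} (h : stratTheory.Eqv f g) :
    eval I f = eval I g := by
  induction h with
  | refl => rfl
  | symm _ ih => exact ih.symm
  | trans _ _ ih₁ ih₂ => exact ih₁.trans ih₂
  | comp _ _ ih₁ ih₂ => exact congrArg₂ (· ≫ ·) ih₁ ih₂
  | tensor _ _ ih₁ ih₂ => simp only [eval, ih₁, ih₂]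
  | id_comp f => exact Category.id_comp _
  | comp_id f => exact Category.comp_id _
  | assoc f g h => exact Category.assoc _ _ _
  | tensor_id A B => simp [eval]
  | interchange f g f' g' => simp [eval]
  | unit_tensor f =>
    simp only [eval, ofWordAppend, id_tensorHom]
    erw [leftUnitor_naturality, Iso.inv_hom_id_assoc]
  | @tensor_unit A B f =>
    have h : ∀ X : List Polarity, (ofWordAppend X []).hom ≫
        eqToHom (congrArg ofWord (List.append_nil X)) = (ρ_ (ofWord X)).hom := fun X =>
      ((ofWordAppend_hom X []).comp (.eqToHom _)).eq (IsStructural.rightUnitor _).1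
    have h' : eqToHom (congrArg ofWord (List.append_nil A)).symm ≫ (ofWordAppend A []).inv =
        (ρ_ (ofWord A)).inv :=
      ((IsStructural.eqToHom _).comp (ofWordAppend_inv A [])).eq (IsStructural.rightUnitor _).2
    rw [eval_cast]
    simp only [eval, Category.assoc]
    erw [h B, reassoc_of% h', tensorHom_id, rightUnitor_naturality, Iso.inv_hom_id_assoc]
  | @tensor_assoc A B C A' B' C' f g h =>
    have h₁ : ∀ A B C : List Polarity, ((ofWordAppend A B).hom ▷ ofWord C) ≫
        (ofWordAppend (A ++ B) C).hom ≫ eqToHom (congrArg ofWord (List.append_assoc A B C)) =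
        (α_ _ _ _).hom ≫ (ofWord A ◁ (ofWordAppend B C).hom) ≫ (ofWordAppend A (B ++ C)).hom :=
      fun A B C => IsStructural.eq
        (((ofWordAppend_hom _ _).whiskerRight _).comp ((ofWordAppend_hom _ _).comp (.eqToHom _)))
        (.comp (IsStructural.associator _ _ _).1 (((ofWordAppend_hom _ _).whiskerLeft _).comp
          (ofWordAppend_hom _ _)))
    have h₂ : eqToHom (congrArg ofWord (List.append_assoc A B C)).symm ≫
        (ofWordAppend (A ++ B) C).inv ≫ ((ofWordAppend A B).inv ▷ ofWord C) =
        (ofWordAppend A (B ++ C)).inv ≫ (ofWord A ◁ (ofWordAppend B C).inv) ≫ (α_ _ _ _).inv :=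
      IsStructural.eq
        (.comp (.eqToHom _) ((ofWordAppend_inv _ _).comp ((ofWordAppend_inv _ _).whiskerRight _)))
        ((ofWordAppend_inv _ _).comp (((ofWordAppend_inv _ _).whiskerLeft _).comp
          (IsStructural.associator _ _ _).2))
    rw [eval_cast]
    simp only [eval, Category.assoc]
    have e₁ : (((ofWordAppend A B).inv ≫ (eval I f ⊗ₘ eval I g) ≫ (ofWordAppend A' B').hom) ⊗ₘ
        eval I h) = ((ofWordAppend A B).inv ▷ ofWord C) ≫ ((eval I f ⊗ₘ eval I g) ⊗ₘ eval I h) ≫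
          ((ofWordAppend A' B').hom ▷ ofWord C') := by
      rw [← tensorHom_id, ← tensorHom_id, tensorHom_comp_tensorHom, tensorHom_comp_tensorHom,
        Category.id_comp, Category.comp_id]
    have e₂ : (eval I f ⊗ₘ ((ofWordAppend B C).inv ≫ (eval I g ⊗ₘ eval I h) ≫
        (ofWordAppend B' C').hom)) = (ofWord A ◁ (ofWordAppend B C).inv) ≫
          (eval I f ⊗ₘ (eval I g ⊗ₘ eval I h)) ≫ (ofWord A' ◁ (ofWordAppend B' C').hom) := by
      rw [← id_tensorHom, ← id_tensorHom, tensorHom_comp_tensorHom, tensorHom_comp_tensorHom,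
        Category.id_comp, Category.comp_id]
    erw [e₁, e₂]
    simp only [Category.assoc]
    erw [h₁ A' B' C', reassoc_of% h₂]
    simp
  | rel h => exact hI h

/-! ### Computation of relations -/

section

variable {A B C D : Games}

theorem rel_of_not_eq (f : A ⟶ B) {x y : A.game.Moves ⊕ B.game.Moves} (h : rel f x y)
    (hxy : x ≠ y) : (A.game.arrow B.game).pol x = O ∧ (A.game.arrow B.game).pol y = P :=
  CyclicStrategy.polarity f.1 x y h hxy

/-- An upper bound on the relation of a composite, obtained by retracting the middle game on the
outer ones. -/
theorem rel_comp_le (f : A ⟶ B) (g : B ⟶ C)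
    {T : A.game.Moves ⊕ C.game.Moves → A.game.Moves ⊕ C.game.Moves → Prop}
    (hT : ∀ x y z, T x y → T y z → T x z) (r : B.game.Moves → A.game.Moves ⊕ C.game.Moves)
    (hf : ∀ x y, rel f x y → T (Sum.elim Sum.inl r x) (Sum.elim Sum.inl r y))
    (hg : ∀ x y, rel g x y → T (Sum.elim r Sum.inr x) (Sum.elim r Sum.inr y))
    {x y : A.game.Moves ⊕ C.game.Moves} (h : rel (f ≫ g) x y) : T x y := by
  let κ : A.game.Moves ⊕ B.game.Moves ⊕ C.game.Moves → A.game.Moves ⊕ C.game.Moves :=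
    Sum.elim Sum.inl (Sum.elim r Sum.inr)
  have step : ∀ u v, Interaction f.1 g.1 u v → T (κ u) (κ v) := by
    rintro _ _ (⟨x, y, h⟩ | ⟨x, y, h⟩)
    · have := hf x y h
      rcases x with a | b <;> rcases y with a' | b' <;> exact this
    · have := hg x y h
      rcases x with a | b <;> rcases y with a' | b' <;> exact this
  have key : ∀ u v, Relation.TransGen (Interaction f.1 g.1) u v → T (κ u) (κ v) := by
    intro u v h
    induction h with
    | single h => exact step _ _ h
    | tail _ h ih => exact hT _ _ _ ih (step _ _ h)
  have := key _ _ h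
  rcases x with a | b <;> rcases y with a' | b' <;> exact this

/-- The interaction paths of two composable morphisms. -/
abbrev Path (f : A ⟶ B) (g : B ⟶ C) := Relation.TransGen (Interaction f.1 g.1)

theorem Path.left {f : A ⟶ B} (g : B ⟶ C) {x y : A.game.Moves ⊕ B.game.Moves} (h : rel f x y) :
    Path f g (Sum.map id Sum.inl x) (Sum.map id Sum.inl y) :=
  .single (.left x y h)

theorem Path.right (f : A ⟶ B) {g : B ⟶ C} {x y : B.game.Moves ⊕ C.game.Moves} (h : rel g x y) :
    Path f g (Sum.inr x) (Sum.inr y) :=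
  .single (.right x y h)

theorem rel_isCopy_comp {f : A ⟶ B} {e : A.game.Moves ≃ B.game.Moves} (hf : IsCopy f e)
    (g : B ⟶ C) (x y : A.game.Moves ⊕ C.game.Moves) :
    rel (f ≫ g) x y ↔ rel g (Sum.map e id x) (Sum.map e id y) := by
  obtain ⟨he, hf⟩ := hf
  refine Iff.trans (iff_of_eq ?_) (copycat_comp_rel e he g.1 x y)
  rw [← hf]
  rfl

theorem rel_comp_isCopy (f : A ⟶ B) {g : B ⟶ C} {e : B.game.Moves ≃ C.game.Moves}
    (hg : IsCopy g e) (x y : A.game.Moves ⊕ C.game.Moves) :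
    rel (f ≫ g) x y ↔ rel f (Sum.map id e.symm x) (Sum.map id e.symm y) := by
  obtain ⟨he, hg⟩ := hg
  refine Iff.trans (iff_of_eq ?_) (comp_copycat_rel e he f.1 x y)
  rw [← hg]
  rfl

end

theorem isCopy_of_eq_isoOf {A B : Games} {i : A ≅ B} {e : A.game.Moves ≃ B.game.Moves}
    {he : ∀ a, B.game.pol (e a) = A.game.pol a} {hle : ∀ a a', a ≤ a' ↔ e a ≤ e a'}
    (h : i = isoOf e he hle) : IsCopy i.hom e ∧ IsCopy i.inv e.symm := by
  subst h
  exact ⟨⟨he, rfl⟩, ⟨fun b => by rw [← he, e.apply_symm_apply], rfl⟩⟩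

/-- The letters of a concatenation. -/
def appendEquiv : ∀ A B : List Polarity,
    (ofWord A).game.Moves ⊕ (ofWord B).game.Moves ≃ (ofWord (A ++ B)).game.Moves
  | [], _ => Equiv.emptySum _ _
  | _ :: A, B => (Equiv.sumAssoc _ _ _).trans (Equiv.sumCongr (Equiv.refl _) (appendEquiv A B))

theorem isCopy_ofWordAppend_hom (A B : List Polarity) :
    IsCopy (ofWordAppend A B).hom (appendEquiv A B) := by
  induction A with
  | nil => exact (isCopy_of_eq_isoOf (i := λ_ (ofWord B)) rfl).1
  | cons a A ih => exact IsCopy.comp (isCopy_of_eq_isoOf rfl).1 (IsCopy.tensor (.id _) ih)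

theorem isCopy_ofWordAppend_inv (A B : List Polarity) :
    IsCopy (ofWordAppend A B).inv (appendEquiv A B).symm := by
  induction A with
  | nil => exact (isCopy_of_eq_isoOf (i := λ_ (ofWord B)) rfl).2
  | cons a A ih => exact IsCopy.comp (IsCopy.tensor (.id _) ih) (isCopy_of_eq_isoOf rfl).2

theorem rel_eval_tensor (I : Interpretation) {A B C D : List Polarity} (f : Term stratSig A B)
    (g : Term stratSig C D) (x y : (ofWord (A ++ C)).game.Moves ⊕ (ofWord (B ++ D)).game.Moves) :
    rel (eval I (f.tensor g)) x y ↔ Sum.LiftRel (rel (eval I f)) (rel (eval I g))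
      (shuffle (Sum.map (appendEquiv A C).symm (appendEquiv B D).symm x))
      (shuffle (Sum.map (appendEquiv A C).symm (appendEquiv B D).symm y)) := by
  refine (rel_isCopy_comp (isCopy_ofWordAppend_inv A C) _ x y).trans
    ((rel_comp_isCopy _ (isCopy_ofWordAppend_hom B D) _ _).trans ?_)
  rcases x with x | x <;> rcases y with y | y <;> exact Iff.rfl

/-! ### The interpretation of the generators -/

/-- The strategy on `A ⊸ B` relating every Opponent move to the Proponent moves above it. -/
def causal (A B : Games) : A ⟶ B :=
  let G := A.game.arrow B.game
  let σ : CyclicStrategy G :=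
    { rel := fun x y => x = y ∨ (x ≤ y ∧ G.pol x = O ∧ G.pol y = P)
      refl := fun _ => .inl rfl
      trans := by
        rintro x y z (rfl | h) (rfl | k)
        · exact .inl rfl
        · exact .inr k
        · exact .inr h
        · rw [h.2.2] at k
          exact absurd k.2.1 (by simp)
      polarity := fun x y h hxy => (h.resolve_left hxy).2 }
  ⟨σ, .strategy _
    { isPartialOrder := σ.isPartialOrder
      polarity := σ.polarity
      acyclic := isPartialOrder_transGen (fun _ => .inl (.inl rfl)) (· ≤ ·) id
        Function.injective_id (by
          rintro x y ((rfl | h) | h)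
          · exact le_rfl
          · exact h.1
          · exact h) }⟩

/-- The strategy relating Opponent moves of `B` to Opponent moves of `A`. -/
def ofEdges {A B : Games} (hA : ∀ a, A.game.pol a = O) (hB : ∀ b, B.game.pol b = O)
    (R : B.game.Moves → A.game.Moves → Prop) : A ⟶ B :=
  let σ : CyclicStrategy (A.game.arrow B.game) :=
    { rel := fun x y => match x, y with
        | .inl a, .inl a' => a = a'
        | .inr b, .inr b' => b = b'
        | .inl _, .inr _ => False
        | .inr b, .inl a => R b a
      refl := by rintro (a | b) <;> rfl
      trans := by
        rintro (a | b) (a' | b') (a'' | b'') h k <;> first | exact h.elim | exact k.elim | skip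
        · exact h.trans k
        · obtain rfl : a' = a'' := k
          exact h
        · obtain rfl : b = b' := h
          exact k
        · exact h.trans k
      polarity := by
        rintro (a | b) (a' | b') h hxy
        · exact absurd (congrArg Sum.inl h) hxy
        · exact h.elim
        · exact ⟨hB _, by simp [hA, Polarity.neg]⟩
        · exact absurd (congrArg Sum.inr h) hxy }
  ⟨σ, .strategy _
    { isPartialOrder := σ.isPartialOrder
      polarity := σ.polarity
      acyclic := by
        -- All edges go from `B` to `A`, so placing `B` below `A` gives an order containing both the
        -- edges and causality.
        let R := Sum.Lex (α := B.game.Moves) (β := A.game.Moves) (· ≤ ·) (· ≤ ·)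
        have : IsPartialOrder _ R :=
          { refl := refl_of _
            trans := fun _ _ _ => trans_of _
            antisymm := fun _ _ => antisymm_of _ }
        refine isPartialOrder_transGen (fun _ => .inl (σ.refl _)) R Sum.swap
          Sum.swap_leftInverse.injective ?_
        rintro (a | b) (a' | b') (h | h)
        · obtain rfl : a = a' := h
          exact .inr le_rfl
        · exact .inr (arrow_le_inl.1 h)
        · exact h.elim
        · exact absurd h not_arrow_le_inl_inr
        · exact .sep _ _
        · exact absurd h not_arrow_le_inr_inl
        · obtain rfl : b = b' := h
          exact .inl le_rfl
        · exact .inl (arrow_le_inr.1 h) }⟩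

/-- The position of a letter. -/
def pos : ∀ {w : List Polarity}, (ofWord w).game.Moves → ℕ
  | _ :: _, .inl _ => 0
  | _ :: _, .inr x => pos x + 1

theorem pos_lt {w : List Polarity} (x : (ofWord w).game.Moves) : pos x < w.length := by
  induction w with
  | nil => exact x.elim
  | cons a w ih =>
    rcases x with _ | x
    · simp [pos]
    · simpa [pos] using ih x

theorem pos_injective {w : List Polarity} : Function.Injective (pos (w := w)) := by
  induction w with
  | nil => exact fun x => x.elim
  | cons a w ih => rintro (_ | x) (_ | y) h <;> simp [pos] at h ⊢; exact ih h

theorem exists_pos {w : List Polarity} {i : ℕ} (hi : i < w.length) :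
    ∃ x : (ofWord w).game.Moves, pos x = i := by
  induction w generalizing i with
  | nil => simp at hi
  | cons a w ih =>
    rcases i with _ | i
    · exact ⟨.inl (), rfl⟩
    · obtain ⟨x, rfl⟩ := ih (i := i) (by simpa using hi)
      exact ⟨.inr x, rfl⟩

theorem pos_append_inl {A B : List Polarity} (x : (ofWord A).game.Moves) :
    pos (appendEquiv A B (.inl x)) = pos x := by
  induction A with
  | nil => exact x.elim
  | cons a A ih =>
    rcases x with _ | x
    · rfl
    · exact congrArg (· + 1) (ih x)

theorem pos_append_inr {A B : List Polarity} (x : (ofWord B).game.Moves) :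
    pos (appendEquiv A B (.inr x)) = A.length + pos x := by
  induction A with
  | nil => exact (Nat.zero_add _).symm
  | cons a A ih => exact (congrArg (· + 1) ih).trans (by rw [List.length_cons]; omega)

/-- The words with Opponent letters only. -/
def allO : List Polarity → Bool
  | [] => true
  | O :: w => allO w
  | P :: _ => false

theorem pol_of_allO {w : List Polarity} (hw : allO w) (x : (ofWord w).game.Moves) :
    (ofWord w).game.pol x = O := by
  induction w with
  | nil => exact x.elim
  | cons a w ih =>
    cases a with
    | O =>
      rcases x with _ | x
      · rfl
      · exact ih hw x
    | P => exact absurd hw (by simp [allO])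

/-- The interpretation of the Opponent structure and of the duality. -/
def interp₀ : Interpretation
  | .muO => ofEdges (pol_of_allO rfl) (pol_of_allO rfl) fun _ _ => True
  | .deltaO => ofEdges (pol_of_allO rfl) (pol_of_allO rfl) fun _ _ => True
  | .gammaO => ofEdges (pol_of_allO rfl) (pol_of_allO rfl) fun b a => pos b + pos a = 1
  -- This gives the expected edge for the unit and counit of the duality, and no edge for the unit
  -- and counit of O. The values at the other generators are replaced in `interp`.
  | _ => causal _ _

/-- The interpretation of the generators. -/
def interp : Interpretation
  -- The defining terms only use generators on which `interp` and `interp₀` agree, so the relations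
  -- of transposition hold by definition.
  | .muP => eval interp₀ (((wire [P, P]).tensor ηOP).comp
      (((wire [P, P]).tensor (δO.tensor (wire [P]))).comp (εPPOO.tensor (wire [P]))))
  | .deltaP => eval interp₀ (((wire [P]).tensor ηOOPP).comp
      (((wire [P]).tensor (μO.tensor (wire [P, P]))).comp (εOP.tensor (wire [P, P]))))
  | .etaP => eval interp₀ (ηOP.comp (εO.tensor (wire [P])))
  | .epsP => eval interp₀ (((wire [P]).tensor ηO).comp εOP)
  | .gammaP => eval interp₀ (((wire [P, P]).tensor ηOOPP).comp
      (((wire [P, P]).tensor (γO.tensor (wire [P, P]))).comp (εPPOO.tensor (wire [P, P]))))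
  | .gammaOP => eval interp₀ (((wire [P, O]).tensor ηOP).comp
      (((wire [P]).tensor (γO.tensor (wire [P]))).comp (εOP.tensor (wire [O, P]))))
  | .muO => interp₀ .muO
  | .etaO => interp₀ .etaO
  | .deltaO => interp₀ .deltaO
  | .epsO => interp₀ .epsO
  | .gammaO => interp₀ .gammaO
  | .etaOP => interp₀ .etaOP
  | .epsOP => interp₀ .epsOP

/-! ### Soundness of the relations -/

/-- The Boolean matrices of the generators of the Opponent structure. -/
def genMat : StratGen → ℕ → ℕ → Bool
  | .muO => fun _ _ => true
  | .deltaO => fun _ _ => true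
  | .gammaO => fun i j => i + j == 1
  | _ => fun _ _ => false

/-- The Boolean matrix of a term. -/
def mat : ∀ {A B : List Polarity}, Term stratSig A B → ℕ → ℕ → Bool
  | _, _, .id _ => fun i j => i == j
  | _, _, .gen g => genMat g
  | _, _, @Term.comp _ _ B _ f g => fun i k =>
    (List.range B.length).any fun j => mat g i j && mat f j k
  | _, _, @Term.tensor _ A B _ _ f g => fun i j =>
    if i < B.length then decide (j < A.length) && mat f i j
    else !decide (j < A.length) && mat g (i - B.length) (j - A.length)

/-- The terms made of the Opponent structure. -/
def opponent : ∀ {A B : List Polarity}, Term stratSig A B → Bool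
  | _, _, .id A => allO A
  | _, _, .gen g => allO (stratSig.src g) && allO (stratSig.tgt g)
  | _, _, .comp f g => opponent f && opponent g
  | _, _, .tensor f g => opponent f && opponent g

theorem allO_append {A B : List Polarity} : allO (A ++ B) = (allO A && allO B) := by
  induction A with
  | nil => rfl
  | cons a A ih =>
    cases a
    · exact ih
    · rfl

theorem allO_of_opponent {A B : List stratSig.Atom} {t : Term stratSig A B} (ht : opponent t) :
    allO A ∧ allO B := by
  induction t with
  | id A => exact ⟨ht, ht⟩
  | gen g => exact Bool.and_eq_true_iff.1 ht
  | comp f g ihf ihg =>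
    obtain ⟨hf, hg⟩ := Bool.and_eq_true_iff.1 ht
    exact ⟨(ihf hf).1, (ihg hg).2⟩
  | tensor f g ihf ihg =>
    obtain ⟨hf, hg⟩ := Bool.and_eq_true_iff.1 ht
    exact ⟨allO_append.trans (Bool.and_eq_true_iff.2 ⟨(ihf hf).1, (ihg hg).1⟩),
      allO_append.trans (Bool.and_eq_true_iff.2 ⟨(ihf hf).2, (ihg hg).2⟩)⟩

theorem rel_of_allO {A B : List Polarity} (hA : allO A) (hB : allO B)
    (f : ofWord A ⟶ ofWord B) {x y : (ofWord A).game.Moves ⊕ (ofWord B).game.Moves}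
    (h : rel f x y) (hxy : x ≠ y) : ∃ b a, x = .inr b ∧ y = .inl a := by
  obtain ⟨hx, hy⟩ := rel_of_not_eq f h hxy
  rcases x with a | b
  · simp [pol_of_allO hA, Polarity.neg] at hx
  · rcases y with a | b'
    · exact ⟨b, a, rfl, rfl⟩
    · simp [pol_of_allO hB] at hy

/-- Every nontrivial edge goes from target to source, so an interaction path descends from `C`
through `B` to `A` without turning back: composition is plain relational composition. -/
theorem rel_comp_of_allO {A B C : List Polarity} (hA : allO A) (hB : allO B) (hC : allO C)
    (f : ofWord A ⟶ ofWord B) (g : ofWord B ⟶ ofWord C) (c : (ofWord C).game.Moves)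
    (a : (ofWord A).game.Moves) :
    rel (f ≫ g) (.inr c) (.inl a) ↔ ∃ b, rel g (.inr c) (.inl b) ∧ rel f (.inr b) (.inl a) := by
  constructor
  · intro h
    let Reach : (ofWord A).game.Moves ⊕ (ofWord B).game.Moves ⊕ (ofWord C).game.Moves → Prop
      | .inl a => ∃ b, rel g (.inr c) (.inl b) ∧ rel f (.inr b) (.inl a)
      | .inr (.inl b) => rel g (.inr c) (.inl b)
      | .inr (.inr c') => c' = c
    have step : ∀ u v, Interaction f.1 g.1 u v → Reach u → Reach v := by
      rintro _ _ (⟨x, y, h⟩ | ⟨x, y, h⟩) hu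
      · by_cases hxy : x = y
        · rwa [← hxy]
        · obtain ⟨b, a, rfl, rfl⟩ := rel_of_allO hA hB f h hxy
          exact ⟨b, hu, h⟩
      · by_cases hxy : x = y
        · rwa [← hxy]
        · obtain ⟨c', b, rfl, rfl⟩ := rel_of_allO hB hC g h hxy
          have hc : c' = c := hu
          rw [hc] at h
          exact h
    have key : ∀ v, Path f g (.inr (.inr c)) v → Reach v := by
      intro v h
      induction h with
      | single h => exact step _ _ h rfl
      | tail _ h ih => exact step _ _ h ih
    exact key _ h
  · rintro ⟨b, hg, hf⟩
    exact (Path.right f hg).trans (Path.left g hf)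

/-- Rows are positions in the target and columns positions in the source. This turns equalities
between Opponent terms into decidable equalities of matrices. -/
theorem rel_eval_opponent {A B : List stratSig.Atom} {t : Term stratSig A B} (ht : opponent t)
    (b : (ofWord B).game.Moves) (a : (ofWord A).game.Moves) :
    rel (eval interp t) (.inr b) (.inl a) ↔ mat t (pos b) (pos a) := by
  induction t with
  | id A =>
    refine (show _ ↔ a = b ∧ (ofWord A).game.pol a = O from Iff.rfl).trans ?_
    rw [pol_of_allO ht a]
    simp only [mat, beq_iff_eq, and_true]
    exact ⟨fun h => h ▸ rfl, fun h => (pos_injective h).symm⟩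
  | gen g =>
    cases g <;> first
      | exact absurd ht (by decide)
      | exact a.elim
      | exact b.elim
      | exact ⟨fun _ => rfl, fun _ => trivial⟩
      | exact beq_iff_eq.symm
  | @comp A B C f g ihf ihg =>
    obtain ⟨hf, hg⟩ := Bool.and_eq_true_iff.1 ht
    refine (rel_comp_of_allO (allO_of_opponent hf).1 (allO_of_opponent hf).2
      (allO_of_opponent hg).2 _ _ _ _).trans ?_
    simp only [mat, List.any_eq_true, List.mem_range, Bool.and_eq_true]
    constructor
    · rintro ⟨b', h, k⟩
      exact ⟨pos b', pos_lt b', (ihg hg _ _).1 h, (ihf hf _ _).1 k⟩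
    · rintro ⟨j, hj, h, k⟩
      obtain ⟨b', rfl⟩ := exists_pos hj
      exact ⟨b', (ihg hg _ _).2 h, (ihf hf _ _).2 k⟩
  | @tensor A B C D f g ihf ihg =>
    obtain ⟨hf, hg⟩ := Bool.and_eq_true_iff.1 ht
    refine (rel_eval_tensor interp f g _ _).trans ?_
    obtain ⟨a, rfl⟩ := (appendEquiv A C).surjective a
    obtain ⟨b, rfl⟩ := (appendEquiv B D).surjective b
    simp only [Sum.map_inl, Sum.map_inr, Equiv.symm_apply_apply]
    rcases a with a | c <;> rcases b with b | d <;>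
      simp only [shuffle, Sum.liftRel_inl_inl, Sum.liftRel_inr_inr, Sum.not_liftRel_inl_inr,
        Sum.not_liftRel_inr_inl, mat, pos_append_inl, pos_append_inr]
    · simp [pos_lt a, pos_lt b, ihf hf]
    · simp [pos_lt a]
    · simp [pos_lt b]
    · simp [ihg hg]

theorem eval_eq_of_mat {A B : List Polarity} {t u : Term stratSig A B} (ht : opponent t)
    (hu : opponent u)
    (h : ∀ i < B.length, ∀ j < A.length, mat t i j = mat u i j) :
    eval interp t = eval interp u := by
  have h' : ∀ b a, rel (eval interp t) (.inr b) (.inl a) ↔ rel (eval interp u) (.inr b) (.inl a) :=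
    fun b a => by
      rw [rel_eval_opponent ht, rel_eval_opponent hu, h _ (pos_lt b) _ (pos_lt a)]
  have hA := (allO_of_opponent ht).1
  have hB := (allO_of_opponent ht).2
  refine hom_ext_of_rel fun x y => ?_
  by_cases hxy : x = y
  · subst hxy
    exact iff_of_true (CyclicStrategy.refl _ _) (CyclicStrategy.refl _ _)
  · constructor
    · intro hr
      obtain ⟨b, a, rfl, rfl⟩ := rel_of_allO hA hB _ hr hxy
      exact (h' b a).1 hr
    · intro hr
      obtain ⟨b, a, rfl, rfl⟩ := rel_of_allO hA hB _ hr hxy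
      exact (h' b a).2 hr

theorem eval_bialgebra {A B : List stratSig.Atom} {t u : Term stratSig A B}
    (h : BialgebraRel (S := stratSig) O μO ηO δO εO γO t u) : eval interp t = eval interp u := by
  cases h <;> exact eval_eq_of_mat (by decide) (by decide) (by decide)

/-! ### The functor from the generated category to games -/

/-- Polarities allow a single nontrivial edge between the two copies of a move, so its presence
determines the morphism. -/
theorem eq_id_of_rel_P (f : ofWord [P] ⟶ ofWord [P])
    (h : rel f (.inl (.inl ())) (.inr (.inl ()))) : f = 𝟙 _ := by
  refine hom_ext_of_rel fun x y => ?_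
  by_cases hxy : x = y
  · subst hxy
    exact iff_of_true (CyclicStrategy.refl _ _) (CyclicStrategy.refl _ _)
  · have key : ∀ g : ofWord [P] ⟶ ofWord [P], rel g x y →
        x = .inl (.inl ()) ∧ y = .inr (.inl ()) := by
      intro g hg
      obtain ⟨hx, hy⟩ := rel_of_not_eq g hg hxy
      rcases x with (_ | x) | (_ | x) <;> rcases y with (_ | y) | (_ | y) <;>
        first | exact x.elim | exact y.elim | simp [Polarity.neg] at hx hy ⊢
    constructor
    · intro hr
      obtain ⟨rfl, rfl⟩ := key _ hr
      exact ⟨rfl, rfl⟩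
    · intro hr
      obtain ⟨rfl, rfl⟩ := key _ hr
      exact h

theorem eq_id_of_rel_O (f : ofWord [O] ⟶ ofWord [O])
    (h : rel f (.inr (.inl ())) (.inl (.inl ()))) : f = 𝟙 _ := by
  refine hom_ext_of_rel fun x y => ?_
  by_cases hxy : x = y
  · subst hxy
    exact iff_of_true (CyclicStrategy.refl _ _) (CyclicStrategy.refl _ _)
  · have key : ∀ g : ofWord [O] ⟶ ofWord [O], rel g x y →
        x = .inr (.inl ()) ∧ y = .inl (.inl ()) := by
      intro g hg
      obtain ⟨hx, hy⟩ := rel_of_not_eq g hg hxy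
      rcases x with (_ | x) | (_ | x) <;> rcases y with (_ | y) | (_ | y) <;>
        first | exact x.elim | exact y.elim | simp [Polarity.neg] at hx hy ⊢
    constructor
    · intro hr
      obtain ⟨rfl, rfl⟩ := key _ hr
      exact ⟨rfl, rfl⟩
    · intro hr
      obtain ⟨rfl, rfl⟩ := key _ hr
      exact h

theorem rel_etaOP : rel (eval interp ηOP) (.inr (.inl ())) (.inr (.inr (.inl ()))) :=
  .inr ⟨arrow_le_inr.2 (.sep _ _), rfl, rfl⟩

theorem rel_epsOP : rel (eval interp εOP) (.inl (.inl ())) (.inl (.inr (.inl ()))) :=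
  .inr ⟨arrow_le_inl.2 (.sep _ _), rfl, rfl⟩

theorem eval_duality {A B : List stratSig.Atom} {t u : Term stratSig A B}
    (h : DualityRel (S := stratSig) P O ηOP εOP t u) : eval interp t = eval interp u := by
  cases h with
  | zigzag_left =>
    let f := eval interp ((wire [P]).tensor ηOP)
    let g := eval interp (εOP.tensor (wire [P]))
    have h₁ : rel f (.inl (.inl ())) (.inr (.inl ())) :=
      (rel_eval_tensor interp (wire [P]) ηOP _ _).2 (.inl ⟨rfl, rfl⟩)
    have h₂ : rel g (.inl (.inl ())) (.inl (.inr (.inl ()))) :=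
      (rel_eval_tensor interp εOP (wire [P]) _ _).2 (.inl rel_epsOP)
    have h₃ : rel f (.inr (.inr (.inl ()))) (.inr (.inr (.inr (.inl ())))) :=
      (rel_eval_tensor interp (wire [P]) ηOP _ _).2 (.inr rel_etaOP)
    have h₄ : rel g (.inl (.inr (.inr (.inl ())))) (.inr (.inl ())) :=
      (rel_eval_tensor interp εOP (wire [P]) _ _).2 (.inr ⟨rfl, rfl⟩)
    refine eq_id_of_rel_P (f ≫ g) ?_
    -- The path follows the bent wire: along the identity on the left, down the counit, up the unit,
    -- and out along the identity on the right.
    exact (((Path.left g h₁).trans (Path.right f h₂)).trans (Path.left g h₃)).trans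
      (Path.right f h₄)
  | zigzag_right =>
    let f := eval interp (ηOP.tensor (wire [O]))
    let g := eval interp ((wire [O]).tensor εOP)
    have h₁ : rel g (.inr (.inl ())) (.inl (.inl ())) :=
      (rel_eval_tensor interp (wire [O]) εOP _ _).2 (.inl ⟨rfl, rfl⟩)
    have h₂ : rel f (.inr (.inl ())) (.inr (.inr (.inl ()))) :=
      (rel_eval_tensor interp ηOP (wire [O]) _ _).2 (.inl rel_etaOP)
    have h₃ : rel g (.inl (.inr (.inl ()))) (.inl (.inr (.inr (.inl ())))) :=
      (rel_eval_tensor interp (wire [O]) εOP _ _).2 (.inr rel_epsOP)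
    have h₄ : rel f (.inr (.inr (.inr (.inl ())))) (.inl (.inl ())) :=
      (rel_eval_tensor interp ηOP (wire [O]) _ _).2 (.inr ⟨rfl, rfl⟩)
    refine eq_id_of_rel_O (f ≫ g) ?_
    exact (((Path.right f h₁).trans (Path.left g h₂)).trans (Path.right f h₃)).trans
      (Path.left g h₄)

theorem eval_rel {A B : List Polarity} {t u : Term stratSig A B} (h : StratRel t u) :
    eval interp t = eval interp u := by
  cases h with
  | opponent h => exact eval_bialgebra h
  | duality h => exact eval_duality h
  | mul_P => rfl
  | comul_P => rfl
  | unit_P => rfl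
  | counit_P => rfl
  | sym_P => rfl
  | sym_OP => rfl

/-- The interpretation of the generated category in games. -/
def semantics : Presented stratTheory ⥤ Games where
  obj X := ofWord X.word
  map {X Y} f := Quotient.lift (s := stratTheory.setoid X.word Y.word)
    (fun t => eval interp t) (fun _ _ h => eval_eqv interp eval_rel h) f
  map_id _ := rfl
  map_comp f g := by
    induction f using Quotient.inductionOn
    induction g using Quotient.inductionOn
    rfl

theorem semantics_tens {A B C D : List Polarity} (f : Mor A B) (g : Mor C D) :
    semantics.map (tensMor f g) = (ofWordAppend A C).inv ≫
      (semantics.map f ⊗ₘ semantics.map g) ≫ (ofWordAppend B D).hom := by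
  induction f using Quotient.inductionOn
  induction g using Quotient.inductionOn
  rfl

theorem isStructural_semantics_eqToHom {X Y : Presented stratTheory} (h : X = Y) :
    IsStructural (semantics.map (eqToHom h)) := by
  subst h
  exact .id _

instance : semantics.Monoidal :=
  Functor.CoreMonoidal.toMonoidal
    { εIso := Iso.refl _
      μIso := fun X Y => ofWordAppend X.word Y.word
      μIso_hom_natural_left := by
        intro X Y f Z
        have := semantics_tens f (𝟙 Z)
        erw [this, Iso.hom_inv_id_assoc, semantics.map_id, tensorHom_id]
        rfl
      μIso_hom_natural_right := by
        intro X Y Z f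
        have := semantics_tens (𝟙 Z) f
        erw [this, Iso.hom_inv_id_assoc, semantics.map_id, id_tensorHom]
        rfl
      associativity := fun X Y Z => IsStructural.eq
        (((ofWordAppend_hom _ _).whiskerRight _).comp
          ((ofWordAppend_hom _ _).comp (isStructural_semantics_eqToHom
            (congrArg Presented.mk (List.append_assoc X.word Y.word Z.word)))))
        (.comp (IsStructural.associator _ _ _).1
          (((ofWordAppend_hom _ _).whiskerLeft _).comp (ofWordAppend_hom _ _)))
      left_unitality := fun X => IsStructural.eq (IsStructural.leftUnitor _).1
        (((IsStructural.id _).whiskerRight _).comp ((ofWordAppend_hom _ _).comp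
          (isStructural_semantics_eqToHom rfl)))
      right_unitality := fun X => IsStructural.eq (IsStructural.rightUnitor _).1
        (((IsStructural.id _).whiskerLeft _).comp ((ofWordAppend_hom _ _).comp
          (isStructural_semantics_eqToHom (congrArg Presented.mk (List.append_nil X.word))))) }

/-! ### Partial copycats -/

/-- The letters of a word. -/
abbrev Letters (w : List Polarity) : Type := (ofWord w).game.Moves

section

variable {A B C D : Games} {K K' : Type}

/-- The edges between the copies of moves in two games. -/
def CopyEdge (i : K → A.game.Moves) (j : K → B.game.Moves)
    (x y : A.game.Moves ⊕ B.game.Moves) : Prop :=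
  ∃ k, (A.game.pol (i k) = P ∧ x = .inl (i k) ∧ y = .inr (j k)) ∨
    (A.game.pol (i k) = O ∧ x = .inr (j k) ∧ y = .inl (i k))

/-- The relation of `f` consists of the copy edges along `i` and `j` and of the edges `E`. -/
def HasRel (f : A ⟶ B) (i : K → A.game.Moves) (j : K → B.game.Moves)
    (E : A.game.Moves ⊕ B.game.Moves → A.game.Moves ⊕ B.game.Moves → Prop) : Prop :=
  ∀ x y, rel f x y ↔ x = y ∨ CopyEdge i j x y ∨ E x y

variable {f : A ⟶ B} {g : C ⟶ D} {i : K → A.game.Moves} {j : K → B.game.Moves}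
  {i' : K' → C.game.Moves} {j' : K' → D.game.Moves}
  {E : A.game.Moves ⊕ B.game.Moves → A.game.Moves ⊕ B.game.Moves → Prop}
  {E' : C.game.Moves ⊕ D.game.Moves → C.game.Moves ⊕ D.game.Moves → Prop}

namespace HasRel

theorem id (A : Games) : HasRel (𝟙 A) (fun a => a) (fun a => a) fun _ _ => False := by
  rintro (a | b) (a' | b')
  · refine (show _ ↔ a = a' from Iff.rfl).trans ?_
    simp [CopyEdge]
  · refine (show _ ↔ a = b' ∧ A.game.pol a = P from Iff.rfl).trans ?_
    simp only [CopyEdge, reduceCtorEq, Sum.inl.injEq, Sum.inr.injEq, and_false,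
      or_false, false_or]
    exact ⟨fun h => ⟨a, h.2, rfl, h.1.symm⟩, fun ⟨k, h₁, h₂, h₃⟩ =>
      ⟨h₂.trans h₃.symm, h₂ ▸ h₁⟩⟩
  · refine (show _ ↔ a' = b ∧ A.game.pol a' = O from Iff.rfl).trans ?_
    simp only [CopyEdge, reduceCtorEq, Sum.inl.injEq, Sum.inr.injEq, and_false,
      or_false, false_or]
    exact ⟨fun h => ⟨a', h.2, h.1.symm, rfl⟩, fun ⟨k, h₁, h₂, h₃⟩ =>
      ⟨h₃.trans h₂.symm, h₃ ▸ h₁⟩⟩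
  · refine (show _ ↔ b = b' from Iff.rfl).trans ?_
    simp [CopyEdge]

theorem tensor (hf : HasRel f i j E) (hg : HasRel g i' j' E') :
    HasRel (A := before A C) (B := before B D) (f ⊗ₘ g) (Sum.map i i') (Sum.map j j') fun x y =>
      Sum.LiftRel E E' (shuffle x) (shuffle y) := by
  intro x y
  refine (show _ ↔ Sum.LiftRel (rel f) (rel g) (shuffle x) (shuffle y) from Iff.rfl).trans ?_
  rcases x with (a | c) | (b | d) <;> rcases y with (a' | c') | (b' | d') <;>
    simp [shuffle, CopyEdge, hf _ _, hg _ _]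

theorem comp_isCopy (hf : HasRel f i j E) {C : Games} {g : B ⟶ C}
    {e : B.game.Moves ≃ C.game.Moves} (hg : IsCopy g e) :
    HasRel (f ≫ g) i (e ∘ j) fun x y => E (Sum.map _root_.id e.symm x) (Sum.map _root_.id e.symm y) := by
  intro x y
  rw [rel_comp_isCopy f hg, hf]
  rcases x with a | c <;> rcases y with a' | c' <;> simp [CopyEdge, Equiv.symm_apply_eq]

theorem isCopy_comp (hf : HasRel f i j E) {C : Games} {g : C ⟶ A}
    {e : C.game.Moves ≃ A.game.Moves} (hg : IsCopy g e) :
    HasRel (g ≫ f) (e.symm ∘ i) j fun x y => E (Sum.map e _root_.id x) (Sum.map e _root_.id y) := by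
  intro x y
  have he : ∀ a, C.game.pol (e.symm a) = A.game.pol a := fun a => by
    rw [← hg.choose, e.apply_symm_apply]
  rw [rel_isCopy_comp hg, hf]
  rcases x with a | c <;> rcases y with a' | c' <;> simp [CopyEdge, Equiv.eq_symm_apply, he]

theorem congr (hf : HasRel f i j E) {i₁ : K' → A.game.Moves} {j₁ : K' → B.game.Moves}
    {E₁ : A.game.Moves ⊕ B.game.Moves → A.game.Moves ⊕ B.game.Moves → Prop} (u : K' ≃ K)
    (hi : ∀ k, i₁ k = i (u k)) (hj : ∀ k, j₁ k = j (u k)) (hE : ∀ x y, E x y ↔ E₁ x y) :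
    HasRel f i₁ j₁ E₁ := by
  intro x y
  rw [hf x y, ← hE x y]
  simp only [CopyEdge, hi, hj]
  rw [u.exists_congr_left]
  simp

theorem copy_P (hf : HasRel f i j E) (k : K) (hk : A.game.pol (i k) = P) :
    rel f (.inl (i k)) (.inr (j k)) :=
  (hf _ _).2 (.inr (.inl ⟨k, .inl ⟨hk, rfl, rfl⟩⟩))

theorem copy_O (hf : HasRel f i j E) (k : K) (hk : A.game.pol (i k) = O) :
    rel f (.inr (j k)) (.inl (i k)) :=
  (hf _ _).2 (.inr (.inl ⟨k, .inr ⟨hk, rfl, rfl⟩⟩))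

theorem edge (hf : HasRel f i j E) {x y : A.game.Moves ⊕ B.game.Moves} (h : E x y) : rel f x y :=
  (hf _ _).2 (.inr (.inr h))

/-- Supplies the hypotheses of `rel_comp_le`: if `s` identifies the two ends of every copied letter,
only the extra edges need checking. -/
theorem retract (hf : HasRel f i j E) {β : Type} {T : β → β → Prop} (hT : ∀ x, T x x)
    (s : A.game.Moves ⊕ B.game.Moves → β) (hs : ∀ k, s (.inl (i k)) = s (.inr (j k)))
    (hE : ∀ x y, E x y → T (s x) (s y)) (x y : A.game.Moves ⊕ B.game.Moves) (h : rel f x y) :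
    T (s x) (s y) := by
  rcases (hf x y).1 h with rfl | ⟨k, ⟨-, rfl, rfl⟩ | ⟨-, rfl, rfl⟩⟩ | h
  · exact hT _
  · rw [hs]
    exact hT _
  · rw [hs]
    exact hT _
  · exact hE _ _ h

theorem isCopy {f : A ⟶ B} (e : A.game.Moves ≃ B.game.Moves)
    (he : ∀ a, B.game.pol (e a) = A.game.pol a) (hf : HasRel f (fun a => a) e fun _ _ => False) :
    IsCopy f e := by
  refine ⟨he, CyclicStrategy.ext (funext fun x => funext fun y => propext ?_)⟩
  refine (hf x y).trans ?_
  simp only [CopyEdge]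
  rcases x with x | x <;> rcases y with y | y <;> simp only [copycat, copyRel, Sum.inl.injEq,
    Sum.inr.injEq, reduceCtorEq, false_and, and_false, or_false, false_or, exists_false]
  · exact ⟨fun ⟨k, h₁, h₂, h₃⟩ => ⟨by rw [h₂, h₃], h₂ ▸ h₁⟩,
      fun ⟨h₁, h₂⟩ => ⟨x, h₂, rfl, h₁.symm⟩⟩
  · exact ⟨fun ⟨k, h₁, h₂, h₃⟩ => ⟨by rw [h₂, h₃], h₃ ▸ h₁⟩,
      fun ⟨h₁, h₂⟩ => ⟨y, h₂, h₁.symm, rfl⟩⟩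

end HasRel

end

/-- The interpretation of a morphism of the generated category. -/
def sem {A B : List Polarity} (f : Mor A B) : ofWord A ⟶ ofWord B := semantics.map f

theorem sem_comp {A B C : List Polarity} (f : Mor A B) (g : Mor B C) :
    sem (f ≫ g) = sem f ≫ sem g := semantics.map_comp f g

/-- The word `[a]` denotes `atom a` before the empty game rather than `atom a`, hence the comparison
move by move. -/
theorem sem_lw (a : Polarity) {A B : List Polarity} (f : Mor A B) :
    sem (lw a f) = atom a ◁ sem f := by
  induction f using Quotient.inductionOn with | _ f
  refine hom_ext_of_rel fun x y => (rel_eval_tensor interp (wire [a]) f x y).trans ?_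
  refine Iff.trans ?_ (beforeHom_rel _ _ _ _).symm
  rcases x with (_ | x) | (_ | x) <;> rcases y with (_ | y) | (_ | y)
  · exact iff_of_true (.inl rfl) (.inl rfl)
  · exact iff_of_false (by rintro ⟨⟩) (by rintro ⟨⟩)
  · exact Sum.liftRel_inl_inl.trans (Iff.trans (by exact ⟨fun h => ⟨rfl, h.2⟩, fun h => ⟨rfl, h.2⟩⟩)
      Sum.liftRel_inl_inl.symm)
  · exact iff_of_false (by rintro ⟨⟩) (by rintro ⟨⟩)
  · exact iff_of_false (by rintro ⟨⟩) (by rintro ⟨⟩)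
  · exact Sum.liftRel_inr_inr.trans Sum.liftRel_inr_inr.symm
  · exact iff_of_false (by rintro ⟨⟩) (by rintro ⟨⟩)
  · exact Sum.liftRel_inr_inr.trans Sum.liftRel_inr_inr.symm
  · exact Sum.liftRel_inl_inl.trans (Iff.trans (by exact ⟨fun h => ⟨rfl, h.2⟩, fun h => ⟨rfl, h.2⟩⟩)
      Sum.liftRel_inl_inl.symm)
  · exact iff_of_false (by rintro ⟨⟩) (by rintro ⟨⟩)
  · exact iff_of_true (.inl rfl) (.inl rfl)
  · exact iff_of_false (by rintro ⟨⟩) (by rintro ⟨⟩)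
  · exact iff_of_false (by rintro ⟨⟩) (by rintro ⟨⟩)
  · exact Sum.liftRel_inr_inr.trans Sum.liftRel_inr_inr.symm
  · exact iff_of_false (by rintro ⟨⟩) (by rintro ⟨⟩)
  · exact Sum.liftRel_inr_inr.trans Sum.liftRel_inr_inr.symm

theorem liftRel_shuffle_left {α β γ δ : Type} (E : α ⊕ β → α ⊕ β → Prop)
    (x y : (α ⊕ γ) ⊕ (β ⊕ δ)) :
    Sum.LiftRel E (fun _ _ => False) (shuffle x) (shuffle y) ↔
      ∃ u v, E u v ∧ x = Sum.map Sum.inl Sum.inl u ∧ y = Sum.map Sum.inl Sum.inl v := by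
  rcases x with (a | c) | (b | d) <;> rcases y with (a' | c') | (b' | d') <;> simp [shuffle]

theorem liftRel_shuffle_right {α β γ δ : Type} (E : γ ⊕ δ → γ ⊕ δ → Prop)
    (x y : (α ⊕ γ) ⊕ (β ⊕ δ)) :
    Sum.LiftRel (fun _ _ => False) E (shuffle x) (shuffle y) ↔
      ∃ u v, E u v ∧ x = Sum.map Sum.inr Sum.inr u ∧ y = Sum.map Sum.inr Sum.inr v := by
  rcases x with (a | c) | (b | d) <;> rcases y with (a' | c') | (b' | d') <;> simp [shuffle]

theorem HasRel.rwk {A B : List Polarity} {t : Term stratSig A B} {K : Type} {i : K → Letters A}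
    {j : K → Letters B} {E : Letters A ⊕ Letters B → Letters A ⊕ Letters B → Prop}
    (ht : HasRel (eval interp t) i j E) (Y : List Polarity) :
    HasRel (sem (rwk (ofT t) Y)) (appendEquiv A Y ∘ Sum.map i fun y => y)
      (appendEquiv B Y ∘ Sum.map j fun y => y) fun x y => ∃ u v, E u v ∧
        x = Sum.map (appendEquiv A Y ∘ Sum.inl) (appendEquiv B Y ∘ Sum.inl) u ∧
        y = Sum.map (appendEquiv A Y ∘ Sum.inl) (appendEquiv B Y ∘ Sum.inl) v := by
  have := ((ht.tensor (HasRel.id (ofWord Y))).comp_isCopy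
    (isCopy_ofWordAppend_hom B Y)).isCopy_comp (isCopy_ofWordAppend_inv A Y)
  refine this.congr (Equiv.refl _) (fun _ => rfl) (fun _ => rfl) fun x y => ?_
  have key : ∀ (x : Letters (A ++ Y) ⊕ Letters (B ++ Y)) (u : Letters A ⊕ Letters B),
      Sum.map _root_.id (appendEquiv B Y).symm (Sum.map (appendEquiv A Y).symm _root_.id x) =
        Sum.map Sum.inl Sum.inl u ↔
      x = Sum.map (appendEquiv A Y ∘ Sum.inl) (appendEquiv B Y ∘ Sum.inl) u := by
    rintro (x | x) (u | u) <;> simp [Equiv.symm_apply_eq]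
  refine (liftRel_shuffle_left E _ _).trans ?_
  exact exists_congr fun u => exists_congr fun v =>
    and_congr Iff.rfl (and_congr (key x u) (key y v))

theorem HasRel.lw (a : Polarity) {A B : List Polarity} {f : Mor A B} {K : Type}
    {i : K → Letters A} {j : K → Letters B}
    {E : Letters A ⊕ Letters B → Letters A ⊕ Letters B → Prop}
    (hf : HasRel (sem f) i j E) :
    HasRel (sem (Causality.lw a f)) (Sum.map (fun u : Unit => u) i)
      (Sum.map (fun u : Unit => u) j) fun x y => ∃ u v, E u v ∧
        x = Sum.map Sum.inr Sum.inr u ∧ y = Sum.map Sum.inr Sum.inr v := by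
  rw [sem_lw, ← id_tensorHom]
  exact ((HasRel.id (atom a)).tensor hf).congr (Equiv.refl _) (fun _ => rfl) (fun _ => rfl)
    fun x y => liftRel_shuffle_right E x y

/-! ### The relations of the whiskered generators -/

theorem hasRel_causal {A B : Games} (E : A.game.Moves ⊕ B.game.Moves →
    A.game.Moves ⊕ B.game.Moves → Prop)
    (hE : ∀ x y, E x y ↔ (A.game.arrow B.game).order.le x y ∧ (A.game.arrow B.game).pol x = O ∧
      (A.game.arrow B.game).pol y = P) :
    HasRel (causal A B) (Empty.elim : Empty → A.game.Moves) (Empty.elim : Empty → B.game.Moves)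
      E := by
  intro x y
  refine (show _ ↔ x = y ∨ ((A.game.arrow B.game).order.le x y ∧
    (A.game.arrow B.game).pol x = O ∧ (A.game.arrow B.game).pol y = P) from Iff.rfl).trans ?_
  simp [CopyEdge, hE]

theorem hasRel_eps (Y : List Polarity) :
    HasRel (sem (eps Y)) (Sum.inr : Letters Y → Letters (O :: Y))
      (fun y : Letters Y => y) fun _ _ => False := by
  have h : HasRel (eval interp εO) (Empty.elim : Empty → Letters [O])
      (Empty.elim : Empty → Letters []) fun _ _ => False := by
    refine hasRel_causal _ ?_
    rintro ((_ | x) | x) ((_ | y) | y) <;> first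
      | exact x.elim
      | exact y.elim
      | exact iff_of_false (fun h => h) (fun h => absurd h.2.1 (by simp [Polarity.neg]))
  exact (h.rwk Y).congr (Equiv.emptySum _ _).symm (fun _ => rfl) (fun _ => rfl) fun x y =>
    iff_of_false (fun ⟨_, _, h, _⟩ => h) fun h => h

theorem hasRel_eta (Y : List Polarity) :
    HasRel (sem (eta Y)) (fun y : Letters Y => y)
      (Sum.inr : Letters Y → Letters (O :: Y)) fun _ _ => False := by
  have h : HasRel (eval interp ηO) (Empty.elim : Empty → Letters [])
      (Empty.elim : Empty → Letters [O]) fun _ _ => False := by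
    refine hasRel_causal _ ?_
    rintro (x | (_ | x)) (y | (_ | y)) <;> first
      | exact x.elim
      | exact y.elim
      | exact iff_of_false (fun h => h) (fun h => absurd h.2.2 (by simp))
  exact (h.rwk Y).congr (Equiv.emptySum _ _).symm (fun _ => rfl) (fun _ => rfl) fun x y =>
    iff_of_false (fun ⟨_, _, h, _⟩ => h) fun h => h

theorem hasRel_etaOP (Y : List Polarity) :
    HasRel (sem (etaOP Y)) (fun y : Letters Y => y)
      (fun y : Letters Y => (.inr (.inr y) : Letters (O :: P :: Y))) fun x y =>
        x = .inr (.inl ()) ∧ y = .inr (.inr (.inl ())) := by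
  have h : HasRel (eval interp ηOP) (Empty.elim : Empty → Letters [])
      (Empty.elim : Empty → Letters [O, P]) fun x y =>
        x = .inr (.inl ()) ∧ y = .inr (.inr (.inl ())) := by
    refine hasRel_causal _ ?_
    rintro (x | (_ | (_ | x))) (y | (_ | (_ | y))) <;> first
      | exact x.elim
      | exact y.elim
      | exact iff_of_true ⟨rfl, rfl⟩ ⟨arrow_le_inr.2 (.sep _ _), rfl, rfl⟩
      | exact iff_of_false (by simp) (by simp)
  refine (h.rwk Y).congr (Equiv.emptySum _ _).symm (fun _ => rfl) (fun _ => rfl) fun x y => ?_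
  exact ⟨fun ⟨_, _, ⟨hu, hv⟩, hx, hy⟩ => ⟨by rw [hx, hu]; rfl, by rw [hy, hv]; rfl⟩,
    fun ⟨hx, hy⟩ => ⟨_, _, ⟨rfl, rfl⟩, hx, hy⟩⟩

theorem hasRel_epsOP (Y : List Polarity) :
    HasRel (sem (epsOP Y)) (fun y : Letters Y => (.inr (.inr y) : Letters (P :: O :: Y)))
      (fun y : Letters Y => y) fun x y => x = .inl (.inl ()) ∧ y = .inl (.inr (.inl ())) := by
  have h : HasRel (eval interp εOP) (Empty.elim : Empty → Letters [P, O])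
      (Empty.elim : Empty → Letters []) fun x y =>
        x = .inl (.inl ()) ∧ y = .inl (.inr (.inl ())) := by
    refine hasRel_causal _ ?_
    rintro ((_ | (_ | x)) | x) ((_ | (_ | y)) | y) <;> first
      | exact x.elim
      | exact y.elim
      | exact iff_of_true ⟨rfl, rfl⟩ ⟨arrow_le_inl.2 (.sep _ _), rfl, rfl⟩
      | exact iff_of_false (by simp) (by simp [Polarity.neg])
  refine (h.rwk Y).congr (Equiv.emptySum _ _).symm (fun _ => rfl) (fun _ => rfl) fun x y => ?_
  exact ⟨fun ⟨_, _, ⟨hu, hv⟩, hx, hy⟩ => ⟨by rw [hx, hu]; rfl, by rw [hy, hv]; rfl⟩,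
    fun ⟨hx, hy⟩ => ⟨_, _, ⟨rfl, rfl⟩, hx, hy⟩⟩

/-- Exchange of the first two letters. -/
def swapEquiv (Y : List Polarity) : Letters (O :: O :: Y) ≃ Letters (O :: O :: Y) where
  toFun
    | .inl u => .inr (.inl u)
    | .inr (.inl u) => .inl u
    | .inr (.inr y) => .inr (.inr y)
  invFun
    | .inl u => .inr (.inl u)
    | .inr (.inl u) => .inl u
    | .inr (.inr y) => .inr (.inr y)
  left_inv := by rintro (_ | _ | _) <;> rfl
  right_inv := by rintro (_ | _ | _) <;> rfl

/-- Exchange of two letters, where moreover the first letter may be added to the second. -/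
def crossTerm : Bool → Term stratSig [O, O] [O, O]
  | false => γO
  | true => (δO.tensor (wire [O])).comp (((wire [O]).tensor γO).comp (μO.tensor (wire [O])))

def cross (b : Bool) (Y : List Polarity) : Mor (O :: O :: Y) (O :: O :: Y) :=
  rwk (ofT (crossTerm b)) Y

/-- For an empty tail this is read off the Boolean matrix of `crossTerm b`; whiskering then only
adds copied letters. -/
theorem hasRel_cross (b : Bool) (Y : List Polarity) :
    HasRel (sem (cross b Y)) (swapEquiv Y) (fun y => y) fun x y =>
      b ∧ x = .inr (.inl ()) ∧ y = .inl (.inl ()) := by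
  have h : HasRel (eval interp (crossTerm b)) (swapEquiv []) (fun y => y) fun x y =>
      b ∧ x = .inr (.inl ()) ∧ y = .inl (.inl ()) := by
    have hb : opponent (crossTerm b) := by cases b <;> rfl
    intro x y
    by_cases hxy : x = y
    · subst hxy
      exact iff_of_true (CyclicStrategy.refl _ _) (.inl rfl)
    · by_cases hx : ∃ d a, x = .inr d ∧ y = .inl a
      · obtain ⟨d, a, rfl, rfl⟩ := hx
        have hc : CopyEdge (A := ofWord [O, O]) (B := ofWord [O, O]) (swapEquiv [])
            (fun y => y) (.inr d) (.inl a) ↔ a = swapEquiv [] d := by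
          constructor
          · rintro ⟨k, ⟨-, h, -⟩ | ⟨-, h₁, h₂⟩⟩
            · exact absurd h (by simp)
            · rw [Sum.inr.inj h₁, Sum.inl.inj h₂]
          · rintro rfl
            exact ⟨d, .inr ⟨pol_of_allO (w := [O, O]) rfl _, rfl, rfl⟩⟩
        rw [rel_eval_opponent hb, hc]
        rcases d with _ | _ | d <;> rcases a with _ | _ | a <;> first
          | exact d.elim
          | exact a.elim
          | cases b <;> simp [pos, swapEquiv] <;> decide
      · refine iff_of_false (fun hr => hx (rel_of_allO rfl rfl _ hr hxy)) ?_
        rintro (h | ⟨k, ⟨hk, -⟩ | ⟨-, h⟩⟩ | ⟨-, h⟩)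
        · exact hxy h
        · exact absurd (pol_of_allO (w := [O, O]) rfl _) (by rw [hk]; simp)
        · exact hx ⟨_, _, h⟩
        · exact hx ⟨_, _, h⟩
  refine (h.rwk Y).congr (appendEquiv [O, O] Y).symm ?_ ?_ fun x y => ?_
  · rintro (_ | _ | _) <;> rfl
  · rintro (_ | _ | _) <;> rfl
  · exact ⟨fun ⟨_, _, ⟨hb, hu, hv⟩, hx, hy⟩ => ⟨hb, by rw [hx, hu]; rfl, by rw [hy, hv]; rfl⟩,
      fun ⟨hb, hx, hy⟩ => ⟨_, _, ⟨hb, rfl, rfl⟩, hx, hy⟩⟩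

theorem isCopy_gam (Y : List Polarity) : IsCopy (sem (gam Y)) (swapEquiv Y) := by
  refine HasRel.isCopy _ (by rintro (_ | _ | _) <;> rfl)
    ((hasRel_cross false Y).congr (swapEquiv Y) ?_ (fun _ => rfl) fun x y => ?_)
  · rintro (_ | _ | _) <;> rfl
  · exact iff_of_false (fun h => absurd h.1 (by simp)) fun h => h

/-! ### Faithfulness -/

theorem semantics_faithful : semantics.Faithful where
  map_injective {X Y} f g h := by
    refine faithful_of_separates semantics ?_ ?_ ?_ 0 X.word Y.word f g h
    · intro a A B f g h
      have h' : sem f = sem g := h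
      exact (sem_lw a f).trans ((congrArg _ h').trans (sem_lw a g).symm)
    · intro h
      have h' : rel (sem (eps []) ≫ sem (eta [])) (.inr (.inl ())) (.inl (.inl ())) := by
        have : 𝟙 (ofWord [O]) = sem (eps []) ≫ sem (eta []) :=
          h.trans (semantics.map_comp (eps []) (eta []))
        rw [← this]
        exact ⟨rfl, rfl⟩
      -- The composite factors through the empty game, hence relates no distinct moves, unlike the
      -- identity.
      have := rel_comp_le (sem (eps [])) (sem (eta [])) (T := Eq) (fun _ _ _ => Eq.trans)
        (fun x => x.elim) ((hasRel_eps []).retract (fun _ => rfl) _ (fun k => k.elim)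
          fun _ _ h => h.elim)
        ((hasRel_eta []).retract (fun _ => rfl) _ (fun k => k.elim) fun _ _ h => h.elim) h'
      simp at this
    · intro h
      let f := sem (etaOP [] ≫ eps [P])
      have h' : rel (f ≫ sem (eta [P])) (.inr (.inl ())) (.inr (.inr (.inl ()))) := by
        have : sem (etaOP []) = f ≫ sem (eta [P]) := by
          rw [← sem_comp, Category.assoc]
          exact h
        rw [← this]
        exact (hasRel_etaOP []).edge ⟨rfl, rfl⟩
      -- Identifying the intermediate P with the output P collapses every edge: a freshly inserted O
      -- is related to nothing.
      have := rel_comp_le f (sem (eta [P])) (T := Eq) (fun _ _ _ => Eq.trans)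
        (fun x => .inr (.inr x)) (by
          rintro (x | (_ | x)) (y | (_ | y)) _ <;> first
            | exact x.elim
            | exact y.elim
            | rfl)
        ((hasRel_eta [P]).retract (fun _ => rfl) _ (fun _ => rfl) fun _ _ h => h.elim) h'
      simp at this

/-! ### Fullness -/

section

variable {A B : List Polarity}

theorem rel_lw_map (a : Polarity) {f : Mor A B} {x y : Letters A ⊕ Letters B}
    (h : rel (sem f) x y) :
    rel (sem (lw a f)) (Sum.map Sum.inr Sum.inr x) (Sum.map Sum.inr Sum.inr y) := by
  rw [sem_lw]
  rcases x with x | x <;> rcases y with y | y <;> exact Sum.LiftRel.inr h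

theorem rel_lw_O (f : Mor A B) : rel (sem (lw O f)) (.inr (.inl ())) (.inl (.inl ())) := by
  rw [sem_lw]
  exact Sum.LiftRel.inl ⟨rfl, rfl⟩

theorem rel_lw_P (f : Mor A B) : rel (sem (lw P f)) (.inl (.inl ())) (.inr (.inl ())) := by
  rw [sem_lw]
  exact Sum.LiftRel.inl ⟨rfl, rfl⟩

theorem rel_lw_retract {a : Polarity} {f : Mor A B} {β : Type} {T : β → β → Prop}
    (hT : ∀ x, T x x) (s : Letters (a :: A) ⊕ Letters (a :: B) → β)
    (hs : s (.inl (.inl ())) = s (.inr (.inl ())))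
    (hf : ∀ x y, rel (sem f) x y →
      T (s (Sum.map Sum.inr Sum.inr x)) (s (Sum.map Sum.inr Sum.inr y)))
    (x y : Letters (a :: A) ⊕ Letters (a :: B)) (h : rel (sem (lw a f)) x y) :
    T (s x) (s y) := by
  rw [sem_lw] at h
  change Sum.LiftRel (rel (𝟙 (atom a))) (rel (sem f)) (shuffle x) (shuffle y) at h
  rcases x with (_ | x) | (_ | x) <;> rcases y with (_ | y) | (_ | y) <;>
    simp only [shuffle, Sum.liftRel_inl_inl, Sum.liftRel_inr_inr, Sum.not_liftRel_inl_inr,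
      Sum.not_liftRel_inr_inl] at h
  · exact hT _
  · rw [hs]
    exact hT _
  · exact hf _ _ h
  · exact hf _ _ h
  · rw [hs]
    exact hT _
  · exact hT _
  · exact hf _ _ h
  · exact hf _ _ h

theorem eq_of_rel {f : ofWord A ⟶ ofWord B}
    {σ : CyclicStrategy ((ofWord A).game.arrow (ofWord B).game)}
    (h₁ : ∀ x y, rel f x y → σ.rel x y) (h₂ : ∀ x y, σ.rel x y → x ≠ y → rel f x y) : f.1 = σ := by
  refine CyclicStrategy.ext (funext fun x => funext fun y => propext ⟨h₁ x y, fun h => ?_⟩)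
  by_cases hxy : x = y
  · subst hxy
    exact CyclicStrategy.refl _ _
  · exact h₂ x y h hxy

theorem rel_comp_of_path {A B C : Games} {f : A ⟶ B} {g : B ⟶ C}
    {x y : A.game.Moves ⊕ C.game.Moves} {u v : A.game.Moves ⊕ B.game.Moves ⊕ C.game.Moves}
    (h₁ : Relation.ReflTransGen (Interaction f.1 g.1) (Sum.map id Sum.inr x) u) (h₂ : Path f g u v)
    (h₃ : Relation.ReflTransGen (Interaction f.1 g.1) v (Sum.map id Sum.inr y)) :
    rel (f ≫ g) x y :=
  (Relation.TransGen.trans_right h₁ h₂).trans_left h₃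

/-- Transposition of the first letter of the source. -/
def transposeMap (A W : List Polarity) :
    Letters A ⊕ Letters (O :: W) → Letters (P :: A) ⊕ Letters W
  | .inl a => .inl (.inr a)
  | .inr (.inl u) => .inl (.inl u)
  | .inr (.inr w) => .inr w

/-- The upper bound retracts both ends of the counit onto the leading P of the source; the lower
bound extends each edge of `f` by copies, and through the counit when it starts at that letter. -/
theorem sem_transpose {W : List Polarity}
    (σ : CyclicStrategy ((ofWord (P :: A)).game.arrow (ofWord W).game)) (f : Mor A (O :: W))
    (hf : ∀ x y, rel (sem f) x y ↔ σ.rel (transposeMap A W x) (transposeMap A W y)) :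
    (sem (lw P f ≫ epsOP W)).1 = σ := by
  rw [sem_comp]
  refine eq_of_rel (fun x y h => ?_) fun x y h hxy => ?_
  · let r : Letters (P :: O :: W) → Letters (P :: A) ⊕ Letters W := fun u => match u with
      | .inl u => .inl (.inl u)
      | .inr (.inl u) => .inl (.inl u)
      | .inr (.inr w) => .inr w
    refine rel_comp_le _ _ σ.trans r
      (rel_lw_retract σ.refl _ rfl ?_)
      ((hasRel_epsOP W).retract σ.refl _ (fun _ => rfl) ?_) h
    · intro x y h
      have := (hf x y).1 h
      rcases x with x | (_ | x) <;> rcases y with y | (_ | y) <;> exact this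
    · rintro _ _ ⟨rfl, rfl⟩
      exact σ.refl _
  · obtain ⟨hx, hy⟩ := σ.polarity x y h hxy
    have hsurj : ∀ z, ∃ u, transposeMap A W u = z := by
      rintro ((z | z) | z)
      exacts [⟨.inr (.inl z), rfl⟩, ⟨.inl z, rfl⟩, ⟨.inr (.inr z), rfl⟩]
    obtain ⟨x, rfl⟩ := hsurj x
    obtain ⟨y, rfl⟩ := hsurj y
    have hl := Path.left (sem (epsOP W)) (rel_lw_map P ((hf x y).2 h))
    have he := hasRel_epsOP W
    refine rel_comp_of_path ?_ hl ?_
    · rcases x with x | (_ | x)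
      · exact .refl
      · exact ((Path.left _ (rel_lw_P f)).trans (Path.right _ (he.edge ⟨rfl, rfl⟩))).to_reflTransGen
      · exact (Path.right _ (he.copy_O x hx)).to_reflTransGen
    · rcases y with y | (_ | y)
      · exact .refl
      · exact absurd hy (by simp [transposeMap, Polarity.neg])
      · exact (Path.right _ (he.copy_P y hy)).to_reflTransGen

/-- The edges into the leading source letter are carried by `k`, all others by `f`. By `hσ` the
former all start in the target, where `k` can supply them. -/
theorem sem_readO {W : List Polarity}
    (σ : CyclicStrategy ((ofWord (O :: A)).game.arrow (ofWord W).game)) (f : Mor A W)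
    (hf : ∀ x y, rel (sem f) x y ↔ σ.rel (Sum.map Sum.inr id x) (Sum.map Sum.inr id y))
    (k : Mor (O :: W) W) (hk : HasRel (sem k) (Sum.inr : Letters W → Letters (O :: W))
      (fun w : Letters W => w) fun x y =>
        ∃ m, σ.rel (.inr m) (.inl (.inl ())) ∧ x = .inr m ∧ y = .inl (.inl ()))
    (hσ : ∀ x, σ.rel x (.inl (.inl ())) → x ≠ .inl (.inl ()) → ∃ m, x = .inr m) :
    (sem (lw O f ≫ k)).1 = σ := by
  rw [sem_comp]
  refine eq_of_rel (fun x y h => ?_) fun x y h hxy => ?_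
  · let r : Letters (O :: W) → Letters (O :: A) ⊕ Letters W := fun u => match u with
      | .inl u => .inl (.inl u)
      | .inr w => .inr w
    refine rel_comp_le _ _ σ.trans r (rel_lw_retract σ.refl _ rfl ?_)
      (hk.retract σ.refl _ (fun _ => rfl) ?_) h
    · intro x y h
      have := (hf x y).1 h
      rcases x with x | x <;> rcases y with y | y <;> exact this
    · rintro _ _ ⟨m, h, rfl, rfl⟩
      exact h
  · obtain ⟨hx, hy⟩ := σ.polarity x y h hxy
    by_cases hy' : y = .inl (.inl ())
    · subst hy'
      obtain ⟨m, rfl⟩ := hσ x h hxy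
      exact (Path.right (sem (lw O f)) (hk.edge ⟨m, h, rfl, rfl⟩)).trans
        (Path.left (sem k) (rel_lw_O f))
    · have hsurj : ∀ z : Letters (O :: A) ⊕ Letters W, z ≠ .inl (.inl ()) →
          ∃ u : Letters A ⊕ Letters W, Sum.map Sum.inr id u = z := by
        rintro ((_ | z) | z) hz
        exacts [absurd rfl hz, ⟨.inl z, rfl⟩, ⟨.inr z, rfl⟩]
      obtain ⟨x, rfl⟩ := hsurj x (by rintro rfl; simp [Polarity.neg] at hx)
      obtain ⟨y, rfl⟩ := hsurj y hy'
      refine rel_comp_of_path ?_ (Path.left (sem k) (rel_lw_map O ((hf x y).2 h))) ?_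
      · rcases x with x | x
        · exact .refl
        · exact (Path.right _ (hk.copy_O x hx)).to_reflTransGen
      · rcases y with y | y
        · exact .refl
        · exact (Path.right _ (hk.copy_P y hy)).to_reflTransGen

/-- `t` inserts the letter `p` together with a new O as its cause, and `k` adds that O to the
letters on which `p` depends. All other edges come from `f`. -/
theorem sem_readP {W W₀ : List Polarity}
    (σ : CyclicStrategy ((ofWord A).game.arrow (ofWord W).game)) (p : Letters W)
    (hp : (ofWord W).game.pol p = P) (ι : Letters W₀ → Letters W)
    (hι : ∀ w, w ≠ p → ∃ u, ι u = w) (hι' : ∀ u, (ofWord W).game.pol (ι u) = (ofWord W₀).game.pol u)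
    (f : Mor A W₀)
    (hf : ∀ x y, rel (sem f) x y ↔ σ.rel (Sum.map id ι x) (Sum.map id ι y))
    (t : Mor W₀ (O :: W)) (ht : HasRel (sem t) (fun w : Letters W₀ => w)
      (fun w => (.inr (ι w) : Letters (O :: W))) fun x y =>
        x = .inr (.inl ()) ∧ y = .inr (.inr p))
    (k : Mor (O :: W) W) (hk : HasRel (sem k) (Sum.inr : Letters W → Letters (O :: W))
      (fun w : Letters W => w) fun x y =>
        ∃ m, (σ.rel (.inr m) (.inr p) ∧ m ≠ p) ∧ x = .inr m ∧ y = .inl (.inl ()))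
    (hσ : ∀ x, σ.rel x (.inr p) → x ≠ .inr p → ∃ m, x = .inr m) :
    (sem ((f ≫ t) ≫ k)).1 = σ := by
  rw [sem_comp, sem_comp]
  let r : Letters A ⊕ Letters (O :: W) → Letters A ⊕ Letters W := fun u => match u with
    | .inl a => .inl a
    | .inr (.inl _) => .inr p
    | .inr (.inr w) => .inr w
  refine eq_of_rel (fun x y h => ?_) fun x y h hxy => ?_
  · refine rel_comp_le _ _ σ.trans (fun u => r (.inr u)) (fun x y h => ?_)
      (hk.retract σ.refl _ (fun _ => rfl) ?_) h
    · have := rel_comp_le (sem f) (sem t) (T := fun x y => σ.rel (r x) (r y))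
        (fun _ _ _ => σ.trans _ _ _) (fun w => .inr (.inr (ι w))) (fun x y h => by
          have := (hf x y).1 h
          rcases x with x | x <;> rcases y with y | y <;> exact this)
        (ht.retract (fun _ => σ.refl _) _ (fun _ => rfl) (by
          rintro _ _ ⟨rfl, rfl⟩
          exact σ.refl _)) h
      rcases x with x | (_ | x) <;> rcases y with y | (_ | y) <;> exact this
    · rintro _ _ ⟨m, ⟨h, -⟩, rfl, rfl⟩
      exact h
  · obtain ⟨hx, hy⟩ := σ.polarity x y h hxy
    by_cases hy' : y = .inr p
    · subst hy'
      obtain ⟨m, rfl⟩ := hσ x h hxy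
      have h₁ : rel (sem f ≫ sem t) (.inr (.inl ())) (.inr (.inr p)) :=
        Path.right _ (ht.edge ⟨rfl, rfl⟩)
      exact ((Path.right (sem f ≫ sem t) (hk.edge
        ⟨m, ⟨h, fun e => hxy (congrArg Sum.inr e)⟩, rfl, rfl⟩)).trans
        (Path.left (sem k) h₁)).trans (Path.right _ (hk.copy_P p hp))
    · have hsurj : ∀ z : Letters A ⊕ Letters W, z ≠ .inr p →
          ∃ u : Letters A ⊕ Letters W₀, Sum.map id ι u = z := by
        rintro (z | z) hz
        · exact ⟨.inl z, rfl⟩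
        · obtain ⟨u, rfl⟩ := hι z fun h => hz (by rw [h])
          exact ⟨.inr u, rfl⟩
      obtain ⟨x, rfl⟩ := hsurj x (by rintro rfl; simp [hp] at hx)
      obtain ⟨y, rfl⟩ := hsurj y hy'
      have h₁ : rel (sem f ≫ sem t) (Sum.map id (Sum.inr ∘ ι) x) (Sum.map id (Sum.inr ∘ ι) y) := by
        refine rel_comp_of_path ?_ (Path.left (sem t) ((hf x y).2 h)) ?_
        · rcases x with x | x
          · exact .refl
          · exact (Path.right _ (ht.copy_O x ((hι' x).symm.trans hx))).to_reflTransGen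
        · rcases y with y | y
          · exact .refl
          · exact (Path.right _ (ht.copy_P y ((hι' y).symm.trans hy))).to_reflTransGen
      refine rel_comp_of_path ?_ (Path.left (sem k) h₁) ?_
      · rcases x with x | x
        · exact .refl
        · exact (Path.right _ (hk.copy_O (ι x) hx)).to_reflTransGen
      · rcases y with y | y
        · exact .refl
        · exact (Path.right _ (hk.copy_P (ι y) hy)).to_reflTransGen

end

/-- Two edges of `Q` never compose, since the middle move would need both polarities. -/
theorem trans_of_polarity {G : Game} {Q : G.Moves → G.Moves → Prop}
    (hQ : ∀ x y, Q x y → G.pol x = O ∧ G.pol y = P) (x y z : G.Moves) (h : x = y ∨ Q x y)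
    (k : y = z ∨ Q y z) : x = z ∨ Q x z := by
  rcases h with rfl | h
  · exact k
  · rcases k with rfl | k
    · exact .inr h
    · have h₁ := (hQ _ _ h).2
      rw [(hQ _ _ k).1] at h₁
      simp at h₁

theorem pol_of_pos_lt {n : ℕ} {B : List Polarity} (m : Letters (List.replicate n O ++ B))
    (hm : pos m < n) : (ofWord (List.replicate n O ++ B)).game.pol m = O := by
  induction n with
  | zero => simp at hm
  | succ n ih =>
    change Letters (O :: (List.replicate n O ++ B)) at m
    rcases m with _ | m
    · rfl
    · exact ih m (Nat.lt_of_succ_lt_succ hm)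

/-- The inductive step of `exists_add`: the incoming letter crosses the first O, being added to it
if that letter is marked, and `k` adds it to the rest. -/
theorem hasRel_cross_lw {W : List Polarity} (S : Letters (O :: W) → Prop) [Decidable (S (.inl ()))]
    (hS : ∀ m, S m → (ofWord (O :: W)).game.pol m = O) {k : Mor (O :: W) W}
    (hk : HasRel (sem k) (Sum.inr : Letters W → Letters (O :: W)) (fun w : Letters W => w)
      fun x y => ∃ m, S (.inr m) ∧ x = .inr m ∧ y = .inl (.inl ())) :
    HasRel (sem (cross (decide (S (.inl ()))) W ≫ lw O k))
      (Sum.inr : Letters (O :: W) → Letters (O :: O :: W)) (fun w : Letters (O :: W) => w)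
      fun x y => ∃ m, S m ∧ x = .inr m ∧ y = .inl (.inl ()) := by
  rw [sem_comp]
  have hl := hk.lw O
  have hc := hasRel_cross (decide (S (.inl ()))) W
  let i : Letters (O :: W) → Letters (O :: O :: W) := Sum.inr
  let Q : Letters (O :: O :: W) ⊕ Letters (O :: W) → Letters (O :: O :: W) ⊕ Letters (O :: W) →
      Prop := fun x y => CopyEdge (A := ofWord (O :: O :: W)) (B := ofWord (O :: W)) i
        (fun w => w) x y ∨ ∃ m, S m ∧ x = .inr m ∧ y = .inl (.inl ())
  have hQ : ∀ x y, Q x y → ((ofWord (O :: O :: W)).game.arrow (ofWord (O :: W)).game).pol x = O ∧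
      ((ofWord (O :: O :: W)).game.arrow (ofWord (O :: W)).game).pol y = P := by
    rintro _ _ (⟨w, ⟨h, rfl, rfl⟩ | ⟨h, rfl, rfl⟩⟩ | ⟨m, hm, rfl, rfl⟩)
    · exact ⟨congrArg Polarity.neg h, h⟩
    · exact ⟨h, congrArg Polarity.neg h⟩
    · exact ⟨hS m hm, rfl⟩
  let r : Letters (O :: O :: W) → Letters (O :: O :: W) ⊕ Letters (O :: W) := fun u => match u with
    | .inl u => .inr (.inl u)
    | .inr (.inl u) => .inl (.inl u)
    | .inr (.inr w) => .inr (.inr w)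
  intro x y
  constructor
  · refine rel_comp_le _ _ (T := fun x y => x = y ∨ Q x y) 
      (trans_of_polarity (G := (ofWord (O :: O :: W)).game.arrow (ofWord (O :: W)).game) hQ) r ?_
      (hl.retract (T := fun x y => x = y ∨ Q x y) (fun _ => .inl rfl) _ ?_ ?_)
    · intro x y h
      rcases (hc x y).1 h with rfl | ⟨(u | u | w), ⟨hw, rfl, rfl⟩ | ⟨hw, rfl, rfl⟩⟩ | ⟨hb, rfl, rfl⟩
      · exact .inl rfl
      · exact absurd hw (by simp [swapEquiv])
      · exact .inr (.inl ⟨.inl u, .inr ⟨rfl, rfl, rfl⟩⟩)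
      · exact .inl rfl
      · exact .inl rfl
      · exact .inr (.inl ⟨.inr w, .inl ⟨hw, rfl, rfl⟩⟩)
      · exact .inr (.inl ⟨.inr w, .inr ⟨hw, rfl, rfl⟩⟩)
      · exact .inr (.inr ⟨.inl (), of_decide_eq_true hb, rfl, rfl⟩)
    · rintro (u | w) <;> rfl
    · rintro _ _ ⟨_, _, ⟨m, hm, rfl, rfl⟩, rfl, rfl⟩
      exact .inr (.inr ⟨.inr m, hm, rfl, rfl⟩)
  · rintro (rfl | ⟨(u | w), ⟨h, rfl, rfl⟩ | ⟨h, rfl, rfl⟩⟩ | ⟨(u | m), hm, rfl, rfl⟩)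
    · exact CyclicStrategy.refl _ _
    · exact absurd h (by simp)
    · exact (Path.right _ (hl.copy_O (.inl u) rfl)).trans (Path.left _ (hc.copy_O (.inl u) rfl))
    · exact (Path.left _ (hc.copy_P (.inr (.inr w)) h)).trans
        (Path.right _ (hl.copy_P (.inr w) h))
    · exact (Path.right _ (hl.copy_O (.inr w) h)).trans
        (Path.left _ (hc.copy_O (.inr (.inr w)) h))
    · exact (Path.right _ (hl.copy_O (.inl u) rfl)).trans
        (Path.left _ (hc.edge ⟨decide_eq_true hm, rfl, rfl⟩))
    · exact (Path.right _ (hl.edge ⟨_, _, ⟨m, hm, rfl, rfl⟩, rfl, rfl⟩)).trans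
        (Path.left _ (hc.copy_O (.inr (.inl ())) rfl))

/-- Addition of a letter `O` to any subset of the first letters `O` of a word. -/
theorem exists_add (n : ℕ) (B : List Polarity) (S : Letters (List.replicate n O ++ B) → Prop)
    (hS : ∀ m, S m → pos m < n) :
    ∃ k : Mor (O :: (List.replicate n O ++ B)) (List.replicate n O ++ B),
      HasRel (sem k) (Sum.inr : _ → Letters (O :: (List.replicate n O ++ B)))
        (fun w : Letters (List.replicate n O ++ B) => w) fun x y =>
          ∃ m, S m ∧ x = .inr m ∧ y = .inl (.inl ()) := by
  induction n with
  | zero =>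
    refine ⟨eps B, (hasRel_eps B).congr (Equiv.refl _) (fun _ => rfl) (fun _ => rfl) fun x y => ?_⟩
    exact iff_of_false (fun h => h) fun ⟨m, h, _⟩ => absurd (hS m h) (by simp)
  | succ n ih =>
    classical
    obtain ⟨k, hk⟩ := ih (fun m => S (.inr m)) fun m hm => Nat.lt_of_succ_lt_succ (hS _ hm)
    exact ⟨_, hasRel_cross_lw S (fun m hm => pol_of_pos_lt (n := n + 1) m (hS m hm)) hk⟩

/-! ### Inserting a letter after a prefix of letters O -/

/-- The first letter after `n` letters `O`. -/
def letterAt : ∀ (n : ℕ) (a : Polarity) (B : List Polarity),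
    Letters (List.replicate n O ++ a :: B)
  | 0, _, _ => .inl ()
  | n + 1, a, B => (.inr (letterAt n a B) : Letters (O :: (List.replicate n O ++ a :: B)))

/-- The inclusion of the other letters. -/
def skip : ∀ (n : ℕ) (a : Polarity) (B : List Polarity),
    Letters (List.replicate n O ++ B) → Letters (List.replicate n O ++ a :: B)
  | 0, _, _ => fun w => .inr w
  | n + 1, a, B => fun w =>
    (Sum.map (fun u : Unit => u) (skip n a B) (show Letters (O :: (List.replicate n O ++ B)) from w) :
      Letters (O :: (List.replicate n O ++ a :: B)))

section

variable (n : ℕ) (a : Polarity) (B : List Polarity)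

theorem pos_letterAt : pos (letterAt n a B) = n := by
  induction n with
  | zero => rfl
  | succ n ih => exact congrArg (· + 1) ih

theorem pol_letterAt : (ofWord (List.replicate n O ++ a :: B)).game.pol (letterAt n a B) = a := by
  induction n with
  | zero => rfl
  | succ n ih => exact ih

theorem pol_skip (w : Letters (List.replicate n O ++ B)) :
    (ofWord (List.replicate n O ++ a :: B)).game.pol (skip n a B w) =
      (ofWord (List.replicate n O ++ B)).game.pol w := by
  induction n with
  | zero => rfl
  | succ n ih =>
    change Letters (O :: (List.replicate n O ++ B)) at w
    rcases w with _ | w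
    · rfl
    · exact ih w

theorem skip_surjective (w : Letters (List.replicate n O ++ a :: B)) (hw : w ≠ letterAt n a B) :
    ∃ u, skip n a B u = w := by
  induction n with
  | zero =>
    rcases w with _ | w
    · exact absurd rfl hw
    · exact ⟨w, rfl⟩
  | succ n ih =>
    change Letters (O :: (List.replicate n O ++ a :: B)) at w
    rcases w with u | w
    · exact ⟨(.inl u : Letters (O :: (List.replicate n O ++ B))), rfl⟩
    · obtain ⟨u, hu⟩ := ih w fun h => hw (congrArg Sum.inr h)
      exact ⟨(.inr u : Letters (O :: (List.replicate n O ++ B))), congrArg Sum.inr hu⟩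

theorem skip_injective : Function.Injective (skip n a B) := by
  induction n with
  | zero => exact Sum.inr_injective
  | succ n ih => exact Sum.map_injective.2 ⟨fun _ _ h => h, ih⟩

theorem skip_mono (w w' : Letters (List.replicate n O ++ B)) (h : w ≤ w') :
    skip n a B w ≤ skip n a B w' := by
  induction n with
  | zero => exact .inr h
  | succ n ih =>
    change Letters (O :: (List.replicate n O ++ B)) at w w'
    change Sum.Lex _ _ _ _ at h
    cases h with
    | inl h => exact .inl h
    | inr h => exact .inr (ih _ _ h)
    | sep => exact .sep _ _

theorem le_of_pos_le {w : List Polarity} (x y : Letters w) (h : pos x ≤ pos y) : x ≤ y := by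
  induction w with
  | nil => exact x.elim
  | cons a w ih =>
    rcases x with x | x <;> rcases y with y | y
    · exact .inl le_rfl
    · exact .sep _ _
    · simp [pos] at h
    · exact .inr (ih x y (Nat.le_of_succ_le_succ h))

/-- Insertion of a new letter `P` after `n` letters `O`, justified by a new first letter. -/
theorem exists_insert : ∃ t : Mor (List.replicate n O ++ B) (O :: (List.replicate n O ++ P :: B)),
    HasRel (sem t) (fun w : Letters (List.replicate n O ++ B) => w)
      (fun w => (.inr (skip n P B w) : Letters (O :: (List.replicate n O ++ P :: B)))) fun x y =>
        x = .inr (.inl ()) ∧ y = .inr (.inr (letterAt n P B)) := by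
  induction n with
  | zero => exact ⟨etaOP B, hasRel_etaOP B⟩
  | succ n ih =>
    obtain ⟨t, ht⟩ := ih
    let W := List.replicate n O ++ B
    let W' := List.replicate n O ++ P :: B
    -- Behind the additional memory letter, `t` creates the cause in second position; the exchange
    -- brings it to the front.
    refine ⟨lw O t ≫ gam W', ?_⟩
    change HasRel (sem (lw O t ≫ gam W')) (fun w : Letters (O :: W) => w)
      (fun w => (.inr (Sum.map (fun u : Unit => u) (skip n P B) w) : Letters (O :: O :: W')))
      fun x y => x = .inr (.inl ()) ∧ y = .inr (.inr (.inr (letterAt n P B)))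
    rw [sem_comp]
    refine ((ht.lw O).comp_isCopy (isCopy_gam W')).congr (Equiv.refl _) ?_ ?_ ?_
    · rintro (_ | _) <;> rfl
    · rintro (_ | _) <;> rfl
    · intro x y
      constructor
      · rintro ⟨_, _, ⟨rfl, rfl⟩, hx, hy⟩
        rcases x with x | x <;> rcases y with y | y
        · exact absurd hx Sum.inl_ne_inr
        · exact absurd hx Sum.inl_ne_inr
        · exact absurd hy Sum.inl_ne_inr
        · exact ⟨congrArg Sum.inr ((Equiv.symm_apply_eq _).1 (Sum.inr_injective hx)),
            congrArg Sum.inr ((Equiv.symm_apply_eq _).1 (Sum.inr_injective hy))⟩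
      · rintro ⟨rfl, rfl⟩
        exact ⟨_, _, ⟨rfl, rfl⟩, rfl, rfl⟩

end

/-! ### Acyclicity and the realisation of strategies -/

/-- The inverse image of a cyclic strategy along an injection preserving polarities. -/
def pullback {G H : Game} (ρ : G.Moves → H.Moves) (hρ : Function.Injective ρ)
    (hpol : ∀ x, H.pol (ρ x) = G.pol x) (σ : CyclicStrategy H) : CyclicStrategy G where
  rel x y := σ.rel (ρ x) (ρ y)
  refl _ := σ.refl _
  trans _ _ _ := σ.trans _ _ _
  polarity x y h hxy := by
    have := σ.polarity _ _ h fun h => hxy (hρ h)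
    rwa [hpol, hpol] at this

/-- Absence of the short cycles formed by a cyclic strategy and causality. -/
structure IsAcyclic {A B : Games} (σ : CyclicStrategy (A.game.arrow B.game)) : Prop where
  left : ∀ a a', σ.rel (.inl a) (.inl a') → a' ≤ a → a = a'
  right : ∀ b b', σ.rel (.inr b) (.inr b') → b' ≤ b → b = b'
  cross : ∀ a a' b b', σ.rel (.inr b) (.inl a) → a ≤ a' → σ.rel (.inl a') (.inr b') → ¬ b' ≤ b

/-- Each excluded configuration is a cycle of edges and causality. These three kinds suffice for the
induction, and excluding them is stable under deleting and transposing letters. -/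
theorem isAcyclic_of_isStrategy {A B : Games} (σ : CyclicStrategy (A.game.arrow B.game))
    (h : IsStrategy (A.game.arrow B.game) σ.rel) : IsAcyclic σ := by
  let R := Relation.TransGen fun m n : (A.game.arrow B.game).Moves => σ.rel m n ∨ m ≤ n
  have anti : ∀ x y, R x y → R y x → x = y := fun x y => h.acyclic.antisymm x y
  have step : ∀ x y, σ.rel x y → R x y := fun x y h => .single (.inl h)
  have le_left : ∀ a a' : A.game.Moves, a ≤ a' → R (.inl a) (.inl a') := fun a a' h =>
    .single (.inr (arrow_le_inl.2 h))
  have le_right : ∀ b b' : B.game.Moves, b ≤ b' → R (.inr b) (.inr b') := fun b b' h =>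
    .single (.inr (arrow_le_inr.2 h))
  refine ⟨fun a a' h k => ?_, fun b b' h k => ?_, fun a a' b b' h k l m => ?_⟩
  · exact Sum.inl_injective (anti _ _ (step _ _ h) (le_left _ _ k))
  · exact Sum.inr_injective (anti _ _ (step _ _ h) (le_right _ _ k))
  · exact Sum.inl_ne_inr (anti (.inl a) (.inr b)
      (((le_left _ _ k).trans (step _ _ l)).trans (le_right _ _ m)) (step _ _ h))

section

variable {A B A' B' : Games}

theorem map_injective {i : A.game.Moves → A'.game.Moves} {j : B.game.Moves → B'.game.Moves}
    (hi : Function.Injective i) (hj : Function.Injective j) : Function.Injective (Sum.map i j) :=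
  Sum.map_injective.2 ⟨hi, hj⟩

theorem map_pol {i : A.game.Moves → A'.game.Moves} {j : B.game.Moves → B'.game.Moves}
    (hi : ∀ a, A'.game.pol (i a) = A.game.pol a) (hj : ∀ b, B'.game.pol (j b) = B.game.pol b)
    (x : (A.game.arrow B.game).Moves) :
    (A'.game.arrow B'.game).pol (Sum.map i j x) = (A.game.arrow B.game).pol x := by
  rcases x with a | b
  · exact congrArg Polarity.neg (hi a)
  · exact hj b

theorem IsAcyclic.pullback {σ : CyclicStrategy (A'.game.arrow B'.game)} (hσ : IsAcyclic σ)
    {i : A.game.Moves → A'.game.Moves} {j : B.game.Moves → B'.game.Moves}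
    (hi : Function.Injective i) (hj : Function.Injective j)
    (hi' : ∀ a, A'.game.pol (i a) = A.game.pol a) (hj' : ∀ b, B'.game.pol (j b) = B.game.pol b)
    (hi'' : ∀ a a', a ≤ a' → i a ≤ i a') (hj'' : ∀ b b', b ≤ b' → j b ≤ j b') :
    IsAcyclic (A := A) (B := B)
      (Games.pullback (Sum.map i j) (map_injective hi hj) (map_pol hi' hj') σ) where
  left _ _ h k := hi (hσ.left _ _ h (hi'' _ _ k))
  right _ _ h k := hj (hσ.right _ _ h (hj'' _ _ k))
  cross _ _ _ _ h k l m := hσ.cross _ _ _ _ h (hi'' _ _ k) l (hj'' _ _ m)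

end

theorem transposeMap_injective (A W : List Polarity) : Function.Injective (transposeMap A W) := by
  rintro (a | _ | w) (a' | _ | w') h <;> simp only [transposeMap, Sum.inl.injEq, Sum.inr.injEq,
    reduceCtorEq] at h
  · exact congrArg _ (Sum.inr_injective h)
  · rfl
  · rw [h]

theorem transposeMap_pol (A W : List Polarity)
    (x : ((ofWord A).game.arrow (ofWord (O :: W)).game).Moves) :
    ((ofWord (P :: A)).game.arrow (ofWord W).game).pol (transposeMap A W x) =
      ((ofWord A).game.arrow (ofWord (O :: W)).game).pol x := by
  rcases x with a | _ | w <;> rfl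

/-- The transposed letter is an Opponent move, so nothing else points to it, and it is the first
letter of the new target. It therefore takes part in no new cycle. -/
theorem IsAcyclic.transpose {A W : List Polarity}
    {σ : CyclicStrategy ((ofWord (P :: A)).game.arrow (ofWord W).game)}
    (hσ : IsAcyclic (A := ofWord (P :: A)) (B := ofWord W) σ) :
    IsAcyclic (A := ofWord A) (B := ofWord (O :: W))
      (Games.pullback (transposeMap A W) (transposeMap_injective A W) (transposeMap_pol A W) σ) := by
  have hp : ∀ x u, σ.rel x (.inl (.inl u)) → x = .inl (.inl u) := by
    intro x u h
    by_contra hx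
    exact absurd (σ.polarity _ _ h hx).2 (by simp [Polarity.neg])
  refine ⟨fun a a' h k => ?_, fun b b' h k => ?_, fun a a' b b' h k l m => ?_⟩
  · exact Sum.inr_injective (hσ.left _ _ h (.inr k))
  · rcases b with u | b <;> rcases b' with u' | b'
    · rfl
    · change Sum.Lex _ _ _ _ at k
      cases k
    · exact absurd (hp _ _ h) Sum.inr_ne_inl
    · change Sum.Lex _ _ _ _ at k
      cases k with | inr k => exact congrArg _ (hσ.right _ _ h k)
  · rcases b' with u' | b'
    · exact absurd (Sum.inl_injective (hp _ _ l)) Sum.inr_ne_inl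
    · rcases b with u | b
      · change Sum.Lex _ _ _ _ at m
        cases m
      · change Sum.Lex _ _ _ _ at m
        cases m with | inr m => exact hσ.cross _ _ _ _ h (.inr k) l m

theorem nonempty_mor_replicate (n : ℕ) : Nonempty (Mor [] (List.replicate n O ++ [])) := by
  induction n with
  | zero => exact ⟨𝟙 _⟩
  | succ n ih => exact ih.map fun f => f ≫ eta _

theorem allO_replicate (n : ℕ) : allO (List.replicate n O ++ []) := by
  induction n with
  | zero => rfl
  | succ n ih => exact ih

/-- `W` is split into a memory of `n` letters O and the letters `B` still to be processed. Keeping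
`W` as a variable with an equation lets the splitting move without casts. -/
theorem exists_sem_eq : ∀ (N n : ℕ) (A B W : List Polarity), A.length + B.length ≤ N →
    W = List.replicate n O ++ B →
    ∀ σ : CyclicStrategy ((ofWord A).game.arrow (ofWord W).game),
      IsAcyclic (A := ofWord A) (B := ofWord W) σ → ∃ f : Mor A W, (sem f).1 = σ := by
  have base : ∀ (n : ℕ) (σ : CyclicStrategy ((ofWord []).game.arrow
      (ofWord (List.replicate n O ++ [])).game)),
      ∃ f : Mor [] (List.replicate n O ++ []), (sem f).1 = σ := by
    intro n σ
    obtain ⟨f⟩ := nonempty_mor_replicate n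
    -- Here the arrow game has no Proponent move, so only the identity relation is possible.
    have hW : ∀ τ : CyclicStrategy ((ofWord []).game.arrow
        (ofWord (List.replicate n O ++ [])).game), ∀ x y, τ.rel x y → x = y := by
      intro τ x y h
      by_contra hxy
      rcases y with y | y
      · exact y.elim
      · have := (τ.polarity _ _ h hxy).2
        exact absurd (this.symm.trans (pol_of_allO (allO_replicate n) y)) (by simp)
    refine ⟨f, eq_of_rel (fun x y h => ?_) fun x y h hxy => absurd (hW _ _ _ h) hxy⟩
    rw [hW _ _ _ h]
    exact σ.refl _
  intro N
  induction N with
  | zero =>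
    rintro n A B _ hN rfl σ hσ
    obtain rfl : A = [] := List.length_eq_zero_iff.1 (by omega)
    obtain rfl : B = [] := List.length_eq_zero_iff.1 (by omega)
    exact base n σ
  | succ N ih =>
    have readO : ∀ (n : ℕ) (A B : List Polarity), (O :: A).length + B.length ≤ N + 1 →
        ∀ σ : CyclicStrategy ((ofWord (O :: A)).game.arrow
          (ofWord (List.replicate n O ++ B)).game),
        IsAcyclic (A := ofWord (O :: A)) (B := ofWord (List.replicate n O ++ B)) σ →
        (∀ x, σ.rel x (.inl (.inl ())) → x ≠ .inl (.inl ()) → ∃ m, x = .inr m ∧ pos m < n) →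
        ∃ f : Mor (O :: A) (List.replicate n O ++ B), (sem f).1 = σ := by
      intro n A B hN σ hσ h
      obtain ⟨f, hf⟩ := ih n A B _ (by simp only [List.length_cons] at hN; omega) rfl _
        (hσ.pullback (A := ofWord A) (B := ofWord (List.replicate n O ++ B)) (i := Sum.inr)
          (j := id) Sum.inr_injective Function.injective_id (fun _ => rfl) (fun _ => rfl)
          (fun _ _ h => .inr h) fun _ _ h => h)
      obtain ⟨k, hk⟩ := exists_add n B (fun m => σ.rel (.inr m) (.inl (.inl ()))) fun m hm => by
        obtain ⟨m', hm', h'⟩ := h _ hm Sum.inr_ne_inl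
        rwa [Sum.inr_injective hm']
      exact ⟨_, sem_readO σ f (fun x y => by rw [rel, hf]; exact Iff.rfl) k hk fun x hx hx' =>
        (h x hx hx').imp fun _ h => h.1⟩
    have readP : ∀ (n : ℕ) (A B : List Polarity), A.length + (P :: B).length ≤ N + 1 →
        ∀ σ : CyclicStrategy ((ofWord A).game.arrow
          (ofWord (List.replicate n O ++ P :: B)).game),
        IsAcyclic (A := ofWord A) (B := ofWord (List.replicate n O ++ P :: B)) σ →
        (∀ x, σ.rel x (.inr (letterAt n P B)) → x ≠ .inr (letterAt n P B) →
          ∃ m, x = .inr m ∧ pos m < n) →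
        ∃ f : Mor A (List.replicate n O ++ P :: B), (sem f).1 = σ := by
      intro n A B hN σ hσ h
      obtain ⟨f, hf⟩ := ih n A B _ (by simp only [List.length_cons] at hN; omega) rfl _
        (hσ.pullback (A := ofWord A) (B := ofWord (List.replicate n O ++ B)) (i := id)
          (j := skip n P B) Function.injective_id (skip_injective n P B) (fun _ => rfl)
          (pol_skip n P B) (fun _ _ h => h) (skip_mono n P B))
      have hpol := pol_letterAt n P B
      obtain ⟨k, hk⟩ := exists_add n (P :: B) (fun m => σ.rel (.inr m) (.inr (letterAt n P B)) ∧
          m ≠ letterAt n P B) fun m hm => by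
        obtain ⟨m', hm', h'⟩ := h _ hm.1 fun h => hm.2 (Sum.inr_injective h)
        rwa [Sum.inr_injective hm']
      obtain ⟨t, ht⟩ := exists_insert n B
      exact ⟨_, sem_readP σ (letterAt n P B) hpol (skip n P B) (skip_surjective n P B)
        (pol_skip n P B) f (fun x y => by rw [rel, hf]; exact Iff.rfl) t ht k hk fun x hx hx' =>
          (h x hx hx').imp fun _ h => h.1⟩
    rintro n A B _ hN rfl σ hσ
    have le_letterAt : ∀ (a : Polarity) (B : List Polarity)
        (m : Letters (List.replicate n O ++ a :: B)), ¬ pos m < n → letterAt n a B ≤ m :=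
      fun a B m hm => le_of_pos_le _ _ (by rw [pos_letterAt]; omega)
    match A, B, hN, σ, hσ with
    | A, O :: B, hN, σ, hσ =>
      -- The same word and the same strategy: the leading O of `B` is merely counted as a memory
      -- letter.
      refine ih (n + 1) A B _ (by simp only [List.length_cons] at hN; omega) ?_ σ hσ
      rw [List.replicate_succ', List.append_assoc]
      rfl
    | P :: A, B, hN, σ, hσ =>
      obtain ⟨f, hf⟩ := ih (n + 1) A B (O :: (List.replicate n O ++ B))
        (by simp only [List.length_cons] at hN; omega) rfl _ hσ.transpose
      exact ⟨_, sem_transpose σ f fun x y => by rw [rel, hf]; exact Iff.rfl⟩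
    | [], [], _, σ, _ => exact base n σ
    | O :: A, [], hN, σ, hσ =>
      refine readO n A [] hN σ hσ fun x hx hx' => ?_
      rcases x with a | b
      · exact absurd (congrArg _ (hσ.left _ _ hx (le_of_pos_le (w := O :: A) _ _ (Nat.zero_le _)))) hx'
      · exact ⟨b, rfl, (pos_lt b).trans_eq (by simp)⟩
    | [], P :: B, hN, σ, hσ =>
      refine readP n [] B hN σ hσ fun x hx hx' => ?_
      rcases x with a | b
      · exact a.elim
      · refine ⟨b, rfl, ?_⟩
        by_contra hb
        exact hx' (congrArg _ (hσ.right _ _ hx (le_letterAt P B b hb)))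
    | O :: A, P :: B, hN, σ, hσ =>
      -- If the leading source O does not depend on the memory alone, it depends on some `b` at or
      -- beyond the leading P of `B`. The P then depends on the memory alone.
      by_cases h : ∀ x, σ.rel x (.inl (.inl ())) → x ≠ .inl (.inl ()) → ∃ m, x = .inr m ∧ pos m < n
      · exact readO n A (P :: B) hN σ hσ h
      · refine readP n (O :: A) B hN σ hσ fun y hy hy' => ?_
        push Not at h
        obtain ⟨x, hx, hx', hxm⟩ := h
        rcases x with a | b
        · exact absurd (congrArg _ (hσ.left _ _ hx (le_of_pos_le (w := O :: A) _ _ (Nat.zero_le _)))) hx'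
        · have hb := le_letterAt P B b (by simpa using hxm b rfl)
          rcases y with a | b'
          · exact absurd hb (hσ.cross _ _ _ _ hx (le_of_pos_le (w := O :: A) _ _ (Nat.zero_le _)) hy)
          · refine ⟨b', rfl, ?_⟩
            by_contra hb'
            exact hy' (congrArg _ (hσ.right _ _ hy (le_letterAt P B b' hb')))

/-! ### Essential surjectivity and fullness -/

theorem pol_eq_getElem {w : List Polarity} (x : Letters w) :
    (ofWord w).game.pol x = w[pos x]'(pos_lt x) := by
  induction w with
  | nil => exact x.elim
  | cons a w ih =>
    rcases x with _ | x
    · rfl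
    · exact ih x

/-- Every finite filiform game is, up to relabelling, the game of a word. -/
theorem exists_word (C : Games) : ∃ (w : List Polarity) (e : Letters w ≃ C.game.Moves),
    (∀ x, C.game.pol (e x) = (ofWord w).game.pol x) ∧ ∀ x y, x ≤ y ↔ e x ≤ e y := by
  classical
  have := C.finite
  have := Fintype.ofFinite C.game.Moves
  let _ : LinearOrder C.game.Moves :=
    { C.game.order with
      le_total := C.total
      toDecidableLE := Classical.decRel _ }
  let o : Fin (Fintype.card C.game.Moves) ≃o C.game.Moves :=
    Fintype.orderIsoFinOfCardEq C.game.Moves rfl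
  let w := List.ofFn fun i => C.game.pol (o i)
  have hw : w.length = Fintype.card C.game.Moves := List.length_ofFn
  let f : Letters w → C.game.Moves := fun x => o ⟨pos x, (pos_lt x).trans_eq hw⟩
  have hf : Function.Bijective f := by
    refine ⟨fun x y h => pos_injective (Fin.mk.inj (o.injective h)), fun c => ?_⟩
    obtain ⟨x, hx⟩ := exists_pos (w := w) ((o.symm c).2.trans_eq hw.symm)
    exact ⟨x, (congrArg o (Fin.ext hx)).trans (o.apply_symm_apply c)⟩
  refine ⟨w, Equiv.ofBijective f hf, fun x => ?_, fun x y => ?_⟩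
  · rw [pol_eq_getElem]
    simp [w, f]
  · have key : f x ≤ f y ↔ pos x ≤ pos y := o.le_iff_le
    refine Iff.trans ⟨fun h => ?_, le_of_pos_le x y⟩ key.symm
    rcases Nat.le_total (pos x) (pos y) with h' | h'
    · exact h'
    · rw [le_antisymm h (le_of_pos_le y x h')]

/-- Every morphism is the meaning of a formal one, up to relabelling its source and target. -/
theorem exists_sem_eq_conj {A B : Games} {σ : A.game ⟶ B.game} (h : IsMorphism σ) :
    ∀ (X Y : List Polarity) (e : Letters X ≃ A.game.Moves) (e' : Letters Y ≃ B.game.Moves)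
      (he : ∀ x, A.game.pol (e x) = (ofWord X).game.pol x) (hle : ∀ x y, x ≤ y ↔ e x ≤ e y)
      (he' : ∀ x, B.game.pol (e' x) = (ofWord Y).game.pol x) (hle' : ∀ x y, x ≤ y ↔ e' x ≤ e' y),
      ∃ f : Mor X Y, sem f = (isoOf (A := ofWord X) e he hle).hom ≫ (⟨σ, h⟩ : A ⟶ B) ≫
        (isoOf (A := ofWord Y) e' he' hle').inv := by
  induction h with
  | @strategy A B σ h =>
    intro X Y e e' he hle he' hle'
    obtain ⟨f, hf⟩ := exists_sem_eq _ 0 X Y Y le_rfl rfl _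
      ((isAcyclic_of_isStrategy σ h).pullback (A := ofWord X) (B := ofWord Y) e.injective
        e'.injective he he' (fun a a' => (hle a a').1) fun a a' => (hle' a a').1)
    refine ⟨f, hom_ext_of_rel fun x y => ?_⟩
    rw [hf]
    refine Iff.trans ?_ (rel_isCopy_comp (isCopy_of_eq_isoOf rfl).1 _ x y).symm
    refine Iff.trans ?_ (rel_comp_isCopy _ (isCopy_of_eq_isoOf rfl).2 _ _).symm
    rcases x with x | x <;> rcases y with y | y <;> rfl
  | @comp A B C σ τ hσ hτ ih₁ ih₂ =>
    intro X Z e e' he hle he' hle'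
    -- The intermediate game is replaced by a word, and the two relabellings of it cancel.
    -- Composites may be cyclic, so only their strategy factors are realised directly.
    obtain ⟨Y, d, hd, hdle⟩ := exists_word B
    obtain ⟨f, hf⟩ := ih₁ X Y e d he hle hd hdle
    obtain ⟨g, hg⟩ := ih₂ Y Z d e' hd hdle he' hle'
    refine ⟨f ≫ g, ?_⟩
    have hc : ∀ (f : A ⟶ B) (g : B ⟶ C), (⟨f.1 ≫ g.1, .comp _ _ f.2 g.2⟩ : A ⟶ C) = f ≫ g :=
      fun _ _ => rfl
    rw [sem_comp, hf, hg, hc ⟨σ, hσ⟩ ⟨τ, hτ⟩]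
    simp only [Category.assoc, Iso.inv_hom_id_assoc]

theorem semantics_full : semantics.Full where
  map_surjective {X Y} σ := by
    obtain ⟨f, hf⟩ := exists_sem_eq_conj σ.2 X.word Y.word (Equiv.refl _) (Equiv.refl _)
      (fun _ => rfl) (fun _ _ => Iff.rfl) (fun _ => rfl) fun _ _ => Iff.rfl
    refine ⟨f, hf.trans (hom_ext_of_rel fun x y => ?_)⟩
    refine (rel_isCopy_comp (isCopy_of_eq_isoOf rfl).1 _ x y).trans ?_
    refine (rel_comp_isCopy _ (isCopy_of_eq_isoOf rfl).2 _ _).trans ?_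
    rcases x with x | x <;> rcases y with y | y <;> rfl

theorem semantics_essSurj : semantics.EssSurj where
  mem_essImage C := by
    obtain ⟨w, e, he, hle⟩ := exists_word C
    exact ⟨⟨w⟩, ⟨isoOf (A := ofWord w) e he hle⟩⟩

theorem semantics_isEquivalence : semantics.IsEquivalence where
  faithful := semantics_faithful
  full := semantics_full
  essSurj := semantics_essSurj

end Games

/-- A theory presents every category to which the one it generates is equivalent by a monoidal
functor. -/
theorem Theory.presents_of_equivalence {T : Theory} {C : Type*} [Category C] [MonoidalCategory C]
    (e : Presented T ≌ C) [m : e.functor.Monoidal] : T.Presents C := by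
  -- The monoidal structure transported along the adjunction is the one for which the unit and
  -- counit are monoidal.
  let n : e.inverse.Monoidal := e.inverseMonoidal
  have h : e.IsMonoidal := { leftAdjoint_ε := rfl, leftAdjoint_μ := fun _ _ => rfl }
  exact ⟨e, m, n, inferInstanceAs (NatTrans.IsMonoidal e.unit),
    inferInstanceAs (NatTrans.IsMonoidal e.counit)⟩

end Causality

theorem mainTheorem1 : Causality.stratTheory.Presents Causality.Games := by
  have := Causality.Games.semantics_isEquivalence
  exact Causality.Theory.presents_of_equivalence Causality.Games.semantics.asEquivalence
    (m := inferInstanceAs Causality.Games.semantics.Monoidal)
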